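/- Let $\Gamma=\mathrm{SL}_2(\mathbb Z)$, $k\in\mathbb R$, $s\in\mathbb C$, let $\rho$ be a unitary representation of $\Gamma$ on a finite-dimensional complex inner product space $X$, and let $v_k(\gamma)=\eta^{2k}(\gamma z)/\bigl((cz+d)^k\eta^{2k}(z)\bigr)$, where $\eta^{2k}(z)=e^{\pi i kz/6}\prod_{n\ge1}(1-e^{2\pi i nz})^{2k}$, $\gamma=\begin{pmatrix}a&b\\c&d\end{pmatrix}$ and $-\pi<\arg(cz+d)\le\pi$. Put $S=\begin{pmatrix}0&-1\\1&0\end{pmatrix}$, $T=\begin{pmatrix}1&1\\0&1\end{pmatrix}$, $T'=\begin{pmatrix}1&0\\1&1\end{pmatrix}$. Maass cusp forms: $\mathcal A^0_k(s,\rho v_k)$ is the space of smooth $u:\mathfrak H\to X$ on the upper half-plane with $\rho(\gamma)^{-1}v_k(\gamma)^{-1}e^{-ik\arg(cz+d)}u(\gamma z)=u(z)$ for all $\gamma\in\Gamma$, with $(-y^2\partial_x^2-y^2\partial_y^2+iky\,\partial_x)u=s(1-s)u$, and with $u(x+iy)=O(e^{-ay})$ as $y\uparrow\infty$ for some $a>0$,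 uniformly for $x$ in compact sets. Action: for functions $\varphi$ on $\mathbb P^1(\mathbb R)$, or on an open subset, put $$(\varphi|\gamma)(t)=\rho(\gamma)^{-1}v_k(\gamma)^{-1}(a-ic)^{-s+k/2}(a+ic)^{-s-k/2}\Bigl(\tfrac{t-i}{t-\gamma^{-1}i}\Bigr)^{s-k/2}\Bigl(\tfrac{t+i}{t-\gamma^{-1}(-i)}\Bigr)^{s+k/2}\varphi(\gamma t),$$ with $-\pi\le\arg(a-ic)<\pi$, $-\pi<\arg(a+ic)\le\pi$, and the continuous branches of the last two powers on $\mathbb P^1(\mathbb R)$ with value $1$ at $t=\infty$. Period functions: $\mathrm{FE}^\omega_{\rho v_k,s,k}$ is the space of real-analytic $f:(0,\infty)\to X$ with values in the $1$-eigenspace of $|(-I_2)$, with $f=f|T+f|T'$ on $(0,\infty)$, such that the limits $a_0=\lim_{t\downarrow0}f(t)$ and $a_\infty=\lim_{t\uparrow\infty}f(t)$ exist and satisfy $a_0=-\rho(S)a_\infty$, and such that $f$ extends holomorphically to a wedge $\{z\neq0:|\arg z|<\delta\}$ for some $\delta\in(0,\pi/2)$. Integrals: put $R_{s,k}(t,z)=y^s\bigl(\tfrac{t-i}{t-z}\bigr)^{s-k/2}\bigl(\tfrac{t+i}{t-\bar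 z}\bigr)^{s+k/2}$ (with the same branches) and $$[u,v]_k=\bigl(\partial_zu\cdot v+\tfrac{k}{4iy}uv\bigr)dz+\bigl(u\,\partial_{\bar z}v-\tfrac{k}{4iy}uv\bigr)d\bar z.$$ For $u\in\mathcal A^0_k(s,\rho v_k)$ and cusps $\xi_1,\xi_2\in\mathbb P^1(\mathbb Q)$ let $c^u(\xi_1,\xi_2)(t)=\int_{\xi_1}^{\xi_2}[u,R_{s,k}(t,\cdot)]_k$ for $t\in\mathbb P^1(\mathbb R)$, taken along the geodesic from $\xi_1$ to $\xi_2$ (and $0$ if $\xi_1=\xi_2$), and let $P(u)=c^u(0,\infty)$. **Proposition.** (1) For every $u\in\mathcal A^0_k(s,\rho v_k)$ these integrals converge absolutely for all $\xi_1,\xi_2$ and $t$, and: (a) $P(u)$ has values in the $1$-eigenspace of $|(-I_2)$, i.e. $P(u)|(-I_2)=P(u)$; (b) $P(u)=-P(u)|S=P(u)|T+P(u)|T'$ on $\mathbb P^1(\mathbb R)$; (c) $P(u)$ is real-analytic on $(-\infty,0)\cup(0,\infty)$ and continuous on $\mathbb P^1(\mathbb R)$; (d) the restriction of $P(u)$ to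 $\mathbb R\setminus\{0\}$ has a holomorphic extension to $\mathbb C\setminus i\mathbb R$; (e) for all $\xi_1,\xi_2\in\mathbb P^1(\mathbb Q)$ there are finitely many $\gamma_j\in\Gamma$ with $c^u(\xi_1,\xi_2)=\sum_jP(u)|\gamma_j$. (2) The restriction $u\mapsto P(u)|_{(0,\infty)}$ is a linear map from $\mathcal A^0_k(s,\rho v_k)$ to $\mathrm{FE}^\omega_{\rho v_k,s,k}$. (3) For each $f\in\mathrm{FE}^\omega_{\rho v_k,s,k}$ there is a unique continuous function $p:\mathbb P^1(\mathbb R)\to X$, real-analytic outside a finite set of cusps, that satisfies (a), (b) and (c) (with $p$ in place of $P(u)$) and has restriction $p|_{(0,\infty)}=f$. -/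

import Mathlib

open scoped MatrixGroups UpperHalfPlane ContDiff InnerProductSpace

noncomputable section

namespace MaassPeriod

/-! ### The multiplier system -/

/-- `η^{2k}(z) = e^{πikz/6} ∏_{n ≥ 1} (1 - e^{2πinz})^{2k}`, with principal powers of the factors
(each of them lies in the right half-plane). -/
def etaPow (k : ℝ) (z : ℍ) : ℂ :=
  Complex.exp (Real.pi * Complex.I * k * (z : ℂ) / 6) *
    ∏' n : ℕ, (1 - Complex.exp (2 * Real.pi * Complex.I * ((n : ℂ) + 1) * (z : ℂ))) ^ (2 * (k : ℂ))

/-- `c z + d` for an integral matrix with lower row `(c, d)`. -/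
def autFactor (γ : SL(2, ℤ)) (z : ℍ) : ℂ := ((γ 1 0 : ℤ) : ℂ) * (z : ℂ) + ((γ 1 1 : ℤ) : ℂ)

/-- The multiplier system `v_k(γ) = η^{2k}(γ z) / ((c z + d)^k η^{2k}(z))` with
`-π < arg (c z + d) ≤ π`. The quotient does not depend on `z`; it is evaluated at `z = i`. -/
def mult (k : ℝ) (γ : SL(2, ℤ)) : ℂ :=
  etaPow k (γ • UpperHalfPlane.I) /
    (autFactor γ UpperHalfPlane.I ^ (k : ℂ) * etaPow k UpperHalfPlane.I)

variable {V : Type*} [NormedAddCommGroup V] [InnerProductSpace ℂ V]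

set_option linter.unusedSectionVars false

/-! ### Maass cusp forms -/

/-- The action `u |_{ρ v_k, k} γ` on `V`-valued functions on the upper half-plane:
`ρ(γ)⁻¹ v_k(γ)⁻¹ e^{-ik arg(cz+d)} u(γ z)`. -/
def slash (ρ : SL(2, ℤ) →* (V ≃ₗᵢ[ℂ] V)) (k : ℝ) (γ : SL(2, ℤ)) (u : ℍ → V) (z : ℍ) : V :=
  ((mult k γ)⁻¹ * Complex.exp (-(Complex.I * k * (Complex.arg (autFactor γ z) : ℂ)))) •
    ρ γ⁻¹ (u (γ • z))

/-- A function on `ℍ` seen as a function of a complex variable (only its values on the open upper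
half-plane matter). -/
def lift {X : Type*} (u : ℍ → X) : ℂ → X := u ∘ UpperHalfPlane.ofComplex

/-- `∂_x` at `z = x + i y`. -/
def dX (f : ℂ → V) (z : ℂ) : V := fderiv ℝ f z 1

/-- `∂_y` at `z = x + i y`. -/
def dY (f : ℂ → V) (z : ℂ) : V := fderiv ℝ f z Complex.I

/-- The Wirtinger derivative `∂_z = (∂_x - i ∂_y) / 2`. -/
def dZ (f : ℂ → V) (z : ℂ) : V := (1 / 2 : ℂ) • (dX f z - Complex.I • dY f z)

/-- The Wirtinger derivative `∂_{z̄} = (∂_x + i ∂_y) / 2`. -/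
def dZbar (f : ℂ → V) (z : ℂ) : V := (1 / 2 : ℂ) • (dX f z + Complex.I • dY f z)

/-- `Δ_k = - y² ∂_x² - y² ∂_y² + i k y ∂_x` on functions on the upper half-plane. -/
def maassLaplacian (k : ℝ) (u : ℍ → V) (z : ℍ) : V :=
  -(((z.im : ℂ) ^ 2) • Laplacian.laplacian (lift u) (z : ℂ)) +
    (Complex.I * k * (z.im : ℂ)) • dX (lift u) (z : ℂ)

/-- Smoothness on the upper half-plane. -/
def IsSmooth (u : ℍ → V) : Prop := ∀ z : ℍ, ContDiffAt ℝ ∞ (lift u) (z : ℂ)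

/-- For some `a > 0`: `u(x + i y) = O(e^{-a y})` as `y ↑ ∞`, uniformly for `x` in compact sets. -/
def ExpDecay (u : ℍ → V) : Prop :=
  ∃ a : ℝ, 0 < a ∧ ∀ K : Set ℝ, IsCompact K → ∃ C Y : ℝ,
    ∀ z : ℍ, z.re ∈ K → Y ≤ z.im → ‖u z‖ ≤ C * Real.exp (-a * z.im)

theorem dX_add {f g : ℂ → V} {z : ℂ} (hf : DifferentiableAt ℝ f z)
    (hg : DifferentiableAt ℝ g z) : dX (f + g) z = dX f z + dX g z := by
  simp [dX, fderiv_add hf hg]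

theorem dX_smul (c : ℂ) {f : ℂ → V} {z : ℂ} (hf : DifferentiableAt ℝ f z) :
    dX (c • f) z = c • dX f z := by
  simp [dX, fderiv_const_smul hf c]

/-- The space `A⁰_k(s, ρ v_k)` of Maass cusp forms of weight `k`, spectral parameter `s` and
multiplier system `ρ v_k`. -/
def cuspForms (ρ : SL(2, ℤ) →* (V ≃ₗᵢ[ℂ] V)) (k : ℝ) (s : ℂ) : Submodule ℂ (ℍ → V) where
  carrier := {u | IsSmooth u ∧ (∀ γ : SL(2, ℤ), slash ρ k γ u = u) ∧
    (∀ z : ℍ, maassLaplacian k u z = (s * (1 - s)) • u z) ∧ ExpDecay u}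
  zero_mem' := by
    refine ⟨fun z => ?_, fun γ => ?_, fun z => ?_, 1, one_pos, fun K _ => ⟨0, 0, ?_⟩⟩
    · exact contDiffAt_const
    · funext z; simp [slash]
    · have h : lift (0 : ℍ → V) = fun _ => 0 := rfl
      have h2 : Laplacian.laplacian (fun _ : ℂ => (0 : V)) = 0 :=
        InnerProductSpace.laplacian_const
      simp [maassLaplacian, h, h2, dX]
    · simp
  add_mem' := by
    rintro u v ⟨hu1, hu2, hu3, a, ha, hu4⟩ ⟨hv1, hv2, hv3, b, hb, hv4⟩
    have hl : lift (u + v) = lift u + lift v := rfl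
    refine ⟨fun z => ?_, fun γ => ?_, fun z => ?_, min a b, lt_min ha hb, fun K hK => ?_⟩
    · rw [hl]; exact (hu1 z).add (hv1 z)
    · funext z
      have h1 := congrFun (hu2 γ) z
      have h2 := congrFun (hv2 γ) z
      simp only [slash] at h1 h2
      simp only [slash, Pi.add_apply, map_add, smul_add, h1, h2]
    · have h1 := hu3 z
      have h2 := hv3 z
      have hle : (2 : WithTop ℕ∞) ≤ ∞ := WithTop.coe_le_coe.2 le_top
      simp only [maassLaplacian] at h1 h2 ⊢
      rw [hl, ContDiffAt.laplacian_add ((hu1 z).of_le hle) ((hv1 z).of_le hle),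
        dX_add ((hu1 z).differentiableAt (by simp)) ((hv1 z).differentiableAt (by simp)),
        Pi.add_apply, smul_add, smul_add, smul_add, ← h1, ← h2]
      abel
    · obtain ⟨C, Y, h⟩ := hu4 K hK
      obtain ⟨D, Z, h'⟩ := hv4 K hK
      refine ⟨max C 0 + max D 0, max Y (max Z 0), fun z hz hy => ?_⟩
      have hy0 : 0 ≤ z.im := z.im_pos.le
      have e1 : Real.exp (-a * z.im) ≤ Real.exp (-(min a b) * z.im) :=
        Real.exp_le_exp.mpr (mul_le_mul_of_nonneg_right (neg_le_neg (min_le_left _ _)) hy0)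
      have e2 : Real.exp (-b * z.im) ≤ Real.exp (-(min a b) * z.im) :=
        Real.exp_le_exp.mpr (mul_le_mul_of_nonneg_right (neg_le_neg (min_le_right _ _)) hy0)
      have i1 : ‖u z‖ ≤ max C 0 * Real.exp (-(min a b) * z.im) :=
        (h z hz ((le_max_left _ _).trans hy)).trans
          (mul_le_mul (le_max_left _ _) e1 (Real.exp_nonneg _) (le_max_right _ _))
      have i2 : ‖v z‖ ≤ max D 0 * Real.exp (-(min a b) * z.im) :=
        (h' z hz (((le_max_left _ _).trans (le_max_right _ _)).trans hy)).trans
          (mul_le_mul (le_max_left _ _) e2 (Real.exp_nonneg _) (le_max_right _ _))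
      rw [add_mul]
      exact (norm_add_le _ _).trans (add_le_add i1 i2)
  smul_mem' := by
    rintro c u ⟨hu1, hu2, hu3, a, ha, hu4⟩
    have hl : lift (c • u) = c • lift u := rfl
    refine ⟨fun z => ?_, fun γ => ?_, fun z => ?_, a, ha, fun K hK => ?_⟩
    · rw [hl]; exact (hu1 z).const_smul c
    · funext z
      have h1 := congrFun (hu2 γ) z
      simp only [slash] at h1
      simp only [slash, Pi.smul_apply, map_smul]
      rw [smul_comm, h1]
    · have h1 := hu3 z
      have hle : (2 : WithTop ℕ∞) ≤ ∞ := WithTop.coe_le_coe.2 le_top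
      simp only [maassLaplacian] at h1 ⊢
      rw [hl, InnerProductSpace.laplacian_smul c ((hu1 z).of_le hle),
        dX_smul c ((hu1 z).differentiableAt (by simp)),
        Pi.smul_apply, smul_comm _ c (u z), ← h1, smul_add, smul_neg, smul_comm c, smul_comm c]
    · obtain ⟨C, Y, h⟩ := hu4 K hK
      refine ⟨‖c‖ * C, Y, fun z hz hy => ?_⟩
      rw [Pi.smul_apply, norm_smul, mul_assoc]
      exact mul_le_mul_of_nonneg_left (h z hz hy) (norm_nonneg c)

/-! ### Principal series action on functions on the projective line

The projective line `P¹(ℝ)` is `OnePoint ℝ`, with the action of `GL₂(ℝ)` by fractional linear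
transformations. -/

/-- `(t - p) / (t - q)` for `t` in `P¹(ℝ)`, with value `1` at `t = ∞`. -/
def crossQuot (t : OnePoint ℝ) (p q : ℂ) : ℂ :=
  t.elim 1 (fun x : ℝ => ((x : ℂ) - p) / ((x : ℂ) - q))

/-- The power `w ^ a` for the convention `-π ≤ arg w < π` (and `w ≠ 0`). -/
def lowPow (w a : ℂ) : ℂ :=
  Complex.exp (starRingEnd ℂ (Complex.log (starRingEnd ℂ w)) * a)

/-- The factor in front of `φ(g t)` in `(φ |_{s,k} g)(t)`:
`(a-ic)^{-s+k/2} (a+ic)^{-s-k/2} ((t-i)/(t-g⁻¹i))^{s-k/2} ((t+i)/(t-g⁻¹(-i)))^{s+k/2}`.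
Here `g⁻¹(-i)` is the complex conjugate of `g⁻¹ i`. For `p` and `q` both in the upper (both in the
lower) half-plane, `(t - p)/(t - q)` avoids `(-∞, 0]` for all `t` in `P¹(ℝ)`, so the
principal power is the continuous branch on `P¹(ℝ)` with value `1` at `∞`; this branch is
holomorphic in `t` outside the line segment from `p` to `q`. -/
def prsFactor (s : ℂ) (k : ℝ) (g : SL(2, ℝ)) (t : OnePoint ℝ) : ℂ :=
  lowPow ((g 0 0 : ℂ) - Complex.I * (g 1 0 : ℂ)) (-s + (k : ℂ) / 2) *
  ((g 0 0 : ℂ) + Complex.I * (g 1 0 : ℂ)) ^ (-s - (k : ℂ) / 2) *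
  crossQuot t Complex.I ((g⁻¹ • UpperHalfPlane.I : ℍ) : ℂ) ^ (s - (k : ℂ) / 2) *
  crossQuot t (-Complex.I) (starRingEnd ℂ ((g⁻¹ • UpperHalfPlane.I : ℍ) : ℂ)) ^ (s + (k : ℂ) / 2)

/-- The action `φ |_{ρ v_k, s, k} γ` on `V`-valued functions on `P¹(ℝ)`:
`ρ(γ)⁻¹ v_k(γ)⁻¹ (φ |_{s,k} γ)(t)`. -/
def prs (ρ : SL(2, ℤ) →* (V ≃ₗᵢ[ℂ] V)) (k : ℝ) (s : ℂ) (γ : SL(2, ℤ))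
    (φ : OnePoint ℝ → V) (t : OnePoint ℝ) : V :=
  ((mult k γ)⁻¹ * prsFactor s k (Matrix.SpecialLinearGroup.map (Int.castRingHom ℝ) γ) t) •
    ρ γ⁻¹ (φ (Matrix.SpecialLinearGroup.mapGL ℝ γ • t))

/-- The matrix `S` with rows `(0, -1)` and `(1, 0)`. -/
def matS : SL(2, ℤ) := ⟨!![0, -1; 1, 0], by simp⟩

/-- The matrix `T` with rows `(1, 1)` and `(0, 1)`. -/
def matT : SL(2, ℤ) := ⟨!![1, 1; 0, 1], by simp⟩

/-- The matrix `T'` with rows `(1, 0)` and `(1, 1)`. -/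
def matT' : SL(2, ℤ) := ⟨!![1, 0; 1, 1], by simp⟩

/-- The point `-1/x` of `P¹(ℝ)`; as a function of `x` this is a chart around `∞`. -/
def chartInfty (x : ℝ) : OnePoint ℝ :=
  if x = 0 then OnePoint.infty else ((-x⁻¹ : ℝ) : OnePoint ℝ)

/-- Real-analyticity of a function on `P¹(ℝ)` at a point. -/
def AnalyticAtP1 (φ : OnePoint ℝ → V) (t : OnePoint ℝ) : Prop :=
  t.elim (AnalyticAt ℝ (fun x => φ (chartInfty x)) 0)
    (fun x₀ : ℝ => AnalyticAt ℝ (fun x : ℝ => φ (x : OnePoint ℝ)) x₀)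

/-- The inclusion of `P¹(ℚ)`, the set of cusps, in `P¹(ℝ)`. -/
def cuspToReal (ξ : OnePoint ℚ) : OnePoint ℝ := ξ.map (fun q : ℚ => (q : ℝ))

/-- Membership in `V^{ω⁰,0}(P¹(ℝ))`: continuous functions on `P¹(ℝ)` that are real-analytic
outside a finite set of cusps. -/
def IsSemiAnalytic (φ : OnePoint ℝ → V) : Prop :=
  Continuous φ ∧ ∃ E : Finset (OnePoint ℚ), ∀ t : OnePoint ℝ,
    (∀ ξ ∈ E, cuspToReal ξ ≠ t) → AnalyticAtP1 φ t

/-! ### Period functions -/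

/-- A function on `(0, ∞)` as a function on `P¹(ℝ)`, extended by zero. It is only used to evaluate
the action of `γ` at points `t` with `γ t ∈ (0, ∞)`, and for local properties at points of
`(0, ∞)`. -/
def extZero (f : Set.Ioi (0 : ℝ) → V) : OnePoint ℝ → V :=
  Function.extend (fun t : Set.Ioi (0 : ℝ) => ((t : ℝ) : OnePoint ℝ)) f 0

/-- The wedge `W_δ = {z ≠ 0 : |arg z| < δ}`. -/
def wedge (δ : ℝ) : Set ℂ := {z | z ≠ 0 ∧ |z.arg| < δ}

theorem extZero_zero : extZero (0 : Set.Ioi (0 : ℝ) → V) = 0 := by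
  funext t
  simp only [extZero, Function.extend]
  split <;> rfl

theorem extZero_add (f g : Set.Ioi (0 : ℝ) → V) : extZero (f + g) = extZero f + extZero g := by
  have h := Function.extend_add (fun t : Set.Ioi (0 : ℝ) => ((t : ℝ) : OnePoint ℝ)) f g 0 0
  simpa [extZero] using h

theorem extZero_smul (c : ℂ) (f : Set.Ioi (0 : ℝ) → V) : extZero (c • f) = c • extZero f := by
  have h := Function.extend_smul c (fun t : Set.Ioi (0 : ℝ) => ((t : ℝ) : OnePoint ℝ)) f 0
  simpa [extZero] using h

theorem prs_zero (ρ : SL(2, ℤ) →* (V ≃ₗᵢ[ℂ] V)) (k : ℝ) (s : ℂ) (γ : SL(2, ℤ)) :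
    prs ρ k s γ 0 = 0 := by
  funext t; simp [prs]

theorem prs_add (ρ : SL(2, ℤ) →* (V ≃ₗᵢ[ℂ] V)) (k : ℝ) (s : ℂ) (γ : SL(2, ℤ))
    (φ ψ : OnePoint ℝ → V) : prs ρ k s γ (φ + ψ) = prs ρ k s γ φ + prs ρ k s γ ψ := by
  funext t; simp [prs]

theorem prs_smul (ρ : SL(2, ℤ) →* (V ≃ₗᵢ[ℂ] V)) (k : ℝ) (s : ℂ) (γ : SL(2, ℤ))
    (c : ℂ) (φ : OnePoint ℝ → V) : prs ρ k s γ (c • φ) = c • prs ρ k s γ φ := by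
  funext t; simp [prs, smul_comm c]

/-- The space `FE^ω_{ρ v_k, s, k}` of period functions: real-analytic functions `f` on `(0, ∞)`
with values in the `1`-eigenspace of `-I₂`, satisfying `f = f|T + f|T'` on `(0, ∞)`, with
limits `a_0`, `a_∞` at `0` and `∞` such that `a_0 = - ρ(S) a_∞`, and with a holomorphic
extension to some wedge. -/
def periodFunctions (ρ : SL(2, ℤ) →* (V ≃ₗᵢ[ℂ] V)) (k : ℝ) (s : ℂ) :
    Submodule ℂ (Set.Ioi (0 : ℝ) → V) where
  carrier := {f |
    (∀ t : ℝ, 0 < t → AnalyticAtP1 (extZero f) (t : OnePoint ℝ)) ∧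
    (∀ t : ℝ, 0 < t → prs ρ k s (-1) (extZero f) (t : OnePoint ℝ) = extZero f t) ∧
    (∀ t : ℝ, 0 < t → extZero f (t : OnePoint ℝ) =
      prs ρ k s matT (extZero f) t + prs ρ k s matT' (extZero f) t) ∧
    (∃ a₀ a₁ : V,
      Filter.Tendsto (fun t : ℝ => extZero f (t : OnePoint ℝ)) Filter.atTop (nhds a₁) ∧
      Filter.Tendsto (fun t : ℝ => extZero f (t : OnePoint ℝ)) (nhdsWithin 0 (Set.Ioi 0))
        (nhds a₀) ∧
      a₀ = -(ρ matS a₁)) ∧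
    (∃ δ : ℝ, 0 < δ ∧ δ < Real.pi / 2 ∧ ∃ F : ℂ → V, DifferentiableOn ℂ F (wedge δ) ∧
      ∀ t : ℝ, 0 < t → F (t : ℂ) = extZero f (t : OnePoint ℝ))}
  zero_mem' := by
    refine ⟨fun t _ => ?_, fun t _ => ?_, fun t _ => ?_, ⟨0, 0, ?_, ?_, ?_⟩,
      Real.pi / 4, by positivity, by linarith [Real.pi_pos], 0, ?_, ?_⟩
    · rw [extZero_zero]; exact (analyticAt_const : AnalyticAt ℝ (fun _ : ℝ => (0 : V)) t)
    · simp [extZero_zero, prs_zero]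
    · simp [extZero_zero, prs_zero]
    · rw [extZero_zero]; exact tendsto_const_nhds
    · rw [extZero_zero]; exact tendsto_const_nhds
    · simp
    · exact differentiableOn_const 0
    · simp [extZero_zero]
  add_mem' := by
    rintro f g ⟨f1, f2, f3, ⟨a₀, a₁, f4, f5, f6⟩, δ, d1, d2, F, f7, f8⟩
      ⟨g1, g2, g3, ⟨b₀, b₁, g4, g5, g6⟩, ε, e1, e2, G, g7, g8⟩
    refine ⟨fun t ht => ?_, fun t ht => ?_, fun t ht => ?_, ⟨a₀ + b₀, a₁ + b₁, ?_, ?_, ?_⟩,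
      min δ ε, lt_min d1 e1, (min_le_left _ _).trans_lt d2, F + G, ?_, fun t ht => ?_⟩
    · rw [extZero_add]
      exact AnalyticAt.add (f1 t ht) (g1 t ht)
    · rw [extZero_add, prs_add, Pi.add_apply, f2 t ht, g2 t ht, Pi.add_apply]
    · rw [extZero_add, prs_add, prs_add, Pi.add_apply, f3 t ht, g3 t ht, Pi.add_apply,
        Pi.add_apply]
      abel
    · rw [extZero_add]; exact f4.add g4
    · rw [extZero_add]; exact f5.add g5
    · rw [f6, g6, map_add]; abel
    · exact (f7.mono fun z hz => ⟨hz.1, hz.2.trans_le (min_le_left _ _)⟩).add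
        (g7.mono fun z hz => ⟨hz.1, hz.2.trans_le (min_le_right _ _)⟩)
    · rw [extZero_add, Pi.add_apply, Pi.add_apply, f8 t ht, g8 t ht]
  smul_mem' := by
    rintro c f ⟨f1, f2, f3, ⟨a₀, a₁, f4, f5, f6⟩, δ, d1, d2, F, f7, f8⟩
    refine ⟨fun t ht => ?_, fun t ht => ?_, fun t ht => ?_, ⟨c • a₀, c • a₁, ?_, ?_, ?_⟩,
      δ, d1, d2, c • F, ?_, fun t ht => ?_⟩
    · rw [extZero_smul]
      exact AnalyticAt.const_smul (f1 t ht)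
    · rw [extZero_smul, prs_smul, Pi.smul_apply, f2 t ht, Pi.smul_apply]
    · rw [extZero_smul, prs_smul, prs_smul, Pi.smul_apply, f3 t ht, Pi.smul_apply,
        Pi.smul_apply, smul_add]
    · rw [extZero_smul]; exact f4.const_smul c
    · rw [extZero_smul]; exact f5.const_smul c
    · rw [f6, map_smul, smul_neg]
    · exact f7.const_smul c
    · rw [extZero_smul, Pi.smul_apply, Pi.smul_apply, f8 t ht]

/-! ### Poisson kernel, Green's form and integrals between cusps -/

/-- `R_{s,k}(t, z) = y^s ((t-i)/(t-z))^{s-k/2} ((t+i)/(t-z̄))^{s+k/2}`, with the continuous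
branches on `P¹(ℝ)` that have value `1` at `t = ∞`. -/
def poissonKernel (s : ℂ) (k : ℝ) (t : OnePoint ℝ) (z : ℍ) : ℂ :=
  (z.im : ℂ) ^ s * crossQuot t Complex.I (z : ℂ) ^ (s - (k : ℂ) / 2) *
    crossQuot t (-Complex.I) (starRingEnd ℂ (z : ℂ)) ^ (s + (k : ℂ) / 2)

/-- Green's form
`[u, v]_k = (∂_z u · v + k/(4iy) u v) dz + (u · ∂_{z̄} v - k/(4iy) u v) dz̄`
at the point `z`, evaluated on the tangent vector `w` (so `dz` is `w` and `dz̄` is `w̄`). -/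
def greenForm (k : ℝ) (u : ℍ → V) (v : ℍ → ℂ) (z w : ℂ) : V :=
  w • (lift v z • dZ (lift u) z +
      (((k : ℂ) / (4 * Complex.I * (z.im : ℂ))) * lift v z) • lift u z) +
    (starRingEnd ℂ w) • (dZbar (lift v) z • lift u z -
      (((k : ℂ) / (4 * Complex.I * (z.im : ℂ))) * lift v z) • lift u z)

/-- A parametrization by `τ ∈ (0, ∞)` of the hyperbolic geodesic from the cusp `ξ₁` (at `τ = 0`)
to the cusp `ξ₂` (at `τ = ∞`); it is a constant path if `ξ₁ = ξ₂`. -/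
def cuspPath : OnePoint ℚ → OnePoint ℚ → ℝ → ℂ
  | none, none => fun _ => Complex.I
  | some a, none => fun τ => (a : ℂ) + Complex.I * (τ : ℂ)
  | none, some b => fun τ => (b : ℂ) + Complex.I * ((τ⁻¹ : ℝ) : ℂ)
  | some a, some b => fun τ =>
      ((a : ℂ) + Complex.I * ((SignType.sign (b - a) : ℤ) : ℂ) * (τ : ℂ) * (b : ℂ)) /
        (1 + Complex.I * ((SignType.sign (b - a) : ℤ) : ℂ) * (τ : ℂ))

/-- The pull-back of `η_{s,k}(u) = [u, R_{s,k}(t, ·)]_k` to `(0, ∞)` under the geodesic path from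
`ξ₁` to `ξ₂`. -/
def etaPullback (k : ℝ) (s : ℂ) (u : ℍ → V) (ξ₁ ξ₂ : OnePoint ℚ) (t : OnePoint ℝ) (τ : ℝ) : V :=
  greenForm k u (poissonKernel s k t) (cuspPath ξ₁ ξ₂ τ) (deriv (cuspPath ξ₁ ξ₂) τ)

/-- `c^u_par(ξ₁, ξ₂)(t) = ∫_{ξ₁}^{ξ₂} [u, R_{s,k}(t, ·)]_k`. -/
def parCocycle (k : ℝ) (s : ℂ) (u : ℍ → V) (ξ₁ ξ₂ : OnePoint ℚ) (t : OnePoint ℝ) : V :=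
  ∫ τ in Set.Ioi (0 : ℝ), etaPullback k s u ξ₁ ξ₂ t τ

/-- `P(u) = c^u_par(0, ∞)`, the integral along the positive imaginary axis. -/
def periodIntegral (k : ℝ) (s : ℂ) (u : ℍ → V) : OnePoint ℝ → V :=
  parCocycle k s u ((0 : ℚ) : OnePoint ℚ) OnePoint.infty

/-- Values in the `1`-eigenspace of the action of `-I₂`. -/
def EigenNegOne (ρ : SL(2, ℤ) →* (V ≃ₗᵢ[ℂ] V)) (k : ℝ) (s : ℂ) (p : OnePoint ℝ → V) : Prop :=
  prs ρ k s (-1) p = p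

/-- `p = - p|S = p|T + p|T'`. -/
def PeriodRelations (ρ : SL(2, ℤ) →* (V ≃ₗᵢ[ℂ] V)) (k : ℝ) (s : ℂ)
    (p : OnePoint ℝ → V) : Prop :=
  p = -prs ρ k s matS p ∧ p = prs ρ k s matT p + prs ρ k s matT' p

/-- Real-analytic on `(-∞, 0) ∪ (0, ∞)`, and continuous on all of `P¹(ℝ)`. -/
def AnalyticOffZeroInfty (p : OnePoint ℝ → V) : Prop :=
  (∀ t : ℝ, t ≠ 0 → AnalyticAtP1 p (t : OnePoint ℝ)) ∧ Continuous p

/-- Existence of a holomorphic extension from `ℝ ∖ {0}` to `ℂ ∖ iℝ`. -/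
def HasHolomorphicExtension (p : OnePoint ℝ → V) : Prop :=
  ∃ F : ℂ → V, DifferentiableOn ℂ F {z | z.re ≠ 0} ∧
    ∀ t : ℝ, t ≠ 0 → F (t : ℂ) = p (t : OnePoint ℝ)

end MaassPeriod

end

noncomputable section

namespace MaassPeriod

open Filter Topology Complex

/-! ### The multiplier system -/

/-! For fixed `t` the Green form `[u, R_{s,k}(t, ·)]_k` is a closed one-form on the upper
half-plane: the eigenvalue equation of `u` and the explicit logarithmic derivatives of the Poisson
kernel make the two mixed derivatives agree (`green_closed`). It is also equivariant: moving `t` and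
`z` by `γ` changes it exactly by `ρ(γ)` and the scalar of the action `|γ` (`greenCLM_smul`). A cusp
form and its gradient decay exponentially while the kernel grows only polynomially, so a primitive
of the form has a limit at every cusp, and `c^u(ξ₁, ξ₂)` is the difference of two such limits
(`etaPullback_integral`). Hence `c^u` is additive in the cusps and `c^u(γξ₁, γξ₂)|γ = c^u(ξ₁, ξ₂)`
(`prs_parCocycle`).

The algebraic statements follow from this. The matrix `-1` fixes `0` and `∞`, while `S` exchanges
them. The path from `0` to `∞` broken at `-1` gives the three-term relation. Since `S` and `T`
generate the group, every integral between cusps is a sum of translates of `P(u)`.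

Three points need analysis. For real weight the multiplier and the powers involve choices of
arguments, and the identities must hold exactly, not modulo `2π`; in each case a continuous function
with values in `2πiℤ` on the connected upper half-plane is constant and is evaluated at a good point
(`etaDefect_eq`, `arg_cocycle`). The definition of a cusp form gives decay of `u` only; decay of its
gradient comes from an interior elliptic estimate, proved by the maximum principle with a quadratic
barrier (`norm_fderiv_le_of_norm_lap_le`). Along the imaginary axis the kernel is holomorphic in `t`
off `iℝ`, and an integrable majorant, locally uniform in `t`, makes the integral holomorphic there;
a majorant uniform over `P¹(ℝ)` gives continuity.

For the extension of a period function, `p = -p|S` prescribes `p` on the negative half-line and the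
condition on `a₀` and `a_∞` is precisely continuity at `0` and `∞`. The defect of the three-term
relation is invariant under `S T'`, which has order three modulo `±1` and permutes the intervals cut
out by `0`, `-1`, `∞`, so vanishing on `(0, ∞)` spreads everywhere (`three_term_of_pos`). -/

/-- A continuous function on the upper half-plane with `exp ∘ f = 1` is constant. -/
theorem eq_of_continuous_of_exp_eq_one {f : ℍ → ℂ} (hf : Continuous f)
    (h : ∀ z, Complex.exp (f z) = 1) (z w : ℍ) : f z = f w := by
  choose n hn using fun z => Complex.exp_eq_one_iff.1 (h z)
  have hpi : (2 * Real.pi * Complex.I : ℂ) ≠ 0 := Complex.two_pi_I_ne_zero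
  -- The integer `n z` varies continuously with `z`, so it is constant on the connected upper
  -- half-plane.
  have hc : Continuous n := by
    rw [Int.isClosedEmbedding_coe_real.isInducing.continuous_iff]
    have : ((↑) : ℤ → ℝ) ∘ n = fun z => (f z / (2 * Real.pi * Complex.I)).re := by
      funext z
      simp [hn z, hpi]
    rw [this]
    exact Complex.continuous_re.comp (hf.div_const _)
  rw [hn, hn, PreconnectedSpace.constant inferInstance hc (x := z) (y := w)]

/-- The logarithm of the eta function. -/
def etaLog (z : ℍ) : ℂ :=
  Real.pi * Complex.I * (z : ℂ) / 12 +
    ∑' n : ℕ, Complex.log (1 - Complex.exp (2 * Real.pi * Complex.I * (z : ℂ)) ^ (n + 1))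

/-- A majorant that is summable in `n` and uniform on `‖q‖ ≤ r`, for the Weierstrass test that makes
`etaLog` continuous. -/
theorem norm_log_one_sub_pow_le {q : ℂ} {r : ℝ} (hr : r < 1) (hq : ‖q‖ ≤ r) (n : ℕ) :
    ‖Complex.log (1 - q ^ (n + 1))‖ ≤ (1 / (1 - r) + 1) * r ^ (n + 1) := by
  have hr0 : 0 ≤ r := (norm_nonneg _).trans hq
  have hp : ‖-q ^ (n + 1)‖ ≤ r ^ (n + 1) := by
    rw [norm_neg, norm_pow]; exact pow_le_pow_left₀ (norm_nonneg _) hq _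
  have hp1 : r ^ (n + 1) ≤ r := pow_le_of_le_one hr0 hr.le (by simp)
  have h1 : ‖-q ^ (n + 1)‖ < 1 := by linarith
  have := Complex.norm_log_one_add_le h1
  rw [← sub_eq_add_neg] at this
  refine this.trans ?_
  set x := ‖-q ^ (n + 1)‖
  have hx0 : 0 ≤ x := norm_nonneg _
  have h2 : (1 - x)⁻¹ ≤ 1 / (1 - r) := by
    rw [one_div]; exact inv_anti₀ (by linarith) (by linarith)
  have h3 : 0 ≤ 1 / (1 - r) := by have : 0 < 1 - r := by linarith
                                  positivity
  have h4 : 0 ≤ (1 - x)⁻¹ := by have : 0 < 1 - x := by linarith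
                                positivity
  calc x ^ 2 * (1 - x)⁻¹ / 2 + x ≤ x * (1 / (1 - r)) + x := by
        have : x ^ 2 * (1 - x)⁻¹ ≤ x * (1 / (1 - r)) :=
          mul_le_mul (by nlinarith) h2 h4 hx0
        have : 0 ≤ x ^ 2 * (1 - x)⁻¹ := by positivity
        linarith
    _ = (1 / (1 - r) + 1) * x := by ring
    _ ≤ _ := by gcongr

theorem summable_log_one_sub_pow {q : ℂ} (hq : ‖q‖ < 1) :
    Summable fun n : ℕ => Complex.log (1 - q ^ (n + 1)) := by
  refine Summable.of_norm_bounded (g := fun n => (1 / (1 - ‖q‖) + 1) * ‖q‖ ^ (n + 1)) ?_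
    fun n => norm_log_one_sub_pow_le hq le_rfl n
  exact ((summable_nat_add_iff 1).2
    (summable_geometric_of_lt_one (norm_nonneg _) hq)).mul_left _

theorem one_sub_pow_mem_slitPlane {q : ℂ} (hq : ‖q‖ < 1) (n : ℕ) :
    1 - q ^ (n + 1) ∈ Complex.slitPlane := by
  have : ‖q ^ (n + 1)‖ < 1 := by
    rw [norm_pow]; exact pow_lt_one₀ (norm_nonneg _) hq (by simp)
  have := Complex.mem_slitPlane_of_norm_lt_one (z := -q ^ (n + 1)) (by simpa using this)
  rwa [← sub_eq_add_neg] at this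

theorem continuousOn_tsum_log_one_sub_pow :
    ContinuousOn (fun q : ℂ => ∑' n : ℕ, Complex.log (1 - q ^ (n + 1))) (Metric.ball 0 1) := by
  intro q hq
  rw [mem_ball_zero_iff] at hq
  obtain ⟨r, hr1, hr2⟩ := exists_between hq
  have : ContinuousOn (fun q : ℂ => ∑' n : ℕ, Complex.log (1 - q ^ (n + 1)))
      (Metric.ball 0 r) := by
    refine continuousOn_tsum (u := fun n => (1 / (1 - r) + 1) * r ^ (n + 1)) (fun n => ?_) ?_
      fun n x hx => norm_log_one_sub_pow_le hr2 (mem_ball_zero_iff.1 hx).le n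
    · refine ContinuousOn.clog (by fun_prop) fun x hx => ?_
      exact one_sub_pow_mem_slitPlane ((mem_ball_zero_iff.1 hx).trans hr2) n
    · exact ((summable_nat_add_iff 1).2
        (summable_geometric_of_lt_one ((norm_nonneg _).trans hr1.le) hr2)).mul_left _
  exact (this.continuousAt (Metric.isOpen_ball.mem_nhds (mem_ball_zero_iff.2 hr1))
    ).continuousWithinAt

theorem norm_nome_lt_one (z : ℍ) : ‖Complex.exp (2 * Real.pi * Complex.I * (z : ℂ))‖ < 1 :=
  UpperHalfPlane.norm_exp_two_pi_I_lt_one z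

theorem continuous_etaLog : Continuous etaLog := by
  unfold etaLog
  refine Continuous.add (by fun_prop) ?_
  exact continuousOn_tsum_log_one_sub_pow.comp_continuous (by fun_prop) fun z =>
    mem_ball_zero_iff.2 (norm_nome_lt_one z)

theorem nome_pow (z : ℍ) (n : ℕ) : Complex.exp (2 * Real.pi * Complex.I * (z : ℂ)) ^ (n + 1) =
    Complex.exp (2 * Real.pi * Complex.I * ((n : ℂ) + 1) * (z : ℂ)) := by
  rw [← Complex.exp_nat_mul]; congr 1; push_cast; ring

/-- The principal power of each factor is the exponential of `2k` times its principal logarithm, and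
the logarithms are summable. All real powers of eta are thus governed by one continuous logarithm.
-/
theorem etaPow_eq_exp (k : ℝ) (z : ℍ) : etaPow k z = Complex.exp (2 * k * etaLog z) := by
  have hs := summable_log_one_sub_pow (norm_nome_lt_one z)
  have h : ∀ n : ℕ, (1 - Complex.exp (2 * Real.pi * Complex.I * ((n : ℂ) + 1) * (z : ℂ))) ^
      (2 * (k : ℂ)) = Complex.exp (Complex.log
        (1 - Complex.exp (2 * Real.pi * Complex.I * (z : ℂ)) ^ (n + 1)) * (2 * k)) := by
    intro n
    rw [← nome_pow, Complex.cpow_def_of_ne_zero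
      (Complex.slitPlane_ne_zero (one_sub_pow_mem_slitPlane (norm_nome_lt_one z) n))]
  rw [etaPow, etaLog]
  simp_rw [h]
  have := (hs.mul_right (2 * (k : ℂ))).hasSum.cexp.tprod_eq
  simp only [Function.comp_def] at this
  rw [this, tsum_mul_right, ← Complex.exp_add]
  congr 1; ring

theorem exp_etaLog (z : ℍ) : Complex.exp (etaLog z) = ModularForm.eta z := by
  have hs := summable_log_one_sub_pow (norm_nome_lt_one z)
  have := hs.hasSum.cexp.tprod_eq
  simp only [Function.comp_def] at this
  rw [etaLog, Complex.exp_add, ← this, ModularForm.eta]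
  congr 1
  · rw [Function.Periodic.qParam]; congr 1; push_cast; ring
  · congr 1
    funext n
    rw [Complex.exp_log
      (Complex.slitPlane_ne_zero (one_sub_pow_mem_slitPlane (norm_nome_lt_one z) n)),
      ModularForm.eta_q_eq_pow]

theorem autFactor_eq_denom (γ : SL(2, ℤ)) (z : ℍ) :
    autFactor γ z = UpperHalfPlane.denom γ z := by
  simp [autFactor, UpperHalfPlane.denom]

theorem autFactor_ne_zero (γ : SL(2, ℤ)) (z : ℍ) : autFactor γ z ≠ 0 := by
  rw [autFactor_eq_denom]; exact UpperHalfPlane.denom_ne_zero _ _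

theorem coe_smul_eq (γ : SL(2, ℤ)) (z : ℍ) :
    ((γ • z : ℍ) : ℂ) = ((γ 0 0 : ℂ) * z + (γ 0 1 : ℂ)) / autFactor γ z := by
  rw [UpperHalfPlane.coe_specialLinearGroup_apply]
  simp [autFactor]

theorem det_eq_one (γ : SL(2, ℤ)) : (γ 0 0 : ℂ) * γ 1 1 - (γ 0 1 : ℂ) * γ 1 0 = 1 := by
  have := γ.det_coe
  rw [Matrix.det_fin_two] at this
  exact_mod_cast this

theorem autFactor_mul (δ γ : SL(2, ℤ)) (z : ℍ) :
    autFactor (δ * γ) z = autFactor δ (γ • z) * autFactor γ z := by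
  have h := autFactor_ne_zero γ z
  rw [autFactor.eq_def δ, coe_smul_eq]
  field_simp
  simp only [autFactor, Matrix.SpecialLinearGroup.coe_mul, Matrix.mul_apply, Fin.sum_univ_two]
  push_cast
  ring

/-- `exp (24 * etaLog)` is the discriminant, a form of weight 12 with trivial character, so no root
of unity occurs at this exponent. -/
theorem exp_etaLog_smul (γ : SL(2, ℤ)) (z : ℍ) :
    Complex.exp (24 * etaLog (γ • z)) = autFactor γ z ^ 12 * Complex.exp (24 * etaLog z) := by
  have h := congrFun (SlashInvariantForm.slash_action_generators_SL2Z
    ModularForm.discriminant_S_invariant ModularForm.discriminant_T_invariant γ) z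
  rw [ModularForm.SL_slash_apply] at h
  have e : ∀ w : ℍ, Complex.exp (24 * etaLog w) = ModularForm.discriminant w := fun w => by
    rw [ModularForm.discriminant, ← exp_etaLog, ← Complex.exp_nat_mul]; norm_num
  rw [e, e, ← h, autFactor_eq_denom]
  have := UpperHalfPlane.denom_ne_zero (γ : GL (Fin 2) ℝ) z
  field_simp

theorem continuous_autFactor (γ : SL(2, ℤ)) : Continuous (autFactor γ) := by
  unfold autFactor; fun_prop

theorem autFactor_mem_slitPlane {γ : SL(2, ℤ)} (h : γ 1 0 ≠ 0) (z : ℍ) :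
    autFactor γ z ∈ Complex.slitPlane := by
  right
  have h1 : ((γ 1 0 : ℤ) : ℝ) ≠ 0 := Int.cast_ne_zero.2 h
  simpa [autFactor] using! ⟨h, z.im_pos.ne'⟩

theorem continuous_smul_upperHalfPlane (γ : SL(2, ℤ)) : Continuous fun z : ℍ => γ • z := by
  rw [UpperHalfPlane.isOpenEmbedding_coe.isInducing.continuous_iff]
  have : (fun z : ℍ => (z : ℂ)) ∘ (fun z : ℍ => γ • z) =
      fun z : ℍ => ((γ 0 0 : ℂ) * z + (γ 0 1 : ℂ)) / autFactor γ z := by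
    funext z; exact coe_smul_eq γ z
  rw [this]
  exact Continuous.div (by fun_prop) (continuous_autFactor γ) (autFactor_ne_zero γ)

/-- For `c = 0` the factor is constant, so it does no harm that `d = -1` lies on the branch cut; for
`c ≠ 0` the imaginary part `c y` keeps it off the cut. -/
theorem continuous_log_autFactor (γ : SL(2, ℤ)) :
    Continuous fun z => Complex.log (autFactor γ z) := by
  by_cases h : γ 1 0 = 0
  · simp only [autFactor, h]
    simpa using continuous_const
  · exact (continuous_autFactor γ).clog fun z => autFactor_mem_slitPlane h z

/-- `log η(γz) - log η(z) - log(cz + d) / 2`, a constant. -/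
def etaDefect (γ : SL(2, ℤ)) (z : ℍ) : ℂ :=
  etaLog (γ • z) - etaLog z - Complex.log (autFactor γ z) / 2

/-- By the weight 12 law, `24 * etaDefect` is a continuous function that exponentiates to one, hence
constant. This is why `mult`, defined through its value at `i`, can be computed at any point. -/
theorem etaDefect_eq (γ : SL(2, ℤ)) (z w : ℍ) : etaDefect γ z = etaDefect γ w := by
  have hc : Continuous (etaDefect γ) := by
    unfold etaDefect
    refine ((continuous_etaLog.comp (continuous_smul_upperHalfPlane γ)).sub continuous_etaLog).sub
      ((continuous_log_autFactor γ).div_const 2)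
  have h := eq_of_continuous_of_exp_eq_one (f := fun z => 24 * etaDefect γ z)
    (continuous_const.mul hc) (fun z => ?_) z w
  · simpa using h
  · have e : 24 * etaDefect γ z = 24 * etaLog (γ • z) - 24 * etaLog z
        - (12 : ℕ) * Complex.log (autFactor γ z) := by rw [etaDefect]; push_cast; ring
    rw [e, Complex.exp_sub, Complex.exp_sub, Complex.exp_nat_mul,
      Complex.exp_log (autFactor_ne_zero γ z), exp_etaLog_smul]
    have := autFactor_ne_zero γ z
    field_simp

theorem mult_eq_exp (k : ℝ) (γ : SL(2, ℤ)) (z : ℍ) :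
    mult k γ = Complex.exp (2 * k * etaDefect γ z) := by
  rw [etaDefect_eq γ z UpperHalfPlane.I, mult, etaPow_eq_exp, etaPow_eq_exp,
    Complex.cpow_def_of_ne_zero (autFactor_ne_zero _ _), ← Complex.exp_add, ← Complex.exp_sub,
    etaDefect]
  congr 1; ring

theorem mult_ne_zero (k : ℝ) (γ : SL(2, ℤ)) : mult k γ ≠ 0 := by
  rw [mult_eq_exp k γ UpperHalfPlane.I]; exact Complex.exp_ne_zero _

/-- The phase `e^{ik arg(cz + d)}`. -/
def phase (k : ℝ) (γ : SL(2, ℤ)) (z : ℍ) : ℂ :=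
  Complex.exp (Complex.I * k * (Complex.arg (autFactor γ z) : ℂ))

theorem phase_ne_zero (k : ℝ) (γ : SL(2, ℤ)) (z : ℍ) : phase k γ z ≠ 0 := Complex.exp_ne_zero _

/-- The argument of `c z + d` inside the multiplier cancels against the phase. What remains consists
of differences of `etaLog` and of `log ‖c z + d‖`, both additive along products, so the cocycle
relation needs no correction of branches. -/
theorem mult_mul_phase (k : ℝ) (γ : SL(2, ℤ)) (z : ℍ) :
    mult k γ * phase k γ z =
      Complex.exp (2 * k * (etaLog (γ • z) - etaLog z) - k * Real.log ‖autFactor γ z‖) := by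
  rw [mult_eq_exp k γ z, phase, ← Complex.exp_add, etaDefect]
  congr 1
  have : Complex.log (autFactor γ z) =
    Real.log ‖autFactor γ z‖ + Complex.arg (autFactor γ z) * Complex.I := rfl
  rw [this]; ring

/-- The cocycle relation of the multiplier system. -/
theorem mult_mul_phase_mul (k : ℝ) (δ γ : SL(2, ℤ)) (z : ℍ) :
    mult k (δ * γ) * phase k (δ * γ) z =
      (mult k δ * phase k δ (γ • z)) * (mult k γ * phase k γ z) := by
  rw [mult_mul_phase, mult_mul_phase, mult_mul_phase, ← Complex.exp_add, autFactor_mul, norm_mul,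
    Real.log_mul (norm_ne_zero_iff.2 (autFactor_ne_zero _ _))
      (norm_ne_zero_iff.2 (autFactor_ne_zero _ _)), mul_smul]
  congr 1; push_cast; ring

end MaassPeriod

end

noncomputable section

namespace MaassPeriod

open Filter Topology Complex

/-! ### Equivariance of the Poisson kernel -/

/-- The action of the modular group on `P¹(ℝ)`. -/
def bdAct (γ : SL(2, ℤ)) (t : OnePoint ℝ) : OnePoint ℝ := Matrix.SpecialLinearGroup.mapGL ℝ γ • t

theorem bdAct_mul (δ γ : SL(2, ℤ)) (t : OnePoint ℝ) :
    bdAct (δ * γ) t = bdAct δ (bdAct γ t) := by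
  simp [bdAct, mul_smul]

theorem bdAct_one (t : OnePoint ℝ) : bdAct 1 t = t := by simp [bdAct]

theorem bdAct_infty (γ : SL(2, ℤ)) : bdAct γ OnePoint.infty =
    if (γ 1 0 : ℝ) = 0 then OnePoint.infty else (((γ 0 0 : ℝ) / (γ 1 0 : ℝ) : ℝ) : OnePoint ℝ) := by
  rw [bdAct, OnePoint.smul_infty_eq_ite]; simp

theorem bdAct_coe (γ : SL(2, ℤ)) (x : ℝ) : bdAct γ (x : OnePoint ℝ) =
    if (γ 1 0 : ℝ) * x + (γ 1 1 : ℝ) = 0 then OnePoint.infty else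
      ((((γ 0 0 : ℝ) * x + (γ 0 1 : ℝ)) / ((γ 1 0 : ℝ) * x + (γ 1 1 : ℝ)) : ℝ) : OnePoint ℝ) := by
  rw [bdAct, OnePoint.smul_some_eq_ite]; simp

@[simp] theorem crossQuot_infty (p q : ℂ) : crossQuot OnePoint.infty p q = 1 := rfl

@[simp] theorem crossQuot_coe (x : ℝ) (p q : ℂ) :
    crossQuot (x : OnePoint ℝ) p q = ((x : ℂ) - p) / ((x : ℂ) - q) := rfl

theorem ofReal_sub_ne_zero (x : ℝ) {z : ℂ} (hz : z.im ≠ 0) : (x : ℂ) - z ≠ 0 := by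
  intro h
  have := congrArg Complex.im h
  simp at this
  exact hz this

theorem crossQuot_ne_zero (t : OnePoint ℝ) {p q : ℂ} (hp : p.im ≠ 0) (hq : q.im ≠ 0) :
    crossQuot t p q ≠ 0 := by
  cases t with
  | infty => simp
  | coe x => exact div_ne_zero (ofReal_sub_ne_zero x hp) (ofReal_sub_ne_zero x hq)

theorem crossQuot_conj (t : OnePoint ℝ) (p q : ℂ) :
    crossQuot t (starRingEnd ℂ p) (starRingEnd ℂ q) = starRingEnd ℂ (crossQuot t p q) := by
  cases t with
  | infty => simp
  | coe x => simp

theorem crossQuot_self (t : OnePoint ℝ) {p : ℂ} (hp : p.im ≠ 0) : crossQuot t p p = 1 := by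
  cases t with
  | infty => simp
  | coe x => exact div_self (ofReal_sub_ne_zero x hp)

theorem crossQuot_mul (t : OnePoint ℝ) {p q : ℂ} (r : ℂ) (hq : q.im ≠ 0) :
    crossQuot t p q * crossQuot t q r = crossQuot t p r := by
  cases t with
  | infty => simp
  | coe x =>
    have := ofReal_sub_ne_zero x hq
    simp only [crossQuot_coe]
    field_simp

/-- If `(t - i)/(t - z) = -λ` with `λ ≥ 0`, then `t = (i + λ z)/(1 + λ)` lies on the segment from
`i` to `z`, inside the upper half-plane, although `t` is real. -/
theorem crossQuot_mem_slitPlane (t : OnePoint ℝ) (z : ℍ) :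
    crossQuot t Complex.I (z : ℂ) ∈ Complex.slitPlane := by
  cases t with
  | infty => simp
  | coe x =>
    have hz : (x : ℂ) - z ≠ 0 := ofReal_sub_ne_zero x z.im_pos.ne'
    have hn : 0 < Complex.normSq ((x : ℂ) - z) := Complex.normSq_pos.2 hz
    rw [crossQuot_coe, Complex.mem_slitPlane_iff]
    by_contra! h
    obtain ⟨h1, h2⟩ := h
    rw [Complex.div_re] at h1
    rw [Complex.div_im] at h2
    simp at h1 h2
    rw [← add_div, div_le_iff₀ hn] at h1
    rw [← sub_div, div_eq_zero_iff] at h2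
    have h3 := h2.resolve_right hn.ne'
    have hy := z.im_pos
    have h4 : x - z.re = x * z.im := by linarith
    rw [h4] at h1
    nlinarith [mul_nonneg hy.le (sq_nonneg x)]

/-- With `j(w) = c w + d` one has `γ t - γ p = (t - p)/(j(t) j(p))`, and `j(t)` drops out of the
quotient, which also settles `t = ∞` and the pole of `γ`. Images and factors are free variables tied
by equations, so that conjugate points in the lower half-plane are covered. -/
theorem crossQuot_smul (γ : SL(2, ℤ)) (t : OnePoint ℝ) {p q p' q' jp jq : ℂ} (hq : q.im ≠ 0)
    (hjp : (γ 1 0 : ℂ) * p + (γ 1 1 : ℂ) = jp) (hjq : (γ 1 0 : ℂ) * q + (γ 1 1 : ℂ) = jq)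
    (hp' : p' * jp = (γ 0 0 : ℂ) * p + (γ 0 1 : ℂ))
    (hq' : q' * jq = (γ 0 0 : ℂ) * q + (γ 0 1 : ℂ)) (hq'0 : q'.im ≠ 0) (hjp0 : jp ≠ 0)
    (hjq0 : jq ≠ 0) :
    crossQuot (bdAct γ t) p' q' * jp = jq * crossQuot t p q := by
  have hdet := det_eq_one γ
  have hp2 : p' = ((γ 0 0 : ℂ) * p + (γ 0 1 : ℂ)) / jp := by field_simp; exact hp'
  have hq2 : q' = ((γ 0 0 : ℂ) * q + (γ 0 1 : ℂ)) / jq := by field_simp; exact hq'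
  cases t with
  | infty =>
    rw [bdAct_infty]
    split_ifs with h
    · have h' : (γ 1 0 : ℂ) = 0 := by exact_mod_cast h
      rw [← hjp, ← hjq, h']; simp
    · have h' : (γ 1 0 : ℂ) ≠ 0 := by exact_mod_cast h
      rw [crossQuot_infty, crossQuot_coe]
      have h1 := ofReal_sub_ne_zero ((γ 0 0 : ℝ) / (γ 1 0 : ℝ)) hq'0
      push_cast at h1 ⊢
      rw [div_mul_eq_mul_div, div_eq_iff h1, hp2, hq2]
      field_simp
      rw [← hjp, ← hjq]
      ring
  | coe x =>
    have hxq := ofReal_sub_ne_zero x hq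
    rw [bdAct_coe]
    split_ifs with h
    · have h' : (γ 1 0 : ℂ) * x + (γ 1 1 : ℂ) = 0 := by exact_mod_cast h
      rw [crossQuot_infty, crossQuot_coe]
      field_simp
      rw [← hjp, ← hjq]
      linear_combination (p - q) * h'
    · have h' : (γ 1 0 : ℂ) * x + (γ 1 1 : ℂ) ≠ 0 := by exact_mod_cast h
      rw [crossQuot_coe, crossQuot_coe]
      have h1 := ofReal_sub_ne_zero
        (((γ 0 0 : ℝ) * x + (γ 0 1 : ℝ)) / ((γ 1 0 : ℝ) * x + (γ 1 1 : ℝ))) hq'0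
      have hX : (((γ 0 0 : ℂ) * x + (γ 0 1 : ℂ)) / ((γ 1 0 : ℂ) * x + (γ 1 1 : ℂ))) *
          ((γ 1 0 : ℂ) * x + (γ 1 1 : ℂ)) = (γ 0 0 : ℂ) * x + (γ 0 1 : ℂ) :=
        div_mul_cancel₀ _ h'
      push_cast at h1 ⊢
      subst hjp hjq
      generalize ((γ 0 0 : ℂ) * x + (γ 0 1 : ℂ)) / ((γ 1 0 : ℂ) * x + (γ 1 1 : ℂ)) = X at *
      field_simp
      refine mul_right_cancel₀ h' ?_
      have e1 : (X - p') * ((γ 1 0 : ℂ) * p + (γ 1 1 : ℂ)) * ((γ 1 0 : ℂ) * x + (γ 1 1 : ℂ)) =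
          x - p := by
        linear_combination ((γ 1 0 : ℂ) * p + (γ 1 1 : ℂ)) * hX -
          ((γ 1 0 : ℂ) * x + (γ 1 1 : ℂ)) * hp' + (x - p) * hdet
      have e2 : (X - q') * ((γ 1 0 : ℂ) * q + (γ 1 1 : ℂ)) * ((γ 1 0 : ℂ) * x + (γ 1 1 : ℂ)) =
          x - q := by
        linear_combination ((γ 1 0 : ℂ) * q + (γ 1 1 : ℂ)) * hX -
          ((γ 1 0 : ℂ) * x + (γ 1 1 : ℂ)) * hq' + (x - q) * hdet
      linear_combination (x - q) * e1 - (x - p) * e2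

/-- For `w = |w| e^{iθ}` the two powers combine to `|w|^{2s} e^{-ikθ}`: one modulus and one argument
control the kernel. -/
theorem cpow_mul_conj_cpow {w : ℂ} (hw : w ∈ Complex.slitPlane) (s : ℂ) (k : ℝ) :
    w ^ (s - (k : ℂ) / 2) * (starRingEnd ℂ w) ^ (s + (k : ℂ) / 2) =
      Complex.exp (s * (Real.log (Complex.normSq w) : ℂ) - Complex.I * k * (Complex.arg w : ℂ)) := by
  have hw0 : w ≠ 0 := Complex.slitPlane_ne_zero hw
  have hw1 : starRingEnd ℂ w ≠ 0 := (map_ne_zero _).2 hw0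
  have h : Complex.log w = Real.log ‖w‖ + Complex.arg w * Complex.I := rfl
  have h2 : Real.log (Complex.normSq w) = 2 * Real.log ‖w‖ := by
    rw [Complex.normSq_eq_norm_sq, Real.log_pow]; norm_num
  rw [Complex.cpow_def_of_ne_zero hw0, Complex.cpow_def_of_ne_zero hw1,
    Complex.log_conj w (Complex.slitPlane_arg_ne_pi hw), h, ← Complex.exp_add, h2]
  congr 1
  simp only [map_add, map_mul, Complex.conj_ofReal, Complex.conj_I]
  push_cast
  ring

/-- The convention `-π ≤ arg < π` for `a - ic` is the conjugate of the principal one for `a + ic`,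
on the negative axis too, so both powers share one argument. -/
theorem lowPow_mul_cpow {w : ℂ} (hw : w ≠ 0) (s : ℂ) (k : ℝ) :
    lowPow (starRingEnd ℂ w) (-s + (k : ℂ) / 2) * w ^ (-s - (k : ℂ) / 2) =
      Complex.exp (-s * (Real.log (Complex.normSq w) : ℂ) - Complex.I * k * (Complex.arg w : ℂ)) := by
  have h : Complex.log w = Real.log ‖w‖ + Complex.arg w * Complex.I := rfl
  have h2 : Real.log (Complex.normSq w) = 2 * Real.log ‖w‖ := by
    rw [Complex.normSq_eq_norm_sq, Real.log_pow]; norm_num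
  rw [lowPow, Complex.cpow_def_of_ne_zero hw, Complex.conj_conj, h, ← Complex.exp_add, h2]
  congr 1
  simp only [map_add, map_mul, Complex.conj_ofReal, Complex.conj_I]
  push_cast
  ring

theorem poissonKernel_eq_exp (s : ℂ) (k : ℝ) (t : OnePoint ℝ) (z : ℍ) :
    poissonKernel s k t z = Complex.exp (s * (Real.log (z.im *
      Complex.normSq (crossQuot t Complex.I z)) : ℂ) -
        Complex.I * k * (Complex.arg (crossQuot t Complex.I z) : ℂ)) := by
  have h0 := crossQuot_mem_slitPlane t z
  have hI : (-Complex.I) = starRingEnd ℂ Complex.I := by simp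
  rw [poissonKernel, hI, crossQuot_conj, mul_assoc, cpow_mul_conj_cpow h0,
    Complex.cpow_def_of_ne_zero (by exact_mod_cast z.im_pos.ne'), ← Complex.ofReal_log z.im_pos.le,
    ← Complex.exp_add, Real.log_mul z.im_pos.ne'
      (Complex.normSq_pos.2 (Complex.slitPlane_ne_zero h0)).ne']
  congr 1
  push_cast; ring

theorem poissonKernel_ne_zero (s : ℂ) (k : ℝ) (t : OnePoint ℝ) (z : ℍ) :
    poissonKernel s k t z ≠ 0 := by
  rw [poissonKernel_eq_exp]; exact Complex.exp_ne_zero _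

/-- The factor of the principal series action for an integral matrix. -/
def intFactor (s : ℂ) (k : ℝ) (γ : SL(2, ℤ)) (t : OnePoint ℝ) : ℂ :=
  prsFactor s k (Matrix.SpecialLinearGroup.map (Int.castRingHom ℝ) γ) t

theorem map_inv_smul_I (γ : SL(2, ℤ)) :
    ((Matrix.SpecialLinearGroup.map (Int.castRingHom ℝ) γ)⁻¹ • UpperHalfPlane.I : ℍ) =
      γ⁻¹ • UpperHalfPlane.I := by
  rw [← map_inv]
  ext
  rw [UpperHalfPlane.coe_specialLinearGroup_apply, UpperHalfPlane.coe_specialLinearGroup_apply]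
  simp only [Matrix.SpecialLinearGroup.map_apply_coe, RingHom.mapMatrix_apply, Matrix.map_apply,
    eq_intCast, Algebra.algebraMap_self, RingHom.id_apply, algebraMap_int_eq]

theorem intFactor_eq_exp (s : ℂ) (k : ℝ) (γ : SL(2, ℤ)) (t : OnePoint ℝ) :
    intFactor s k γ t = Complex.exp (s * (Real.log (Complex.normSq
        (crossQuot t Complex.I (γ⁻¹ • UpperHalfPlane.I : ℍ))) -
          Real.log (Complex.normSq ((γ 0 0 : ℂ) + Complex.I * (γ 1 0 : ℂ))) : ℂ) -
      Complex.I * k * ((Complex.arg ((γ 0 0 : ℂ) + Complex.I * (γ 1 0 : ℂ)) : ℂ) +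
        (Complex.arg (crossQuot t Complex.I (γ⁻¹ • UpperHalfPlane.I : ℍ)) : ℂ))) := by
  have h0 := crossQuot_mem_slitPlane t (γ⁻¹ • UpperHalfPlane.I)
  have hI : (-Complex.I) = starRingEnd ℂ Complex.I := by simp
  have hw : (γ 0 0 : ℂ) + Complex.I * (γ 1 0 : ℂ) ≠ 0 := by
    intro h
    have hr := congrArg Complex.re h
    have hi := congrArg Complex.im h
    simp at hr hi
    have := det_eq_one γ
    simp [hr, hi] at this
  have hc : (γ 0 0 : ℂ) - Complex.I * (γ 1 0 : ℂ) =
      starRingEnd ℂ ((γ 0 0 : ℂ) + Complex.I * (γ 1 0 : ℂ)) := by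
    simp [sub_eq_add_neg]
  rw [intFactor, prsFactor, map_inv_smul_I, hI, crossQuot_conj, mul_assoc _ (_ ^ _) (_ ^ _),
    cpow_mul_conj_cpow h0]
  simp only [Matrix.SpecialLinearGroup.map_apply_coe, RingHom.mapMatrix_apply, Matrix.map_apply,
    eq_intCast, Complex.ofReal_intCast]
  rw [hc, lowPow_mul_cpow hw, ← Complex.exp_add]
  congr 1
  ring

theorem continuous_crossQuot_right (t : OnePoint ℝ) :
    Continuous fun z : ℍ => crossQuot t Complex.I (z : ℂ) := by
  cases t with
  | infty => simpa using continuous_const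
  | coe x =>
    simp only [crossQuot_coe]
    exact continuous_const.div (by fun_prop) fun z => ofReal_sub_ne_zero x z.im_pos.ne'

theorem continuous_arg_autFactor (γ : SL(2, ℤ)) :
    Continuous fun z => Complex.arg (autFactor γ z) := by
  simpa [Function.comp_def, Complex.log_im] using
    Complex.continuous_im.comp (continuous_log_autFactor γ)

theorem smul_mul_autFactor (γ : SL(2, ℤ)) (z : ℍ) :
    ((γ • z : ℍ) : ℂ) * autFactor γ z = (γ 0 0 : ℂ) * z + (γ 0 1 : ℂ) := by
  rw [coe_smul_eq, div_mul_cancel₀ _ (autFactor_ne_zero γ z)]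

theorem crossQuot_smul_smul (γ : SL(2, ℤ)) (t : OnePoint ℝ) (p z : ℍ) :
    crossQuot (bdAct γ t) (γ • p : ℍ) (γ • z : ℍ) * autFactor γ p =
      autFactor γ z * crossQuot t p z :=
  crossQuot_smul γ t z.im_pos.ne' rfl rfl (smul_mul_autFactor γ p) (smul_mul_autFactor γ z)
    (γ • z).im_pos.ne' (autFactor_ne_zero γ p) (autFactor_ne_zero γ z)

theorem autFactor_inv_smul_I (γ : SL(2, ℤ)) :
    autFactor γ (γ⁻¹ • UpperHalfPlane.I) * ((γ 0 0 : ℂ) - Complex.I * (γ 1 0 : ℂ)) = 1 := by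
  have h := autFactor_mul γ γ⁻¹ UpperHalfPlane.I
  rw [mul_inv_cancel] at h
  have h1 : autFactor 1 UpperHalfPlane.I = 1 := by simp [autFactor]
  have h2 : autFactor γ⁻¹ UpperHalfPlane.I = (γ 0 0 : ℂ) - Complex.I * (γ 1 0 : ℂ) := by
    rw [autFactor, Matrix.SpecialLinearGroup.coe_inv, Matrix.adjugate_fin_two]
    simp; ring
  rw [← h1, h, h2]

/-- The identity behind equivariance of the kernel: its modulus settles the exponent `s`, and its
argument settles the weight `k` up to multiples of `2π`. -/
theorem crossQuot_cocycle (γ : SL(2, ℤ)) (t : OnePoint ℝ) (z : ℍ) :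
    crossQuot t Complex.I (γ⁻¹ • UpperHalfPlane.I : ℍ) *
        crossQuot (bdAct γ t) Complex.I (γ • z : ℍ) =
      ((γ 0 0 : ℂ) - Complex.I * (γ 1 0 : ℂ)) * autFactor γ z * crossQuot t Complex.I z := by
  have h := crossQuot_smul_smul γ t (γ⁻¹ • UpperHalfPlane.I) z
  rw [smul_inv_smul] at h
  have h2 := autFactor_inv_smul_I γ
  have h3 := crossQuot_mul t (p := Complex.I) (z : ℂ)
    (γ⁻¹ • UpperHalfPlane.I : ℍ).im_pos.ne'
  rw [UpperHalfPlane.coe_I] at h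
  linear_combination (crossQuot t Complex.I (γ⁻¹ • UpperHalfPlane.I : ℍ) *
    ((γ 0 0 : ℂ) - Complex.I * (γ 1 0 : ℂ))) * h -
    crossQuot t Complex.I (γ⁻¹ • UpperHalfPlane.I : ℍ) *
      crossQuot (bdAct γ t) Complex.I (γ • z : ℍ) * h2 +
    autFactor γ z * ((γ 0 0 : ℂ) - Complex.I * (γ 1 0 : ℂ)) * h3

theorem exp_arg_mul_norm (w : ℂ) :
    (‖w‖ : ℂ) * Complex.exp (Complex.I * Complex.arg w) = w := by
  rw [mul_comm Complex.I]; exact Complex.norm_mul_exp_arg_mul_I w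

/-- For non-integral `k` the arguments must agree exactly. The difference of the two sides is
continuous in `z` and, by `crossQuot_cocycle`, a multiple of `2π`, hence constant. It vanishes at `z
= γ⁻¹ i`, where the third quotient is `1` and `c z + d` is a positive multiple of `a + ic`. -/
theorem arg_cocycle (γ : SL(2, ℤ)) (t : OnePoint ℝ) (z : ℍ) :
    Complex.arg ((γ 0 0 : ℂ) + Complex.I * (γ 1 0 : ℂ)) +
      Complex.arg (crossQuot t Complex.I (γ⁻¹ • UpperHalfPlane.I : ℍ)) +
      Complex.arg (crossQuot (bdAct γ t) Complex.I (γ • z : ℍ)) =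
    Complex.arg (autFactor γ z) + Complex.arg (crossQuot t Complex.I z) := by
  set A := Complex.arg ((γ 0 0 : ℂ) + Complex.I * (γ 1 0 : ℂ)) with hA
  set B := Complex.arg (crossQuot t Complex.I (γ⁻¹ • UpperHalfPlane.I : ℍ)) with hB
  let f : ℍ → ℂ := fun z => Complex.I * ((A + B + Complex.arg (crossQuot (bdAct γ t) Complex.I (γ • z : ℍ))
    - Complex.arg (autFactor γ z) - Complex.arg (crossQuot t Complex.I z) : ℝ) : ℂ)
  have hf : Continuous f := by
    refine continuous_const.mul (Complex.continuous_ofReal.comp ?_)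
    have e : ∀ t : OnePoint ℝ, Continuous fun z : ℍ => Complex.arg (crossQuot t Complex.I z) :=
      fun t => continuous_iff_continuousAt.2 fun z =>
        (Complex.continuousAt_arg (crossQuot_mem_slitPlane t z)).comp
          (f := fun z : ℍ => crossQuot t Complex.I z) (continuous_crossQuot_right t).continuousAt
    exact ((continuous_const.add ((e _).comp (continuous_smul_upperHalfPlane γ))).sub
      (continuous_arg_autFactor γ)).sub (e t)
  have hexp : ∀ z, Complex.exp (f z) = 1 := by
    intro z
    have h := crossQuot_cocycle γ t z
    set w := (γ 0 0 : ℂ) + Complex.I * (γ 1 0 : ℂ) with hw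
    have hc : (γ 0 0 : ℂ) - Complex.I * (γ 1 0 : ℂ) = starRingEnd ℂ w := by
      simp [hw, sub_eq_add_neg]
    rw [hc] at h
    have hw0 : w ≠ 0 := by
      have := autFactor_inv_smul_I γ
      rw [hc] at this
      exact (map_ne_zero _).1 (right_ne_zero_of_mul_eq_one this)
    have hb0 := Complex.slitPlane_ne_zero (crossQuot_mem_slitPlane t (γ⁻¹ • UpperHalfPlane.I))
    have hc0 := Complex.slitPlane_ne_zero (crossQuot_mem_slitPlane (bdAct γ t) (γ • z))
    have he0 := Complex.slitPlane_ne_zero (crossQuot_mem_slitPlane t z)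
    have hd0 := autFactor_ne_zero γ z
    simp only [f, hA, hB]
    generalize crossQuot t Complex.I (γ⁻¹ • UpperHalfPlane.I : ℍ) = b at *
    generalize crossQuot (bdAct γ t) Complex.I (γ • z : ℍ) = c at *
    generalize crossQuot t Complex.I z = e at *
    generalize autFactor γ z = d at *
    have hn := congrArg (fun x : ℂ => (‖x‖ : ℂ)) h
    simp only [norm_mul, RCLike.norm_conj, Complex.ofReal_mul] at hn
    have hm : w * starRingEnd ℂ w = (‖w‖ : ℂ) ^ 2 := by
      rw [Complex.mul_conj, Complex.normSq_eq_norm_sq]; push_cast; rfl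
    have hE : ∀ x : ℂ, x ≠ 0 → Complex.exp (Complex.I * Complex.arg x) = x / ‖x‖ := fun x hx => by
      rw [eq_div_iff (by exact_mod_cast norm_ne_zero_iff.2 hx), mul_comm, exp_arg_mul_norm]
    have : ∀ x : ℂ, x ≠ 0 → (‖x‖ : ℂ) ≠ 0 := fun x hx => by exact_mod_cast norm_ne_zero_iff.2 hx
    have n1 := this w hw0
    have n2 := this b hb0
    have n3 := this c hc0
    have n4 := this d hd0
    have n5 := this e he0
    push_cast
    rw [mul_sub, mul_sub, mul_add, mul_add, Complex.exp_sub, Complex.exp_sub, Complex.exp_add,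
      Complex.exp_add, hE w hw0, hE b hb0, hE c hc0, hE d hd0, hE e he0]
    field_simp
    linear_combination w * (‖d‖ : ℂ) * ‖e‖ * h + d * e * ‖d‖ * ‖e‖ * hm - ‖w‖ * d * e * hn
  have h1 := eq_of_continuous_of_exp_eq_one hf hexp z (γ⁻¹ • UpperHalfPlane.I)
  have h2 : f (γ⁻¹ • UpperHalfPlane.I) = 0 := by
    have h3 : autFactor γ (γ⁻¹ • UpperHalfPlane.I) =
        ((Complex.normSq ((γ 0 0 : ℂ) + Complex.I * (γ 1 0 : ℂ)))⁻¹ : ℝ) *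
          ((γ 0 0 : ℂ) + Complex.I * (γ 1 0 : ℂ)) := by
      have h := autFactor_inv_smul_I γ
      set w := (γ 0 0 : ℂ) + Complex.I * (γ 1 0 : ℂ) with hw
      have hc : (γ 0 0 : ℂ) - Complex.I * (γ 1 0 : ℂ) = starRingEnd ℂ w := by
        simp [hw, sub_eq_add_neg]
      rw [hc] at h
      have hw0 : (Complex.normSq w : ℂ) ≠ 0 := by
        exact_mod_cast (Complex.normSq_pos.2
          ((map_ne_zero (starRingEnd ℂ)).1 (right_ne_zero_of_mul_eq_one h))).ne'
      have hm := Complex.mul_conj w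
      push_cast
      rw [inv_mul_eq_div, eq_div_iff hw0, ← hm]
      linear_combination w * h
    have h4 : 0 < (Complex.normSq ((γ 0 0 : ℂ) + Complex.I * (γ 1 0 : ℂ)))⁻¹ := by
      refine inv_pos.2 (Complex.normSq_pos.2 fun h0 => ?_)
      rw [h0, mul_zero] at h3
      exact autFactor_ne_zero _ _ h3
    simp only [f]
    rw [smul_inv_smul, UpperHalfPlane.coe_I, crossQuot_self _ (by simp), h3,
      Complex.arg_real_mul _ h4]
    simp [hA, hB]
  rw [h2] at h1
  have h4 := (mul_eq_zero.1 h1).resolve_left Complex.I_ne_zero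
  have h5 := Complex.ofReal_eq_zero.1 h4
  linarith

/-- Equivariance of the Poisson kernel. -/
theorem intFactor_mul_poissonKernel (s : ℂ) (k : ℝ) (γ : SL(2, ℤ)) (t : OnePoint ℝ) (z : ℍ) :
    intFactor s k γ t * poissonKernel s k (bdAct γ t) (γ • z) * phase k γ z =
      poissonKernel s k t z := by
  have ha := arg_cocycle γ t z
  have hn := congrArg Complex.normSq (crossQuot_cocycle γ t z)
  have hc : (γ 0 0 : ℂ) - Complex.I * (γ 1 0 : ℂ) =
      starRingEnd ℂ ((γ 0 0 : ℂ) + Complex.I * (γ 1 0 : ℂ)) := by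
    simp [sub_eq_add_neg]
  have hw0 : (γ 0 0 : ℂ) + Complex.I * (γ 1 0 : ℂ) ≠ 0 := by
    have := autFactor_inv_smul_I γ
    rw [hc] at this
    exact (map_ne_zero _).1 (right_ne_zero_of_mul_eq_one this)
  have hb0 := Complex.slitPlane_ne_zero (crossQuot_mem_slitPlane t (γ⁻¹ • UpperHalfPlane.I))
  have hc0 := Complex.slitPlane_ne_zero (crossQuot_mem_slitPlane (bdAct γ t) (γ • z))
  have he0 := Complex.slitPlane_ne_zero (crossQuot_mem_slitPlane t z)
  have hd0 := autFactor_ne_zero γ z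
  have him : (γ • z).im = z.im / Complex.normSq (autFactor γ z) := by
    rw [ModularGroup.im_smul_eq_div_normSq, autFactor_eq_denom]
  rw [hc] at hn
  simp only [map_mul, Complex.normSq_conj] at hn
  rw [intFactor_eq_exp, poissonKernel_eq_exp, poissonKernel_eq_exp, phase, ← Complex.exp_add,
    ← Complex.exp_add, him]
  generalize crossQuot t Complex.I (γ⁻¹ • UpperHalfPlane.I : ℍ) = b at *
  generalize crossQuot (bdAct γ t) Complex.I (γ • z : ℍ) = c at *
  generalize crossQuot t Complex.I z = e at *
  generalize autFactor γ z = d at *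
  generalize (γ 0 0 : ℂ) + Complex.I * (γ 1 0 : ℂ) = w at *
  have p : ∀ x : ℂ, x ≠ 0 → Complex.normSq x ≠ 0 := fun x hx => (Complex.normSq_pos.2 hx).ne'
  have hl := congrArg Real.log hn
  rw [Real.log_mul (p _ hb0) (p _ hc0), Real.log_mul (mul_ne_zero (p _ hw0) (p _ hd0)) (p _ he0),
    Real.log_mul (p _ hw0) (p _ hd0)] at hl
  rw [Real.log_mul (div_ne_zero z.im_pos.ne' (p _ hd0)) (p _ hc0),
    Real.log_div z.im_pos.ne' (p _ hd0), Real.log_mul z.im_pos.ne' (p _ he0)]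
  congr 1
  have hl' := congrArg (fun x : ℝ => (x : ℂ)) hl
  have ha' := congrArg (fun x : ℝ => (x : ℂ)) ha
  push_cast at hl' ha' ⊢
  linear_combination s * hl' - Complex.I * k * ha'

/-- The scalar factor of the action on `P¹(ℝ)`, including the multiplier. -/
def bdFactor (s : ℂ) (k : ℝ) (γ : SL(2, ℤ)) (t : OnePoint ℝ) : ℂ :=
  (mult k γ)⁻¹ * intFactor s k γ t

theorem bdFactor_mul_poissonKernel (s : ℂ) (k : ℝ) (γ : SL(2, ℤ)) (t : OnePoint ℝ) (z : ℍ) :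
    bdFactor s k γ t * poissonKernel s k (bdAct γ t) (γ • z) * (mult k γ * phase k γ z) =
      poissonKernel s k t z := by
  rw [← intFactor_mul_poissonKernel s k γ t z, bdFactor]
  have := mult_ne_zero k γ
  field_simp

/-- Three instances of the equivariance of the kernel and the cocycle relation of the multiplier
force this, because the kernel never vanishes; no branches have to be compared again. -/
theorem bdFactor_mul (s : ℂ) (k : ℝ) (δ γ : SL(2, ℤ)) (t : OnePoint ℝ) :
    bdFactor s k (δ * γ) t = bdFactor s k δ (bdAct γ t) * bdFactor s k γ t := by
  have h1 := bdFactor_mul_poissonKernel s k (δ * γ) t UpperHalfPlane.I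
  have h2 := bdFactor_mul_poissonKernel s k δ (bdAct γ t) (γ • UpperHalfPlane.I)
  have h3 := bdFactor_mul_poissonKernel s k γ t UpperHalfPlane.I
  rw [mult_mul_phase_mul, mul_smul, bdAct_mul] at h1
  have n1 := mul_ne_zero (mult_ne_zero k δ) (phase_ne_zero k δ (γ • UpperHalfPlane.I))
  have n2 := mul_ne_zero (mult_ne_zero k γ) (phase_ne_zero k γ UpperHalfPlane.I)
  have n3 := poissonKernel_ne_zero s k (bdAct δ (bdAct γ t)) (δ • γ • UpperHalfPlane.I)
  rw [← h2, ← h1] at h3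
  refine mul_right_cancel₀ (mul_ne_zero n3 (mul_ne_zero n1 n2)) ?_
  linear_combination -h3

variable {V : Type*} [NormedAddCommGroup V] [InnerProductSpace ℂ V]

theorem prs_apply (ρ : SL(2, ℤ) →* (V ≃ₗᵢ[ℂ] V)) (k : ℝ) (s : ℂ) (γ : SL(2, ℤ))
    (φ : OnePoint ℝ → V) (t : OnePoint ℝ) :
    prs ρ k s γ φ t = bdFactor s k γ t • ρ γ⁻¹ (φ (bdAct γ t)) := rfl

/-- The formula `φ | δ | γ = φ | δγ`. -/
theorem prs_prs (ρ : SL(2, ℤ) →* (V ≃ₗᵢ[ℂ] V)) (k : ℝ) (s : ℂ) (δ γ : SL(2, ℤ))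
    (φ : OnePoint ℝ → V) : prs ρ k s γ (prs ρ k s δ φ) = prs ρ k s (δ * γ) φ := by
  funext t
  simp only [prs_apply, bdFactor_mul, bdAct_mul, mul_inv_rev, map_mul, map_smul, smul_smul]
  rw [mul_comm]; rfl

theorem slash_apply (ρ : SL(2, ℤ) →* (V ≃ₗᵢ[ℂ] V)) (k : ℝ) (γ : SL(2, ℤ)) (u : ℍ → V) (z : ℍ) :
    slash ρ k γ u z = (mult k γ * phase k γ z)⁻¹ • ρ γ⁻¹ (u (γ • z)) := by
  rw [slash, mul_inv, phase, ← Complex.exp_neg]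

end MaassPeriod

end

noncomputable section

namespace MaassPeriod

open Filter Topology Complex

variable {V : Type*} [NormedAddCommGroup V] [InnerProductSpace ℂ V]

/-! ### Wirtinger calculus -/

/-- The real-linear map `w ↦ w α + w̄ β`. -/
def wirt (α β : V) : ℂ →L[ℝ] V :=
  (ContinuousLinearMap.lsmul ℝ ℂ).flip α +
    ((ContinuousLinearMap.lsmul ℝ ℂ).flip β).comp (Complex.conjCLE : ℂ →L[ℝ] ℂ)

theorem wirt_apply (α β : V) (w : ℂ) : wirt α β w = w • α + starRingEnd ℂ w • β := rfl

theorem clm_eq_wirt (D : ℂ →L[ℝ] V) :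
    D = wirt ((1 / 2 : ℂ) • (D 1 - Complex.I • D Complex.I))
      ((1 / 2 : ℂ) • (D 1 + Complex.I • D Complex.I)) := by
  ext w
  have h : w = (w.re : ℝ) • (1 : ℂ) + (w.im : ℝ) • Complex.I := by simp
  have h1 : D w = (w.re : ℂ) • D 1 + (w.im : ℂ) • D Complex.I := by
    conv_lhs => rw [h]
    rw [map_add, map_smul, map_smul]; rfl
  rw [h1, wirt_apply]
  have h2 : starRingEnd ℂ w = w.re - w.im * Complex.I := by
    apply Complex.ext <;> simp
  have h3 : w = w.re + w.im * Complex.I := by simp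
  rw [h2]
  generalize D 1 = a
  generalize D Complex.I = b
  rw [h3]
  simp only [add_re, ofReal_re, mul_re, I_re, mul_zero, ofReal_im, I_im, mul_one, sub_self,
    add_zero, add_im, mul_im, zero_add]
  have := Complex.I_sq
  match_scalars
  · ring
  · linear_combination (w.im : ℂ) * this

theorem hasFDerivAt_wirt {f : ℂ → V} {z : ℂ} (hf : DifferentiableAt ℝ f z) :
    HasFDerivAt f (wirt (dZ f z) (dZbar f z)) z := by
  have h := hf.hasFDerivAt
  rwa [clm_eq_wirt (fderiv ℝ f z)] at h

theorem wirt_one_sub (α β : V) :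
    (1 / 2 : ℂ) • (wirt α β 1 - Complex.I • wirt α β Complex.I) = α := by
  simp only [wirt_apply, map_one, Complex.conj_I]
  have := Complex.I_sq
  match_scalars
  · linear_combination (-1 / 2 : ℂ) * this
  · linear_combination (1 / 2 : ℂ) * this

theorem wirt_one_add (α β : V) :
    (1 / 2 : ℂ) • (wirt α β 1 + Complex.I • wirt α β Complex.I) = β := by
  simp only [wirt_apply, map_one, Complex.conj_I]
  have := Complex.I_sq
  match_scalars
  · linear_combination (1 / 2 : ℂ) * this
  · linear_combination (-1 / 2 : ℂ) * this

theorem dZ_eq_of_hasFDerivAt {f : ℂ → V} {z : ℂ} {α β : V} (h : HasFDerivAt f (wirt α β) z) :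
    dZ f z = α := by
  rw [dZ, dX, dY, h.fderiv, wirt_one_sub]

theorem dZbar_eq_of_hasFDerivAt {f : ℂ → V} {z : ℂ} {α β : V} (h : HasFDerivAt f (wirt α β) z) :
    dZbar f z = β := by
  rw [dZbar, dX, dY, h.fderiv, wirt_one_add]

theorem hasFDerivAt_wirt_smul {g : ℂ → ℂ} {f : ℂ → V} {z a b : ℂ} {α β : V}
    (hg : HasFDerivAt g (wirt a b) z) (hf : HasFDerivAt f (wirt α β) z) :
    HasFDerivAt (fun w => g w • f w) (wirt (a • f z + g z • α) (b • f z + g z • β)) z := by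
  refine (hg.smul hf).congr_fderiv ?_
  ext w
  simp only [wirt_apply, _root_.add_apply, _root_.smul_apply,
    ContinuousLinearMap.smulRight_apply, smul_eq_mul]
  module

theorem hasFDerivAt_wirt_add {g f : ℂ → V} {z : ℂ} {a b α β : V}
    (hg : HasFDerivAt g (wirt a b) z) (hf : HasFDerivAt f (wirt α β) z) :
    HasFDerivAt (fun w => g w + f w) (wirt (a + α) (b + β)) z := by
  refine (hg.add hf).congr_fderiv ?_
  ext w
  simp only [wirt_apply, _root_.add_apply]
  module

theorem hasFDerivAt_wirt_of_hasDerivAt {f : ℂ → ℂ} {z a : ℂ} (h : HasDerivAt f a z) :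
    HasFDerivAt f (wirt a 0) z := by
  refine (h.hasFDerivAt.restrictScalars ℝ).congr_fderiv ?_
  ext w
  simp [wirt_apply]

theorem hasFDerivAt_wirt_conj {f : ℂ → ℂ} {z a b : ℂ} (h : HasFDerivAt f (wirt a b) z) :
    HasFDerivAt (fun w => starRingEnd ℂ (f w))
      (wirt (starRingEnd ℂ b) (starRingEnd ℂ a)) z := by
  refine (((Complex.conjCLE : ℂ ≃L[ℝ] ℂ) : ℂ →L[ℝ] ℂ).hasFDerivAt.comp z h).congr_fderiv ?_
  ext w
  simp [wirt_apply]
  ring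

theorem hasFDerivAt_wirt_comp {f : ℂ → V} {h : ℂ → ℂ} {z a : ℂ} {α β : V}
    (hf : HasFDerivAt f (wirt α β) (h z)) (hh : HasDerivAt h a z) :
    HasFDerivAt (fun w => f (h w)) (wirt (a • α) (starRingEnd ℂ a • β)) z := by
  refine (hf.comp z (hasFDerivAt_wirt_of_hasDerivAt hh)).congr_fderiv ?_
  ext w
  simp only [wirt_apply, ContinuousLinearMap.comp_apply, add_zero, smul_eq_mul,
    mul_zero, map_mul, smul_smul]

theorem hasFDerivAt_wirt_comp_left {f : ℂ → ℂ} {h : ℂ → ℂ} {z a b c : ℂ}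
    (hf : HasFDerivAt f (wirt a b) z) (hh : HasDerivAt h c (f z)) :
    HasFDerivAt (fun w => h (f w)) (wirt (c * a) (c * b)) z := by
  refine ((hasFDerivAt_wirt_of_hasDerivAt hh).comp z hf).congr_fderiv ?_
  ext w
  simp only [wirt_apply, ContinuousLinearMap.comp_apply, smul_eq_mul]
  ring

theorem hasFDerivAt_wirt_im (z : ℂ) :
    HasFDerivAt (fun w : ℂ => (w.im : ℂ)) (wirt (1 / (2 * Complex.I)) (-1 / (2 * Complex.I))) z := by
  refine ((Complex.ofRealCLM.comp Complex.imCLM).hasFDerivAt (x := z)).congr_fderiv ?_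
  ext w
  have h2 : starRingEnd ℂ w = w - 2 * w.im * Complex.I := by
    apply Complex.ext <;> simp
    ring
  simp only [wirt_apply, h2, ContinuousLinearMap.comp_apply, Complex.imCLM_apply,
    Complex.ofRealCLM_apply, smul_eq_mul]
  field_simp
  ring

theorem hasFDerivAt_wirt_inv_im (d : ℂ) {z : ℂ} (hz : 0 < z.im) :
    HasFDerivAt (fun w : ℂ => d / (w.im : ℂ))
      (wirt (-d / (2 * Complex.I * z.im ^ 2)) (d / (2 * Complex.I * z.im ^ 2))) z := by
  have hy : (z.im : ℂ) ≠ 0 := by exact_mod_cast hz.ne'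
  have h := hasFDerivAt_wirt_comp_left (h := fun w => d / w) (hasFDerivAt_wirt_im z)
    (((hasDerivAt_const _ d).div (hasDerivAt_id _) hy))
  refine h.congr_fderiv ?_
  congr 1 <;> field_simp <;> ring

theorem hasFDerivAt_wirt_const (c : V) (z : ℂ) : HasFDerivAt (fun _ : ℂ => c) (wirt 0 0) z := by
  refine (hasFDerivAt_const c z).congr_fderiv ?_
  ext w; simp [wirt_apply]

/-- Poincaré lemma on the upper half-plane in Wirtinger form. -/
theorem exists_primitive_wirt [CompleteSpace V] {A B M : ℂ → V}
    (hA : ∀ z : ℂ, 0 < z.im → ∃ a, HasFDerivAt A (wirt a (M z)) z)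
    (hB : ∀ z : ℂ, 0 < z.im → ∃ b, HasFDerivAt B (wirt (M z) b) z) :
    ∃ Φ : ℂ → V, ∀ z : ℂ, 0 < z.im → HasFDerivAt Φ (wirt (A z) (B z)) z := by
  choose! Az hA using hA
  choose! Bz hB using hB
  let l1 : V →L[ℝ] ℂ →L[ℝ] V := (ContinuousLinearMap.lsmul ℝ ℂ).flip
  let l2 : V →L[ℝ] ℂ →L[ℝ] V :=
    ((ContinuousLinearMap.compL ℝ ℂ ℂ V).flip (Complex.conjCLE : ℂ →L[ℝ] ℂ)).comp l1
  have key : ∀ z : ℂ, 0 < z.im → HasFDerivAt (fun z => wirt (A z) (B z))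
      (l1.comp (wirt (Az z) (M z)) + l2.comp (wirt (M z) (Bz z))) z := fun z hz =>
    (l1.hasFDerivAt.comp z (hA z hz)).add (l2.hasFDerivAt.comp z (hB z hz))
  have hopen : IsOpen {z : ℂ | 0 < z.im} := isOpen_lt continuous_const Complex.continuous_im
  refine Convex.exists_forall_hasFDerivAt_of_fderiv_symmetric (s := {z : ℂ | 0 < z.im})
    (convex_halfSpace_im_gt 0) hopen
    (fun z hz => (key z hz).differentiableAt.differentiableWithinAt) fun z hz x y => ?_
  -- Symmetry of the derivative holds because the mixed coefficients of `A` and `B` are the same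
  -- function `M`.
  rw [(key z hz).fderiv]
  have e1 : ∀ (v : V) (w : ℂ), l1 v w = w • v := fun _ _ => rfl
  have e2 : ∀ (v : V) (w : ℂ), l2 v w = starRingEnd ℂ w • v := fun _ _ => rfl
  simp only [_root_.add_apply, ContinuousLinearMap.comp_apply, e1, e2, wirt_apply]
  module

/-- `4 ∂_{z̄} ∂_z` is the Laplacian because mixed second derivatives commute. Through this the
eigenvalue equation enters the exterior derivative of the Green form. -/
theorem dZbar_dZ {f : ℂ → V} {z : ℂ} (hf : ContDiffAt ℝ ∞ f z) :
    HasFDerivAt (dZ f) (wirt (dZ (dZ f) z) ((1 / 4 : ℂ) • Laplacian.laplacian f z)) z := by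
  have h1 : ContDiffAt ℝ 1 (fderiv ℝ f) z := hf.fderiv_right (m := 1)
    (WithTop.coe_le_coe.2 le_top)
  have h2 : DifferentiableAt ℝ (fderiv ℝ f) z := h1.differentiableAt (by simp)
  have hd : ∀ v : ℂ, HasFDerivAt (fun w => fderiv ℝ f w v)
      ((ContinuousLinearMap.apply ℝ V v).comp (fderiv ℝ (fderiv ℝ f) z)) z := fun v =>
    (ContinuousLinearMap.apply ℝ V v).hasFDerivAt.comp z h2.hasFDerivAt
  have h3 := ((hd 1).sub ((hd Complex.I).const_smul Complex.I)).const_smul (1 / 2 : ℂ)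
  have h3' : HasFDerivAt (dZ f) ((1 / 2 : ℂ) • ((ContinuousLinearMap.apply ℝ V 1).comp
      (fderiv ℝ (fderiv ℝ f) z) - Complex.I • (ContinuousLinearMap.apply ℝ V Complex.I).comp
      (fderiv ℝ (fderiv ℝ f) z))) z := h3
  have h4 := hasFDerivAt_wirt h3'.differentiableAt
  have hsymm := (hf.isSymmSndFDerivAt (n := ∞) (by
    rw [minSmoothness_of_isRCLikeNormedField]; exact WithTop.coe_le_coe.2 le_top)) 1 Complex.I
  convert h4 using 2
  rw [dZbar, dX, dY, h3'.fderiv, InnerProductSpace.laplacian_eq_iteratedFDeriv_complexPlane]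
  simp only [iteratedFDeriv_two_apply, _root_.smul_apply,
    _root_.sub_apply, ContinuousLinearMap.comp_apply, ContinuousLinearMap.apply_apply,
    Matrix.cons_val_zero, Matrix.cons_val_one, Matrix.cons_val_fin_one]
  rw [hsymm]
  have := Complex.I_sq
  match_scalars
  · ring
  · linear_combination (1 / 4 : ℂ) * this
  · ring

end MaassPeriod

end

noncomputable section

namespace MaassPeriod

open Filter Topology Complex

variable {V : Type*} [NormedAddCommGroup V] [InnerProductSpace ℂ V]

/-! ### The Green form of an eigenfunction and a Poisson kernel -/

@[simp] theorem lift_coe {X : Type*} (u : ℍ → X) (z : ℍ) : lift u (z : ℂ) = u z := by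
  simp [lift]

theorem eventually_im_pos {z : ℂ} (hz : 0 < z.im) : ∀ᶠ w : ℂ in 𝓝 z, 0 < w.im :=
  (isOpen_lt continuous_const Complex.continuous_im).mem_nhds hz

theorem lift_of_im_pos {X : Type*} (u : ℍ → X) {w : ℂ} (hw : 0 < w.im) :
    lift u w = u ⟨w, hw⟩ := by
  rw [lift, Function.comp_apply, UpperHalfPlane.ofComplex_apply_of_im_pos hw]

/-- `1 / (t - w)` for `t` in `P¹(ℝ)`. -/
def bdInv (t : OnePoint ℝ) (w : ℂ) : ℂ := t.elim 0 (fun x : ℝ => 1 / ((x : ℂ) - w))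

theorem hasDerivAt_bdInv (t : OnePoint ℝ) {w : ℂ} (hw : w.im ≠ 0) :
    HasDerivAt (bdInv t) (bdInv t w ^ 2) w := by
  cases t with
  | infty =>
    refine (hasDerivAt_const w (0 : ℂ)).congr_deriv ?_
    simp [bdInv]
  | coe x =>
    have h := ofReal_sub_ne_zero x hw
    have := (hasDerivAt_const w (1 : ℂ)).div ((hasDerivAt_id w).const_sub (x : ℂ)) h
    refine this.congr_deriv ?_
    simp [bdInv]

theorem hasDerivAt_crossQuot (t : OnePoint ℝ) (p : ℂ) {w : ℂ} (hw : w.im ≠ 0) :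
    HasDerivAt (fun w => crossQuot t p w) (crossQuot t p w * bdInv t w) w := by
  cases t with
  | infty => simpa [bdInv] using hasDerivAt_const w (1 : ℂ)
  | coe x =>
    have h := ofReal_sub_ne_zero x hw
    have := (hasDerivAt_const w ((x : ℂ) - p)).div ((hasDerivAt_id w).const_sub (x : ℂ)) h
    refine this.congr_deriv ?_
    simp [bdInv]
    field_simp

/-- Partial fractions; the one relation between the poles at `z` and `z̄` that closedness of the
Green form needs. -/
theorem bdInv_sub (t : OnePoint ℝ) {z : ℂ} (hz : z.im ≠ 0) :
    bdInv t z - bdInv t (starRingEnd ℂ z) =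
      2 * Complex.I * z.im * (bdInv t z * bdInv t (starRingEnd ℂ z)) := by
  cases t with
  | infty => simp [bdInv]
  | coe x =>
    have h := ofReal_sub_ne_zero x hz
    have h' := ofReal_sub_ne_zero x (z := starRingEnd ℂ z) (by simpa using hz)
    have h2 : starRingEnd ℂ z = z - 2 * z.im * Complex.I := by
      apply Complex.ext <;> simp
      ring
    simp only [bdInv, OnePoint.elim_some]
    field_simp
    rw [h2]; ring

theorem crossQuot_conj_eq (t : OnePoint ℝ) {z : ℂ} (hz : z.im ≠ 0) :
    crossQuot t z (starRingEnd ℂ z) = 1 - 2 * Complex.I * z.im * bdInv t (starRingEnd ℂ z) := by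
  cases t with
  | infty => simp [bdInv]
  | coe x =>
    have h' := ofReal_sub_ne_zero x (z := starRingEnd ℂ z) (by simpa using hz)
    have h2 : starRingEnd ℂ z = z - 2 * z.im * Complex.I := by
      apply Complex.ext <;> simp
      ring
    simp only [bdInv, OnePoint.elim_some, crossQuot_coe]
    field_simp
    rw [h2]; ring

/-- `∂_z R_{s,k} / R_{s,k}`. -/
def poissonLogZ (s : ℂ) (k : ℝ) (t : OnePoint ℝ) (z : ℂ) : ℂ :=
  s / (2 * Complex.I * z.im) + (s - (k : ℂ) / 2) * bdInv t z

/-- `∂_{z̄} R_{s,k} / R_{s,k} - k / (4 i y)`. -/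
def poissonLogZbar (s : ℂ) (k : ℝ) (t : OnePoint ℝ) (z : ℂ) : ℂ :=
  (s + (k : ℂ) / 2) * (bdInv t (starRingEnd ℂ z) - 1 / (2 * Complex.I * z.im))

/-- The power of `y` contributes to both derivatives, while the other two factors are holomorphic
and antiholomorphic in `z`. The summand `k/(4iy)` is kept apart in the `z̄`-derivative because the
Green form subtracts it. -/
theorem hasFDerivAt_poissonKernel (s : ℂ) (k : ℝ) (t : OnePoint ℝ) {z : ℂ} (hz : 0 < z.im) :
    HasFDerivAt (lift (poissonKernel s k t))
      (wirt (lift (poissonKernel s k t) z * poissonLogZ s k t z)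
        (lift (poissonKernel s k t) z * (poissonLogZbar s k t z + k / (4 * Complex.I * z.im)))) z := by
  have hy : (z.im : ℂ) ≠ 0 := by exact_mod_cast hz.ne'
  have hz' : (starRingEnd ℂ z).im ≠ 0 := by simpa using hz.ne'
  have hsl : crossQuot t Complex.I z ∈ Complex.slitPlane := crossQuot_mem_slitPlane t ⟨z, hz⟩
  have hsl' : crossQuot t (-Complex.I) (starRingEnd ℂ z) ∈ Complex.slitPlane := by
    rw [← Complex.conj_I, crossQuot_conj, Complex.mem_slitPlane_iff]
    simpa [Complex.mem_slitPlane_iff] using hsl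
  have e1 : HasFDerivAt (fun w : ℂ => (w.im : ℂ) ^ s)
      (wirt ((z.im : ℂ) ^ s * (s / (2 * Complex.I * z.im)))
        ((z.im : ℂ) ^ s * (-s / (2 * Complex.I * z.im)))) z := by
    have h1 : HasDerivAt (fun w : ℂ => w ^ s) (s * (z.im : ℂ) ^ (s - 1)) (z.im : ℂ) := by
      simpa using (hasDerivAt_id (z.im : ℂ)).cpow_const (c := s) (Or.inl (by simpa using hz))
    refine (hasFDerivAt_wirt_comp_left (h := fun w => w ^ s) (hasFDerivAt_wirt_im z)
      h1).congr_fderiv ?_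
    rw [Complex.cpow_sub _ _ hy, Complex.cpow_one]
    congr 1 <;> field_simp
  have e2 : HasFDerivAt (fun w : ℂ => crossQuot t Complex.I w ^ (s - (k : ℂ) / 2))
      (wirt (crossQuot t Complex.I z ^ (s - (k : ℂ) / 2) * ((s - (k : ℂ) / 2) * bdInv t z)) 0) z := by
    have := hasFDerivAt_wirt_of_hasDerivAt
      ((hasDerivAt_crossQuot t Complex.I hz.ne').cpow_const (c := s - (k : ℂ) / 2) hsl)
    refine this.congr_fderiv ?_
    have h0 := Complex.slitPlane_ne_zero hsl
    rw [Complex.cpow_sub _ _ h0, Complex.cpow_one]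
    congr 1
    field_simp
  have e3 : HasFDerivAt
      (fun w : ℂ => crossQuot t (-Complex.I) (starRingEnd ℂ w) ^ (s + (k : ℂ) / 2))
      (wirt 0 (crossQuot t (-Complex.I) (starRingEnd ℂ z) ^ (s + (k : ℂ) / 2) *
        ((s + (k : ℂ) / 2) * bdInv t (starRingEnd ℂ z)))) z := by
    have h1 := hasFDerivAt_wirt_conj (hasFDerivAt_wirt_of_hasDerivAt (hasDerivAt_id z))
    have := hasFDerivAt_wirt_comp_left
      (h := fun w => crossQuot t (-Complex.I) w ^ (s + (k : ℂ) / 2)) h1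
      ((hasDerivAt_crossQuot t (-Complex.I) hz').cpow_const (c := s + (k : ℂ) / 2) hsl')
    refine this.congr_fderiv ?_
    have h0 := Complex.slitPlane_ne_zero hsl'
    rw [Complex.cpow_sub _ _ h0, Complex.cpow_one]
    congr 1
    · simp
    · simp only [map_one]; field_simp
  have e4 := hasFDerivAt_wirt_smul (hasFDerivAt_wirt_smul e1 e2) e3
  have heq : lift (poissonKernel s k t) =ᶠ[𝓝 z] fun w => ((w.im : ℂ) ^ s •
      crossQuot t Complex.I w ^ (s - (k : ℂ) / 2)) •
        crossQuot t (-Complex.I) (starRingEnd ℂ w) ^ (s + (k : ℂ) / 2) := by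
    filter_upwards [eventually_im_pos hz] with w hw
    rw [lift_of_im_pos _ hw]; rfl
  refine (e4.congr_of_eventuallyEq heq).congr_fderiv ?_
  rw [heq.self_of_nhds]
  simp only [poissonLogZ, poissonLogZbar, smul_eq_mul]
  congr 1
  · ring
  · field_simp
    ring

/-- The covariant derivative `u_z + k / (4 i y) u`. -/
def covD (k : ℝ) (u : ℍ → V) (z : ℂ) : V :=
  dZ (lift u) z + ((k : ℂ) / (4 * Complex.I * (z.im : ℂ))) • lift u z

/-- The Green form as a differential form. -/
def greenCLM (s : ℂ) (k : ℝ) (u : ℍ → V) (t : OnePoint ℝ) (z : ℂ) : ℂ →L[ℝ] V :=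
  wirt (lift (poissonKernel s k t) z • covD k u z)
    ((lift (poissonKernel s k t) z * poissonLogZbar s k t z) • lift u z)

theorem greenForm_eq (s : ℂ) (k : ℝ) (u : ℍ → V) (t : OnePoint ℝ) {z : ℂ} (hz : 0 < z.im)
    (w : ℂ) : greenForm k u (poissonKernel s k t) z w = greenCLM s k u t z w := by
  rw [greenForm, dZbar_eq_of_hasFDerivAt (hasFDerivAt_poissonKernel s k t hz), greenCLM,
    wirt_apply, covD]
  module

theorem hasFDerivAt_poissonLogZbar (s : ℂ) (k : ℝ) (t : OnePoint ℝ) {z : ℂ} (hz : 0 < z.im) :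
    ∃ b, HasFDerivAt (poissonLogZbar s k t)
      (wirt ((s + (k : ℂ) / 2) * (1 / (2 * Complex.I * z.im)) ^ 2) b) z := by
  have hz' : (starRingEnd ℂ z).im ≠ 0 := by simpa using hz.ne'
  have hy : (z.im : ℂ) ≠ 0 := by exact_mod_cast hz.ne'
  have h1 := hasFDerivAt_wirt_conj (hasFDerivAt_wirt_of_hasDerivAt (hasDerivAt_id z))
  have h2 := hasFDerivAt_wirt_comp_left h1 (hasDerivAt_bdInv t hz')
  have h3 := hasFDerivAt_wirt_add h2 (hasFDerivAt_wirt_inv_im (-1 / (2 * Complex.I)) hz)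
  have h4 := hasFDerivAt_wirt_smul (hasFDerivAt_wirt_const (s + (k : ℂ) / 2) z) h3
  have h5 : poissonLogZbar s k t =ᶠ[𝓝 z] fun w => (s + (k : ℂ) / 2) •
      (bdInv t (starRingEnd ℂ (id w)) + -1 / (2 * Complex.I) / (w.im : ℂ)) := by
    filter_upwards [eventually_im_pos hz] with w hw
    have hw' : (w.im : ℂ) ≠ 0 := by exact_mod_cast hw.ne'
    simp only [poissonLogZbar, id, smul_eq_mul]
    field_simp
    ring
  refine ⟨_, (h4.congr_of_eventuallyEq h5).congr_fderiv (congrArg₂ wirt ?_ rfl)⟩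
  simp only [smul_eq_mul, map_zero, mul_zero, zero_mul, zero_add]
  field_simp

/-- Closedness means that `∂_{z̄}` of the `dz`-coefficient equals `∂_z` of the `dz̄`-coefficient.
Once the eigenvalue equation has replaced the Laplacian, the terms in `∂_z u` and `∂_{z̄} u` agree
outright and those in `u` agree by `bdInv_sub`. The half-plane being convex, a primitive exists. -/
theorem green_closed [CompleteSpace V] {s : ℂ} {k : ℝ} {u : ℍ → V} (hu : IsSmooth u)
    (hL : ∀ z : ℍ, maassLaplacian k u z = (s * (1 - s)) • u z) (t : OnePoint ℝ) :
    ∃ Φ : ℂ → V, ∀ z : ℂ, 0 < z.im → HasFDerivAt Φ (greenCLM s k u t z) z := by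
  have hR := fun (z : ℂ) (hz : 0 < z.im) => hasFDerivAt_poissonKernel s k t hz
  have hu1 := fun (z : ℂ) (hz : 0 < z.im) =>
    hasFDerivAt_wirt (f := lift u) (z := z) ((hu ⟨z, hz⟩).differentiableAt (by simp))
  have hu2 := fun (z : ℂ) (hz : 0 < z.im) => dZbar_dZ (f := lift u) (z := z) (hu ⟨z, hz⟩)
  choose! b hb using fun (z : ℂ) (hz : 0 < z.im) => hasFDerivAt_poissonLogZbar s k t hz
  have hB := fun (z : ℂ) (hz : 0 < z.im) =>
    hasFDerivAt_wirt_smul (hasFDerivAt_wirt_smul (hR z hz) (hb z hz)) (hu1 z hz)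
  have hA := fun (z : ℂ) (hz : 0 < z.im) =>
    hasFDerivAt_wirt_smul (hR z hz) (hasFDerivAt_wirt_add (hu2 z hz)
      (hasFDerivAt_wirt_smul (hasFDerivAt_wirt_inv_im ((k : ℂ) / (4 * Complex.I)) hz) (hu1 z hz)))
  refine exists_primitive_wirt (A := fun z => lift (poissonKernel s k t) z • covD k u z)
    (B := fun z => (lift (poissonKernel s k t) z * poissonLogZbar s k t z) • lift u z)
    (M := fun z => ((lift (poissonKernel s k t) z * poissonLogZ s k t z) * poissonLogZbar s k t z +
      lift (poissonKernel s k t) z * ((s + (k : ℂ) / 2) * (1 / (2 * Complex.I * z.im)) ^ 2)) •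
      lift u z + (lift (poissonKernel s k t) z * poissonLogZbar s k t z) • dZ (lift u) z)
    (fun z hz => ?_) (fun z hz => ⟨_, hB z hz⟩)
  have hcov : (fun z => lift (poissonKernel s k t) z • covD k u z) = fun w =>
      lift (poissonKernel s k t) w • (dZ (lift u) w +
        ((k : ℂ) / (4 * Complex.I) / (w.im : ℂ)) • lift u w) := by
    funext w; simp only [covD, div_div]
  rw [hcov]
  refine ⟨_, (hA z hz).congr_fderiv (congrArg₂ wirt rfl ?_)⟩
  have hL' := hL ⟨z, hz⟩
  rw [maassLaplacian] at hL'
  have hX : dX (lift u) z = dZ (lift u) z + dZbar (lift u) z := by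
    rw [dZ, dZbar]; module
  have hy : (z.im : ℂ) ≠ 0 := by exact_mod_cast hz.ne'
  have hLap : Laplacian.laplacian (lift u) z = ((Complex.I * k / z.im)) • (dZ (lift u) z + dZbar (lift u) z) -
      (s * (1 - s) / z.im ^ 2) • lift u z := by
    have h1 : (⟨z, hz⟩ : ℍ).im = z.im := rfl
    have h2 : ((⟨z, hz⟩ : ℍ) : ℂ) = z := rfl
    have h3 : u ⟨z, hz⟩ = lift u z := (lift_of_im_pos u hz).symm
    rw [h1, h2, h3, hX] at hL'
    have h4 : (z.im : ℂ) ^ 2 • Laplacian.laplacian (lift u) z =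
        (Complex.I * k * z.im) • (dZ (lift u) z + dZbar (lift u) z) - (s * (1 - s)) • lift u z := by
      rw [← hL']; abel
    have h5 := congrArg (fun v => ((z.im : ℂ) ^ 2)⁻¹ • v) h4
    simp only [smul_smul, inv_mul_cancel₀ (pow_ne_zero 2 hy), one_smul, smul_sub] at h5
    rw [h5]
    congr 2 <;> field_simp
  rw [hLap]
  have hpq := bdInv_sub t hz.ne'
  simp only [poissonLogZ, poissonLogZbar]
  generalize bdInv t (starRingEnd ℂ z) = q at *
  generalize bdInv t z = p at *
  generalize (lift (poissonKernel s k t) z) = R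
  generalize lift u z = U
  generalize dZ (lift u) z = A
  generalize dZbar (lift u) z = B
  generalize (z.im : ℂ) = y at *
  -- In terms of `Y = 1/(2iy)` all coefficients are polynomials in which `i` no longer occurs.
  obtain ⟨Y, hY⟩ : ∃ Y, Y = 1 / (2 * Complex.I * y) := ⟨_, rfl⟩
  have hI := Complex.I_sq
  have c1 : (k : ℂ) / (4 * Complex.I * y) = k / 2 * Y := by rw [hY]; field_simp; norm_num
  have c2 : Complex.I * k / y = -2 * k * Y := by
    rw [hY]; field_simp; linear_combination k * hI
  have c3 : s * (1 - s) / y ^ 2 = -4 * Y ^ 2 * (s * (1 - s)) := by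
    rw [hY]; field_simp; linear_combination 4 * s * (1 - s) * hI
  have c4 : s / (2 * Complex.I * y) = s * Y := by rw [hY]; field_simp
  have c5 : (k : ℂ) / (4 * Complex.I) / (2 * Complex.I * y ^ 2) = k / 2 * Y ^ 2 := by
    rw [hY]; field_simp; norm_num
  have c6 : (k : ℂ) / (4 * Complex.I) / y = k / 2 * Y := by rw [hY]; field_simp; norm_num
  have hpq' : Y * (p - q) = p * q := by rw [hpq, hY]; field_simp
  rw [c1, c2, c3, c4, c5, c6, ← hY]
  match_scalars
  · ring
  · linear_combination (R * (s + k / 2) * (s - k / 2)) * hpq'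
  · ring

end MaassPeriod

end

noncomputable section

namespace MaassPeriod

open Filter Topology Complex

variable {V : Type*} [NormedAddCommGroup V] [InnerProductSpace ℂ V]

/-! ### Invariance of the Green form -/

/-- The Möbius transformation attached to an integral matrix, as a function on `ℂ`. -/
def moeb (γ : SL(2, ℤ)) (w : ℂ) : ℂ :=
  ((γ 0 0 : ℂ) * w + (γ 0 1 : ℂ)) / ((γ 1 0 : ℂ) * w + (γ 1 1 : ℂ))

theorem moeb_coe (γ : SL(2, ℤ)) (z : ℍ) : moeb γ z = (γ • z : ℍ) := (coe_smul_eq γ z).symm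

theorem hasDerivAt_moeb (γ : SL(2, ℤ)) (z : ℍ) :
    HasDerivAt (moeb γ) (1 / autFactor γ z ^ 2) z := by
  have h0 := autFactor_ne_zero γ z
  have hlin : ∀ a b : ℂ, HasDerivAt (fun w : ℂ => a * w + b) a (z : ℂ) := fun a b => by
    simpa using ((hasDerivAt_id (z : ℂ)).const_mul a).add_const b
  refine ((hlin (γ 0 0) (γ 0 1)).div (hlin (γ 1 0) (γ 1 1)) h0).congr_deriv ?_
  rw [autFactor] at h0 ⊢
  have := det_eq_one γ
  field_simp
  linear_combination this

/-- `-ik arg w = -(k/2) log w + (k/2) conj (log w)` splits the inverse phase into a holomorphic and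
an antiholomorphic factor. -/
theorem hasFDerivAt_phase_inv (k : ℝ) (γ : SL(2, ℤ)) (z : ℍ) :
    HasFDerivAt (lift fun z => (phase k γ z)⁻¹)
      (wirt ((phase k γ z)⁻¹ * (-(k / 2) * ((γ 1 0 : ℂ) / autFactor γ z)))
        ((phase k γ z)⁻¹ * (k / 2 * starRingEnd ℂ ((γ 1 0 : ℂ) / autFactor γ z)))) (z : ℂ) := by
  have hlin : HasDerivAt (fun w : ℂ => (γ 1 0 : ℂ) * w + (γ 1 1 : ℂ)) (γ 1 0 : ℂ) (z : ℂ) := by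
    simpa using ((hasDerivAt_id (z : ℂ)).const_mul _).add_const (γ 1 1 : ℂ)
  have hlog : HasDerivAt (fun w : ℂ => Complex.log ((γ 1 0 : ℂ) * w + (γ 1 1 : ℂ)))
      ((γ 1 0 : ℂ) / autFactor γ z) (z : ℂ) := by
    by_cases h : γ 1 0 = 0
    · simpa [h] using hasDerivAt_const (z : ℂ) (Complex.log (γ 1 1 : ℂ))
    · exact hlin.clog (autFactor_mem_slitPlane h z)
  have h1 := hasFDerivAt_wirt_of_hasDerivAt hlog
  have h2 := hasFDerivAt_wirt_conj h1
  have h3 := hasFDerivAt_wirt_add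
    (hasFDerivAt_wirt_smul (hasFDerivAt_wirt_const (-(k / 2) : ℂ) z) h1)
    (hasFDerivAt_wirt_smul (hasFDerivAt_wirt_const (k / 2 : ℂ) z) h2)
  have h4 := hasFDerivAt_wirt_comp_left h3 (Complex.hasDerivAt_exp _)
  have e : ∀ w : ℂ, -(k / 2 : ℂ) * Complex.log w + k / 2 * starRingEnd ℂ (Complex.log w) =
      -(Complex.I * k * Complex.arg w) := by
    intro w
    have h : Complex.log w = Real.log ‖w‖ + Complex.arg w * Complex.I := rfl
    rw [h]
    simp only [map_add, map_mul, Complex.conj_ofReal, Complex.conj_I]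
    ring
  have heq : (lift fun z => (phase k γ z)⁻¹) =ᶠ[𝓝 (z : ℂ)] fun w =>
      Complex.exp (-(k / 2 : ℂ) • Complex.log ((γ 1 0 : ℂ) * w + (γ 1 1 : ℂ)) +
        (k / 2 : ℂ) • starRingEnd ℂ (Complex.log ((γ 1 0 : ℂ) * w + (γ 1 1 : ℂ)))) := by
    filter_upwards [eventually_im_pos z.im_pos] with w hw
    rw [lift_of_im_pos _ hw, smul_eq_mul, smul_eq_mul, e, phase, ← Complex.exp_neg]
    rfl
  refine (h4.congr_of_eventuallyEq heq).congr_fderiv ?_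
  have := heq.self_of_nhds
  rw [lift_coe] at this
  rw [this]
  congr 1 <;> simp

theorem hasFDerivAt_clm_comp {f : ℂ → V} {z : ℂ} {α β : V} (h : HasFDerivAt f (wirt α β) z)
    (L : V →L[ℂ] V) : HasFDerivAt (fun w => L (f w)) (wirt (L α) (L β)) z := by
  refine ((L.restrictScalars ℝ).hasFDerivAt.comp z h).congr_fderiv ?_
  ext w
  simp [wirt_apply]

variable {ρ : SL(2, ℤ) →* (V ≃ₗᵢ[ℂ] V)} {k : ℝ} {s : ℂ} {u : ℍ → V}

theorem apply_eq_of_slash {γ : SL(2, ℤ)} (h : slash ρ k γ u = u) (z : ℍ) :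
    u z = (mult k γ * phase k γ z)⁻¹ • ρ γ⁻¹ (u (γ • z)) := by
  rw [← slash_apply, h]

/-- Differentiating the phase produces `-(k/2) c/(cz+d)`. The change of `k/(4iy)` under `γ`
compensates it, because `conj (cz+d) = (cz+d) - 2iyc`; this is the purpose of the correction term in
`covD`. -/
theorem covD_eq_of_slash {γ : SL(2, ℤ)} (hu : IsSmooth u) (h : slash ρ k γ u = u) (z : ℍ) :
    covD k u z = ((mult k γ * phase k γ z)⁻¹ / autFactor γ z ^ 2) •
      ρ γ⁻¹ (covD k u (γ • z : ℍ)) := by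
  have hd : DifferentiableAt ℝ (lift u) ((γ • z : ℍ) : ℂ) := (hu (γ • z)).differentiableAt (by simp)
  have h1 := hasFDerivAt_wirt hd
  rw [← moeb_coe] at h1
  have h2 := hasFDerivAt_clm_comp (hasFDerivAt_wirt_comp h1 (hasDerivAt_moeb γ z))
    ((ρ γ⁻¹ : V ≃L[ℂ] V) : V →L[ℂ] V)
  have h3 := hasFDerivAt_wirt_smul (hasFDerivAt_wirt_smul
    (hasFDerivAt_wirt_const (mult k γ)⁻¹ (z : ℂ)) (hasFDerivAt_phase_inv k γ z)) h2
  have heq : lift u =ᶠ[𝓝 (z : ℂ)] fun w => ((mult k γ)⁻¹ • lift (fun z => (phase k γ z)⁻¹) w) •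
      ((ρ γ⁻¹ : V ≃L[ℂ] V) : V →L[ℂ] V) (lift u (moeb γ w)) := by
    filter_upwards [eventually_im_pos z.im_pos] with w hw
    rw [lift_of_im_pos _ hw, lift_of_im_pos _ hw, apply_eq_of_slash h, smul_eq_mul, mul_inv]
    have : moeb γ w = (γ • (⟨w, hw⟩ : ℍ) : ℍ) := moeb_coe γ ⟨w, hw⟩
    rw [this, lift_coe]
    rfl
  have h4 := dZ_eq_of_hasFDerivAt (h3.congr_of_eventuallyEq heq)
  rw [covD, covD, h4, heq.self_of_nhds]
  simp only [moeb_coe, lift_coe]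
  have e : ∀ v, ((ρ γ⁻¹ : V ≃L[ℂ] V) : V →L[ℂ] V) v = ρ γ⁻¹ v := fun _ => rfl
  simp only [e, map_add, map_smul]
  have him : (((γ • z).im : ℝ) : ℂ) = z.im / (autFactor γ z * starRingEnd ℂ (autFactor γ z)) := by
    rw [ModularGroup.im_smul_eq_div_normSq, autFactor_eq_denom, Complex.mul_conj]; push_cast; rfl
  have hj := autFactor_ne_zero γ z
  have hj' : starRingEnd ℂ (autFactor γ z) ≠ 0 := (map_ne_zero _).2 hj
  have hj2 : starRingEnd ℂ (autFactor γ z) = autFactor γ z - 2 * Complex.I * z.im * (γ 1 0 : ℂ) := by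
    simp only [autFactor]
    apply Complex.ext <;> simp
    ring
  have hm := mult_ne_zero k γ
  have hp := phase_ne_zero k γ z
  have hy : (z.im : ℂ) ≠ 0 := by exact_mod_cast z.im_pos.ne'
  simp only [UpperHalfPlane.coe_im, him, smul_eq_mul]
  generalize dZ (lift u) ↑(γ • z) = A
  generalize u (γ • z) = U
  match_scalars
  · field_simp
    rw [hj2]
    ring
  · field_simp

/-- The factor `(t - z)/(t - z̄)` transforms simply under the group and has modulus one for `t` in
`P¹(ℝ)`; the first gives invariance, the second an exact norm. -/
theorem poissonLogZbar_eq (t : OnePoint ℝ) (z : ℍ) :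
    poissonLogZbar s k t z = -((s + (k : ℂ) / 2) / (2 * Complex.I * z.im)) *
      crossQuot t z (starRingEnd ℂ (z : ℂ)) := by
  have hy : (z.im : ℂ) ≠ 0 := by exact_mod_cast z.im_pos.ne'
  rw [crossQuot_conj_eq t z.im_pos.ne', poissonLogZbar]
  simp only [UpperHalfPlane.coe_im]
  field_simp
  ring

theorem poissonLogZbar_smul (γ : SL(2, ℤ)) (t : OnePoint ℝ) (z : ℍ) :
    poissonLogZbar s k t z = poissonLogZbar s k (bdAct γ t) (γ • z : ℍ) *
      starRingEnd ℂ (1 / autFactor γ z ^ 2) := by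
  rw [poissonLogZbar_eq, poissonLogZbar_eq]
  have him : (((γ • z).im : ℝ) : ℂ) = z.im / (autFactor γ z * starRingEnd ℂ (autFactor γ z)) := by
    rw [ModularGroup.im_smul_eq_div_normSq, autFactor_eq_denom, Complex.mul_conj]; push_cast; rfl
  have hj := autFactor_ne_zero γ z
  have hj' : starRingEnd ℂ (autFactor γ z) ≠ 0 := (map_ne_zero _).2 hj
  have hy : (z.im : ℂ) ≠ 0 := by exact_mod_cast z.im_pos.ne'
  have hc : (γ 1 0 : ℂ) * starRingEnd ℂ (z : ℂ) + (γ 1 1 : ℂ) = starRingEnd ℂ (autFactor γ z) := by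
    simp [autFactor]
  have h := crossQuot_smul γ t (p := z) (q := starRingEnd ℂ (z : ℂ)) (p' := (γ • z : ℍ))
    (q' := starRingEnd ℂ ((γ • z : ℍ) : ℂ)) (jp := autFactor γ z)
    (jq := starRingEnd ℂ (autFactor γ z)) (by simpa using z.im_pos.ne') rfl hc
    (smul_mul_autFactor γ z) (by rw [← map_mul, smul_mul_autFactor]; simp)
    (by simpa using (γ • z).im_pos.ne') hj hj'
  simp only [him, map_div₀, map_pow, map_one]
  field_simp
  linear_combination (2 * s + k) * h

/-- Invariance of the Green form. -/
theorem greenCLM_smul {γ : SL(2, ℤ)} (hu : IsSmooth u) (h : slash ρ k γ u = u)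
    (t : OnePoint ℝ) (z : ℍ) (w : ℂ) :
    greenCLM s k u t z w = bdFactor s k γ t •
      ρ γ⁻¹ (greenCLM s k u (bdAct γ t) (γ • z : ℍ) (w / autFactor γ z ^ 2)) := by
  have hm := mul_ne_zero (mult_ne_zero k γ) (phase_ne_zero k γ z)
  have hj := autFactor_ne_zero γ z
  have hw : starRingEnd ℂ (w / autFactor γ z ^ 2) =
      starRingEnd ℂ w * starRingEnd ℂ (1 / autFactor γ z ^ 2) := by
    rw [← map_mul]; congr 1; ring
  rw [greenCLM, greenCLM, wirt_apply, wirt_apply, covD_eq_of_slash hu h z, hw]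
  simp only [lift_coe]
  rw [apply_eq_of_slash h z, poissonLogZbar_smul γ t z, ← bdFactor_mul_poissonKernel s k γ t z]
  simp only [map_add, map_smul]
  generalize mult k γ * phase k γ z = m at *
  match_scalars
  · field_simp
  · field_simp

end MaassPeriod

end

noncomputable section

namespace MaassPeriod

open Filter Topology Complex

variable {V : Type*} [NormedAddCommGroup V] [InnerProductSpace ℂ V]

/-! ### An interior gradient estimate -/

section GradientEstimate

variable {E : Type*} [NormedAddCommGroup E] [NormedSpace ℝ E]

/-- The Laplacian in terms of second derivatives. -/
def lap (f : ℂ → E) (z : ℂ) : E :=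
  fderiv ℝ (fderiv ℝ f) z 1 1 + fderiv ℝ (fderiv ℝ f) z Complex.I Complex.I

theorem differentiableAt_fderiv_of_contDiffAt {f : ℂ → E} {z : ℂ} (hf : ContDiffAt ℝ 2 f z) :
    DifferentiableAt ℝ (fderiv ℝ f) z :=
  (hf.fderiv_right (m := 1) (by norm_num)).differentiableAt (by simp)

/-- A positive second derivative would make the point a local minimum along the line as well, so the
restriction would be locally constant and its second derivative zero. -/
theorem fderiv_fderiv_nonpos_of_isLocalMax {f : ℂ → ℝ} {z : ℂ} (hf : ContDiffAt ℝ 2 f z)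
    (hm : IsLocalMax f z) (v : ℂ) : fderiv ℝ (fderiv ℝ f) z v v ≤ 0 := by
  by_contra! hpos
  let A : ℝ → ℂ := fun t => z + t • v
  have hA : ∀ t, HasDerivAt A v t := fun t =>
    (((hasDerivAt_id t).smul_const v).const_add z).congr_deriv (by simp)
  have hA0 : A 0 = z := by simp [A]
  have hAc : ContinuousAt A 0 := (hA 0).continuousAt
  have hev : ∀ᶠ w in 𝓝 z, DifferentiableAt ℝ f w :=
    (hf.eventually (by simp)).mono fun w hw => hw.differentiableAt (by simp)
  have hev' : ∀ᶠ t in 𝓝 (0 : ℝ), DifferentiableAt ℝ f (A t) := by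
    have := hAc.tendsto; rw [hA0] at this; exact this.eventually hev
  have hd1 : deriv (f ∘ A) =ᶠ[𝓝 0] fun t => fderiv ℝ f (A t) v := by
    filter_upwards [hev'] with t ht
    exact (ht.hasFDerivAt.comp_hasDerivAt t (hA t)).deriv
  have hd2 : deriv (deriv (f ∘ A)) 0 = fderiv ℝ (fderiv ℝ f) z v v := by
    rw [hd1.deriv_eq]
    have h1 : HasDerivAt (fun t => fderiv ℝ f (A t)) (fderiv ℝ (fderiv ℝ f) z v) 0 := by
      have := (differentiableAt_fderiv_of_contDiffAt hf).hasFDerivAt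
      rw [← hA0] at this
      have := this.comp_hasDerivAt 0 (hA 0)
      rwa [hA0] at this
    exact (h1.clm_apply (hasDerivAt_const 0 v)).deriv.trans (by simp)
  have hmax : IsLocalMax (f ∘ A) 0 := by
    have := hAc.tendsto; rw [hA0] at this
    have := this.eventually hm
    simpa [IsLocalMax, IsMaxFilter, hA0] using this
  have hcont : ContinuousAt (f ∘ A) 0 := by
    refine ContinuousAt.comp ?_ hAc
    rw [hA0]; exact hf.continuousAt
  have hmin := isLocalMin_of_deriv_deriv_pos (by rw [hd2]; exact hpos) hmax.deriv_eq_zero hcont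
  have hconst : f ∘ A =ᶠ[𝓝 0] fun _ => (f ∘ A) 0 := by
    filter_upwards [hmax, hmin] with t h1 h2
    exact le_antisymm h1 h2
  have : deriv (deriv (f ∘ A)) 0 = 0 := by
    rw [hconst.deriv.deriv_eq]; simp
  rw [hd2] at this
  exact hpos.ne' this

/-- Maximum principle: at a maximum in `U` both pure second derivatives are nonpositive, against a
positive Laplacian, so the maximum over `K` is taken off `U`. -/
theorem nonpos_of_lap_pos {f : ℂ → ℝ} {K U : Set ℂ} (hK : IsCompact K) (hU : IsOpen U)
    (hUK : U ⊆ K) (hc : ContinuousOn f K) (hf : ∀ z ∈ U, ContDiffAt ℝ 2 f z)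
    (hl : ∀ z ∈ U, 0 < lap f z) (hb : ∀ z ∈ K \ U, f z ≤ 0) (z : ℂ) (hz : z ∈ K) : f z ≤ 0 := by
  obtain ⟨w, hw, hmax⟩ := hK.exists_isMaxOn ⟨z, hz⟩ hc
  refine (hmax hz).trans ?_
  by_cases hwU : w ∈ U
  · exfalso
    have hloc : IsLocalMax f w := hmax.isLocalMax (mem_of_superset (hU.mem_nhds hwU) hUK)
    have h1 := fderiv_fderiv_nonpos_of_isLocalMax (hf w hwU) hloc 1
    have h2 := fderiv_fderiv_nonpos_of_isLocalMax (hf w hwU) hloc Complex.I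
    have := hl w hwU
    rw [lap] at this
    linarith
  · exact hb w ⟨hw, hwU⟩

theorem fderiv_fderiv_comp_affine {f : ℂ → E} (c : ℂ) (L : ℂ →L[ℝ] ℂ) {z : ℂ}
    (hf : ContDiffAt ℝ 2 f (c + L z)) (v w : ℂ) :
    fderiv ℝ (fderiv ℝ fun z => f (c + L z)) z v w =
      fderiv ℝ (fderiv ℝ f) (c + L z) (L v) (L w) := by
  have hA : ∀ z, HasFDerivAt (fun z => c + L z) L z := fun z => L.hasFDerivAt.const_add c
  have hev : ∀ᶠ w in 𝓝 z, DifferentiableAt ℝ f (c + L w) :=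
    (hA z).continuousAt.tendsto.eventually
      ((hf.eventually (by simp)).mono fun w hw => hw.differentiableAt (by simp))
  have h1 : (fderiv ℝ fun z => f (c + L z)) =ᶠ[𝓝 z] fun w => (fderiv ℝ f (c + L w)).comp L := by
    filter_upwards [hev] with w hw
    exact (hw.hasFDerivAt.comp w (hA w)).fderiv
  have h2 := (differentiableAt_fderiv_of_contDiffAt hf).hasFDerivAt.comp z (hA z)
  have h3 := h2.clm_comp (hasFDerivAt_const L z)
  rw [h1.fderiv_eq]
  erw [h3.fderiv]
  simp

theorem lap_sub {f g : ℂ → ℝ} {z : ℂ} (hf : ContDiffAt ℝ 2 f z) (hg : ContDiffAt ℝ 2 g z) :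
    lap (fun z => f z - g z) z = lap f z - lap g z := by
  have h1 : fderiv ℝ (fun z => f z - g z) =ᶠ[𝓝 z] fun w => fderiv ℝ f w - fderiv ℝ g w := by
    filter_upwards [(hf.eventually (by simp)).mono fun w hw => hw.differentiableAt (by simp),
      (hg.eventually (by simp)).mono fun w hw => hw.differentiableAt (by simp)] with w h1 h2
    exact fderiv_sub h1 h2
  rw [lap, h1.fderiv_eq, fderiv_fun_sub (differentiableAt_fderiv_of_contDiffAt hf)
    (differentiableAt_fderiv_of_contDiffAt hg), lap, lap]
  simp only [_root_.sub_apply]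
  ring

theorem lap_quadratic (a b c : ℝ) (z : ℂ) :
    lap (fun z : ℂ => a * z.re ^ 2 + b * z.im - c * z.im ^ 2) z = 2 * a - 2 * c := by
  have h1 : ∀ w : ℂ, HasFDerivAt (fun z : ℂ => a * z.re ^ 2 + b * z.im - c * z.im ^ 2)
      ((2 * a * w.re) • Complex.reCLM + (b - 2 * c * w.im) • Complex.imCLM) w := fun w => by
    have hr : HasFDerivAt (fun z : ℂ => z.re) Complex.reCLM w := Complex.reCLM.hasFDerivAt
    have hi : HasFDerivAt (fun z : ℂ => z.im) Complex.imCLM w := Complex.imCLM.hasFDerivAt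
    refine ((((hr.pow 2).const_mul a).add (hi.const_mul b)).sub
      ((hi.pow 2).const_mul c)).congr_fderiv ?_
    ext v; simp; ring
  have h2 : fderiv ℝ (fun z : ℂ => a * z.re ^ 2 + b * z.im - c * z.im ^ 2) =
      fun w => (2 * a * w.re) • Complex.reCLM + (b - 2 * c * w.im) • Complex.imCLM :=
    funext fun w => (h1 w).fderiv
  have h3 : HasFDerivAt (fun w : ℂ => (2 * a * w.re) • Complex.reCLM +
      (b - 2 * c * w.im) • Complex.imCLM)
      (((2 * a) • Complex.reCLM).smulRight Complex.reCLM +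
        (-(2 * c) • Complex.imCLM).smulRight Complex.imCLM) z := by
    have hr : HasFDerivAt (fun z : ℂ => z.re) Complex.reCLM z := Complex.reCLM.hasFDerivAt
    have hi : HasFDerivAt (fun z : ℂ => z.im) Complex.imCLM z := Complex.imCLM.hasFDerivAt
    refine (((hr.const_mul (2 * a)).smul_const Complex.reCLM).add
      (((hi.const_mul (2 * c)).const_sub b).smul_const Complex.imCLM)).congr_fderiv ?_
    ext; simp
  rw [lap, h2, h3.fderiv]
  simp
  ring

/-- One-sided derivative bound at the origin by comparison with a quadratic barrier. -/
theorem fderiv_I_le_of_lap_bound {f : ℂ → ℝ} {d U N : ℝ} (hd : 0 < d)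
    (hf : ∀ z : ℂ, |z.re| ≤ d → |z.im| ≤ d → ContDiffAt ℝ 2 f z)
    (hU : ∀ z : ℂ, |z.re| ≤ d → |z.im| ≤ d → |f z| ≤ U)
    (hN : ∀ z : ℂ, |z.re| ≤ d → |z.im| ≤ d → |lap f z| < N) :
    fderiv ℝ f 0 Complex.I ≤ 2 * U / d + N * d / 2 := by
  have hU0 : 0 ≤ U := (abs_nonneg _).trans (hU 0 (by simpa using hd.le) (by simpa using hd.le))
  have hN0 : 0 ≤ N :=
    (abs_nonneg _).trans (hN 0 (by simpa using hd.le) (by simpa using hd.le)).le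
  -- Constants of the barrier `ψ = a x² + b y - c y²` on `[-d, d] × [0, d]`. From `a - c = -N/2` the
  -- Laplacian of `2ψ` is `-2N`, which outweighs those of `f` and of its reflection; `a d² = U` and
  -- the choice of `b` give `ψ ≥ U` on the three sides off the real axis.
  set a := U / d ^ 2 with ha
  set b := 2 * U / d + N * d / 2 with hb
  set c := U / d ^ 2 + N / 2 with hc
  have ha0 : 0 ≤ a := by positivity
  let L : ℂ →L[ℝ] ℂ := (Complex.conjCLE : ℂ →L[ℝ] ℂ)
  have hL : ∀ z, L z = starRingEnd ℂ z := fun _ => rfl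
  -- Subtracting the reflection makes the difference vanish on the real side, where `f` itself is
  -- only bounded by `U`.
  let f' : ℂ → ℝ := fun z => f (0 + L z)
  let ψ : ℂ → ℝ := fun z => a * z.re ^ 2 + b * z.im - c * z.im ^ 2
  let g : ℂ → ℝ := fun z => f z - f' z - 2 * ψ z
  let K : Set ℂ := Set.Icc (-d) d ×ℂ Set.Icc 0 d
  let O : Set ℂ := Set.Ioo (-d) d ×ℂ Set.Ioo 0 d
  have hKm : ∀ z ∈ K, |z.re| ≤ d ∧ 0 ≤ z.im ∧ z.im ≤ d ∧ |z.im| ≤ d ∧ |(L z).re| ≤ d ∧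
      |(L z).im| ≤ d := by
    rintro z ⟨h1, h2⟩
    have h1' : |z.re| ≤ d := abs_le.2 h1
    have h2' : |z.im| ≤ d := abs_le.2 ⟨by linarith [h2.1], h2.2⟩
    exact ⟨h1', h2.1, h2.2, h2', by simpa [hL] using h1', by simpa [hL] using h2'⟩
  have hOK : O ⊆ K := fun z hz => ⟨Set.Ioo_subset_Icc_self hz.1, Set.Ioo_subset_Icc_self hz.2⟩
  have hf1 : ∀ z ∈ K, ContDiffAt ℝ 2 f z := fun z hz => hf z (hKm z hz).1 (hKm z hz).2.2.2.1
  have hf0 : ∀ z ∈ K, ContDiffAt ℝ 2 f (0 + L z) := fun z hz => by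
    rw [zero_add]; exact hf _ (hKm z hz).2.2.2.2.1 (hKm z hz).2.2.2.2.2
  have hf2 : ∀ z ∈ K, ContDiffAt ℝ 2 f' z := fun z hz =>
    (hf0 z hz).comp z (contDiffAt_const.add L.contDiff.contDiffAt)
  have hψ : ContDiff ℝ 2 ψ := by
    have hr : ContDiff ℝ 2 (fun z : ℂ => z.re) := Complex.reCLM.contDiff
    have hi : ContDiff ℝ 2 (fun z : ℂ => z.im) := Complex.imCLM.contDiff
    exact ((contDiff_const.mul (hr.pow 2)).add (contDiff_const.mul hi)).sub
      (contDiff_const.mul (hi.pow 2))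
  have hψ2 : ContDiff ℝ 2 (fun z => 2 * ψ z) := contDiff_const.mul hψ
  have hlapψ : ∀ z, lap (fun z => 2 * ψ z) z = -2 * N := fun z => by
    have e : (fun z => 2 * ψ z) = fun z : ℂ => (2 * a) * z.re ^ 2 + (2 * b) * z.im -
        (2 * c) * z.im ^ 2 := by funext z; simp only [ψ]; ring
    rw [e, lap_quadratic, hc, ha]; ring
  have hlapf' : ∀ z ∈ K, lap f' z = lap f (L z) := fun z hz => by
    rw [lap, lap, fderiv_fderiv_comp_affine 0 L (hf0 z hz), fderiv_fderiv_comp_affine 0 L (hf0 z hz)]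
    simp [hL]
  have key := nonpos_of_lap_pos (f := g) (K := K) (U := O)
    (isCompact_Icc.reProdIm isCompact_Icc) (isOpen_Ioo.reProdIm isOpen_Ioo) hOK
    (fun z hz => (((hf1 z hz).sub (hf2 z hz)).sub hψ2.contDiffAt).continuousAt.continuousWithinAt)
    (fun z hz => ((hf1 z (hOK hz)).sub (hf2 z (hOK hz))).sub hψ2.contDiffAt)
    (fun z hz => by
      have hz := hOK hz
      obtain ⟨h1, h2, h3, h4, h5, h6⟩ := hKm z hz
      have e1 := lap_sub ((hf1 z hz).sub (hf2 z hz)) hψ2.contDiffAt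
      have e2 := lap_sub (hf1 z hz) (hf2 z hz)
      have e3 : lap g z = lap f z - lap f (L z) + 2 * N := by
        rw [← hlapf' z hz]
        have : lap g z = lap (fun z => f z - f' z) z - lap (fun z => 2 * ψ z) z := e1
        rw [this, e2, hlapψ]; ring
      have i1 := abs_lt.1 (hN z h1 h4)
      have i2 := abs_lt.1 (hN _ h5 h6)
      rw [e3]; linarith [i1.1, i2.2])
    (fun z hz => by
      obtain ⟨hzK, hzO⟩ := hz
      obtain ⟨h1, h2, h3, h4, h5, h6⟩ := hKm z hzK
      have i1 := abs_le.1 (hU z h1 h4)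
      have i2 := abs_le.1 (hU _ h5 h6)
      have e : ψ z = U / d ^ 2 * (z.re ^ 2 + z.im * (2 * d - z.im)) + N / 2 * (z.im * (d - z.im)) := by
        simp only [ψ, ha, hb, hc]; field_simp; ring
      have p1 : 0 ≤ N / 2 * (z.im * (d - z.im)) :=
        mul_nonneg (by positivity) (mul_nonneg h2 (by linarith))
      have p2 : 0 ≤ z.im * (2 * d - z.im) := mul_nonneg h2 (by linarith)
      by_cases hy : z.im = 0
      · have : L z = z := by rw [hL]; exact Complex.conj_eq_iff_im.2 hy
        simp only [g, f', zero_add, this, e, hy]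
        simp
        positivity
      · have hge : d ^ 2 ≤ z.re ^ 2 + z.im * (2 * d - z.im) := by
          by_cases hx : |z.re| = d
          · have hx2 : z.re ^ 2 = d ^ 2 := by rw [← sq_abs, hx]
            linarith
          · have hy2 : z.im = d := by
              by_contra hy3
              refine hzO ⟨?_, ?_⟩
              · exact abs_lt.1 (lt_of_le_of_ne h1 hx)
              · exact ⟨lt_of_le_of_ne h2 (Ne.symm hy), lt_of_le_of_ne h3 hy3⟩
            rw [hy2]; nlinarith [sq_nonneg z.re]
        have : U ≤ U / d ^ 2 * (z.re ^ 2 + z.im * (2 * d - z.im)) := by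
          calc U = U / d ^ 2 * d ^ 2 := by field_simp
            _ ≤ _ := mul_le_mul_of_nonneg_left hge (by positivity)
        simp only [g, f', zero_add, e]
        linarith [i1.2, i2.1])
  have hf00 : DifferentiableAt ℝ f 0 :=
    (hf 0 (by simpa using hd.le) (by simpa using hd.le)).differentiableAt (by simp)
  have hline : HasDerivAt (fun t : ℝ => f (t • Complex.I)) (fderiv ℝ f 0 Complex.I) 0 := by
    have h1 : HasDerivAt (fun t : ℝ => t • Complex.I) Complex.I 0 := by
      simpa using (hasDerivAt_id (0 : ℝ)).smul_const Complex.I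
    have h2 := hf00.hasFDerivAt
    rw [show (0 : ℂ) = (0 : ℝ) • Complex.I by simp] at h2
    exact (h2.comp_hasDerivAt (0 : ℝ) h1).congr_deriv (by simp)
  have hline2 : HasDerivAt (fun t : ℝ => f (-t • Complex.I)) (-fderiv ℝ f 0 Complex.I) 0 := by
    have := HasDerivAt.scomp (0 : ℝ) (g₁ := fun t : ℝ => f (t • Complex.I)) (h := fun t => -t)
      (by simpa using hline) (hasDerivAt_neg 0)
    simpa [Function.comp_def] using this
  -- `f(it) - f(-it)` has derivative `2 ∂_y f(0)` at `t = 0` and, by the comparison, is at most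
  -- `2ψ(it) ≤ 2bt` for small positive `t`.
  have hdiff := (hline.sub hline2).hasDerivWithinAt (s := Set.Ioi 0)
  rw [hasDerivWithinAt_iff_tendsto_slope' (by simp)] at hdiff
  have hle : fderiv ℝ f 0 Complex.I - -fderiv ℝ f 0 Complex.I ≤ 2 * b := by
    refine le_of_tendsto hdiff ?_
    filter_upwards [Ioo_mem_nhdsGT hd] with t ht
    have hz : (t • Complex.I : ℂ) ∈ K := by
      refine ⟨?_, ?_⟩ <;> simp [hd.le, ht.1.le, ht.2.le]
    have := key _ hz
    simp only [g, f', ψ, hL, zero_add] at this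
    have e : starRingEnd ℂ (t • Complex.I) = -t • Complex.I := by simp
    rw [e] at this
    simp only [slope, vsub_eq_sub, sub_zero, Pi.sub_apply, zero_smul, neg_zero, sub_self,
      smul_eq_mul]
    rw [inv_mul_le_iff₀ ht.1]
    simp at this
    have hc0 : 0 ≤ c := by positivity
    have : 0 ≤ c * t ^ 2 := by positivity
    simp
    linarith
  linarith

end GradientEstimate

end MaassPeriod

end

/-! ### Gradient bounds for vector-valued functions and decay of the gradient of a cusp form. -/

noncomputable section

namespace MaassPeriod

open Filter Topology Complex

variable {V : Type*} [NormedAddCommGroup V] [InnerProductSpace ℂ V]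

section GradientEstimate

variable {E : Type*} [NormedAddCommGroup E] [NormedSpace ℝ E]

/-- A norming functional reduces to real values, and a rotation by `1` or `-i`, which preserves the
Laplacian, turns the direction `ζ` into `i`. The square of half-side `d` fits into the ball of
radius `2d`. -/
theorem norm_fderiv_le_of_lap_bound {f : ℂ → E} {z₀ ζ : ℂ} {d U N : ℝ} (hd : 0 < d)
    (hζ : ζ = 1 ∨ ζ = Complex.I)
    (hf : ∀ z ∈ Metric.closedBall z₀ (2 * d), ContDiffAt ℝ 2 f z)
    (hU : ∀ z ∈ Metric.closedBall z₀ (2 * d), ‖f z‖ ≤ U)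
    (hN : ∀ z ∈ Metric.closedBall z₀ (2 * d), ‖lap f z‖ < N) :
    ‖fderiv ℝ f z₀ ζ‖ ≤ 2 * U / d + N * d / 2 := by
  obtain ⟨g, hg1, hg2⟩ := exists_dual_vector'' ℝ (fderiv ℝ f z₀ ζ)
  have hg2' : g (fderiv ℝ f z₀ ζ) = ‖fderiv ℝ f z₀ ζ‖ := hg2
  obtain ⟨ξ, hξ, hξn, hξ2⟩ : ∃ ξ : ℂ, ξ * Complex.I = ζ ∧ ‖ξ‖ = 1 ∧ (ξ = 1 ∨ ξ = -Complex.I) := by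
    rcases hζ with rfl | rfl
    · exact ⟨-Complex.I, by simp, by simp, Or.inr rfl⟩
    · exact ⟨1, by simp, by simp, Or.inl rfl⟩
  let L : ℂ →L[ℝ] ℂ := ContinuousLinearMap.mul ℝ ℂ ξ
  have hL : ∀ z, L z = ξ * z := fun _ => rfl
  have hmem : ∀ z : ℂ, |z.re| ≤ d → |z.im| ≤ d → z₀ + L z ∈ Metric.closedBall z₀ (2 * d) := by
    intro z h1 h2
    rw [mem_closedBall_iff_norm, add_sub_cancel_left, hL, norm_mul, hξn, one_mul]
    exact (Complex.norm_le_abs_re_add_abs_im z).trans (by linarith)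
  have hgf : ∀ z ∈ Metric.closedBall z₀ (2 * d), ContDiffAt ℝ 2 (fun z => g (f z)) z :=
    fun z hz => g.contDiff.contDiffAt.comp z (hf z hz)
  have hlapg : ∀ z ∈ Metric.closedBall z₀ (2 * d), ∀ v w : ℂ,
      fderiv ℝ (fderiv ℝ fun z => g (f z)) z v w = g (fderiv ℝ (fderiv ℝ f) z v w) := by
    intro z hz v w
    have h1 : (fderiv ℝ fun z => g (f z)) =ᶠ[𝓝 z] fun w => g.comp (fderiv ℝ f w) := by
      filter_upwards [(hf z hz).eventually (by simp)] with w hw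
      exact (g.hasFDerivAt.comp w (hw.differentiableAt (by simp)).hasFDerivAt).fderiv
    have h2 := (hasFDerivAt_const g z).clm_comp
      (differentiableAt_fderiv_of_contDiffAt (hf z hz)).hasFDerivAt
    rw [h1.fderiv_eq]
    erw [h2.fderiv]
    simp
  have key := fderiv_I_le_of_lap_bound (f := fun z => g (f (z₀ + L z))) (d := d) (U := U) (N := N)
    hd (fun z h1 h2 => by
      have hl : ContDiffAt ℝ 2 (fun z : ℂ => z₀ + L z) z := contDiffAt_const.add L.contDiff.contDiffAt
      exact ContDiffAt.comp (g := fun z => g (f z)) z (hgf _ (hmem z h1 h2)) hl)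
    (fun z h1 h2 => (g.le_opNorm _).trans ((mul_le_of_le_one_left (norm_nonneg _) hg1).trans
      (hU _ (hmem z h1 h2))))
    (fun z h1 h2 => by
      have hm := hmem z h1 h2
      rw [lap, fderiv_fderiv_comp_affine (f := fun z => g (f z)) z₀ L (hgf _ hm),
        fderiv_fderiv_comp_affine (f := fun z => g (f z)) z₀ L (hgf _ hm), hlapg _ hm, hlapg _ hm,
        ← map_add]
      have e : fderiv ℝ (fderiv ℝ f) (z₀ + L z) (L 1) (L 1) +
          fderiv ℝ (fderiv ℝ f) (z₀ + L z) (L Complex.I) (L Complex.I) = lap f (z₀ + L z) := by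
        simp only [lap, hL]
        rcases hξ2 with rfl | rfl
        · simp
        · simp [add_comm]
      rw [e]
      exact (g.le_opNorm _).trans_lt ((mul_le_of_le_one_left (norm_nonneg _) hg1).trans_lt
        (hN _ hm)))
  have h0 : z₀ + L 0 = z₀ := by simp
  have hz0 : z₀ ∈ Metric.closedBall z₀ (2 * d) := by simp [hd.le]
  have hd1 : HasFDerivAt f (fderiv ℝ f z₀) (z₀ + L 0) := by
    rw [h0]; exact ((hf z₀ hz0).differentiableAt (by simp)).hasFDerivAt
  have hd2 := g.hasFDerivAt.comp (0 : ℂ) (hd1.comp (0 : ℂ) (L.hasFDerivAt.const_add z₀))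
  have hd3 : fderiv ℝ (fun z => g (f (z₀ + L z))) 0 Complex.I = ‖fderiv ℝ f z₀ ζ‖ := by
    erw [hd2.fderiv]
    rw [← hg2']
    simp [hL, hξ]
  rw [← hd3]
  exact key

/-- Interior gradient estimate for solutions of an elliptic equation with small coefficients. -/
theorem norm_fderiv_le_of_norm_lap_le {f : ℂ → E} {z₀ : ℂ} {U κ μ : ℝ} (hU0 : 0 < U)
    (hκ : κ ≤ 1) (hκ0 : 0 ≤ κ) (hμ : μ ≤ 1)
    (hf : ∀ z ∈ Metric.closedBall z₀ 1, ContDiffAt ℝ 2 f z)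
    (hU : ∀ z ∈ Metric.closedBall z₀ 1, ‖f z‖ ≤ U)
    (hL : ∀ z ∈ Metric.closedBall z₀ 1, ‖lap f z‖ ≤ κ * ‖fderiv ℝ f z 1‖ + μ * ‖f z‖) :
    ‖fderiv ℝ f z₀ 1‖ + ‖fderiv ℝ f z₀ Complex.I‖ ≤ 33 * U := by
  let q : ℂ → ℝ := fun z => ‖fderiv ℝ f z 1‖ + ‖fderiv ℝ f z Complex.I‖
  have hq0 : ∀ z, 0 ≤ q z := fun z => by positivity
  have hfc : ∀ z ∈ Metric.closedBall z₀ 1, ContinuousAt (fderiv ℝ f) z := fun z hz =>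
    (differentiableAt_fderiv_of_contDiffAt (hf z hz)).continuousAt
  have hcont : ContinuousOn (fun z => (1 - ‖z - z₀‖) * q z) (Metric.closedBall z₀ 1) := by
    intro z hz
    have h1 : ∀ v : ℂ, ContinuousAt (fun z => ‖fderiv ℝ f z v‖) z := fun v =>
      ((hfc z hz).clm_apply continuousAt_const).norm
    exact (ContinuousAt.mul (by fun_prop) ((h1 1).add (h1 Complex.I))).continuousWithinAt
  obtain ⟨w, hw, hmax⟩ := (isCompact_closedBall z₀ 1).exists_isMaxOn ⟨z₀, by simp⟩ hcont
  set M := (1 - ‖w - z₀‖) * q w with hM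
  have hmax' : ∀ z ∈ Metric.closedBall z₀ 1, (1 - ‖z - z₀‖) * q z ≤ M := fun z hz => hmax hz
  have h0 : q z₀ ≤ M := by simpa using hmax' z₀ (by simp)
  refine h0.trans ?_
  have hw1 : ‖w - z₀‖ ≤ 1 := by simpa [dist_eq_norm] using hw
  rcases eq_or_lt_of_le hw1 with h | h
  · rw [hM, h]; simp; positivity
  set r := 1 - ‖w - z₀‖ with hr
  have hr0 : 0 < r := by linarith
  have hr1 : r ≤ 1 := by rw [hr]; linarith [norm_nonneg (w - z₀)]
  have hM0 : 0 ≤ M := mul_nonneg hr0.le (hq0 w)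
  have hsub : ∀ z ∈ Metric.closedBall w (2 * (r / 4)), z ∈ Metric.closedBall z₀ 1 ∧
      r / 2 ≤ 1 - ‖z - z₀‖ := by
    intro z hz
    rw [mem_closedBall_iff_norm] at hz
    have : ‖z - z₀‖ ≤ ‖z - w‖ + ‖w - z₀‖ := norm_sub_le_norm_sub_add_norm_sub _ _ _
    refine ⟨mem_closedBall_iff_norm.2 ?_, ?_⟩ <;> linarith
  have hq : ∀ z ∈ Metric.closedBall w (2 * (r / 4)), q z ≤ 2 * M / r := by
    intro z hz
    obtain ⟨h1, h2⟩ := hsub z hz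
    rw [le_div_iff₀ hr0]
    have := hmax' z h1
    nlinarith [hq0 z]
  -- The second `U` only serves to make the inequality strict.
  have hlap : ∀ z ∈ Metric.closedBall w (2 * (r / 4)), ‖lap f z‖ < κ * (2 * M / r) + U + U := by
    intro z hz
    obtain ⟨h1, h2⟩ := hsub z hz
    have e1 := hL z h1
    have e2 : ‖fderiv ℝ f z 1‖ ≤ 2 * M / r :=
      le_trans (le_add_of_nonneg_right (norm_nonneg _)) (hq z hz)
    have e3 : κ * ‖fderiv ℝ f z 1‖ ≤ κ * (2 * M / r) := mul_le_mul_of_nonneg_left e2 hκ0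
    have e4 : μ * ‖f z‖ ≤ U :=
      (mul_le_of_le_one_left (norm_nonneg _) hμ).trans (hU z h1)
    linarith
  have hb := fun ζ hζ => norm_fderiv_le_of_lap_bound (f := f) (z₀ := w) (ζ := ζ) (d := r / 4)
    (U := U) (by positivity) hζ (fun z hz => hf z (hsub z hz).1) (fun z hz => hU z (hsub z hz).1) hlap
  have hb1 := hb 1 (Or.inl rfl)
  have hb2 := hb Complex.I (Or.inr rfl)
  have hfin : M ≤ r * (2 * (2 * U / (r / 4) + (κ * (2 * M / r) + U + U) * (r / 4) / 2)) := by
    rw [hM]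
    refine mul_le_mul_of_nonneg_left ?_ hr0.le
    simp only [q]; linarith
  have e : r * (2 * (2 * U / (r / 4) + (κ * (2 * M / r) + U + U) * (r / 4) / 2)) =
      16 * U + κ * M * r / 2 + U * r ^ 2 / 2 := by field_simp; ring
  rw [e] at hfin
  -- The gradient term on the right is at most `M/2` and is absorbed: `M ≤ 16 U + M/2 + U/2` gives
  -- the constant `33`.
  have e5 : κ * M * r ≤ M := by
    have : κ * M ≤ M := mul_le_of_le_one_left hM0 hκ
    have : κ * M * r ≤ κ * M := mul_le_of_le_one_right (mul_nonneg hκ0 hM0) hr1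
    linarith
  have e6 : U * r ^ 2 ≤ U := mul_le_of_le_one_right hU0.le (pow_le_one₀ hr0.le hr1)
  linarith

end GradientEstimate

theorem lap_eq_laplacian (f : ℂ → V) (z : ℂ) : lap f z = Laplacian.laplacian f z := by
  rw [InnerProductSpace.laplacian_eq_iteratedFDeriv_complexPlane, lap]
  simp [iteratedFDeriv_two_apply]

/-- Exponential decay of a cusp form together with its gradient. -/
theorem exists_decay_fderiv {k : ℝ} {s : ℂ} {u : ℍ → V} (hu : IsSmooth u)
    (hL : ∀ z : ℍ, maassLaplacian k u z = (s * (1 - s)) • u z) (hd : ExpDecay u) (B : ℝ) :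
    ∃ a C Y : ℝ, 0 < a ∧ 0 < C ∧ 1 ≤ Y ∧ ∀ z : ℂ, |z.re| ≤ B → Y ≤ z.im →
      ‖lift u z‖ ≤ C * Real.exp (-a * z.im) ∧
      ‖fderiv ℝ (lift u) z 1‖ + ‖fderiv ℝ (lift u) z Complex.I‖ ≤ C * Real.exp (-a * z.im) := by
  obtain ⟨a, ha, hd⟩ := hd
  obtain ⟨C, Y, hd⟩ := hd (Set.Icc (-(B + 1)) (B + 1)) isCompact_Icc
  set C' := max C 1
  have hC' : 0 < C' := lt_max_of_lt_right one_pos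
  set l := ‖s * (1 - s)‖
  have hdec : ∀ z : ℂ, |z.re| ≤ B + 1 → Y ≤ z.im → 0 < z.im →
      ‖lift u z‖ ≤ C' * Real.exp (-a * z.im) := by
    intro z h1 h2 h3
    rw [lift_of_im_pos u h3]
    refine (hd ⟨z, h3⟩ (abs_le.1 h1) h2).trans ?_
    exact mul_le_mul_of_nonneg_right (le_max_left _ _) (Real.exp_nonneg _)
  -- `33` is the constant of the interior estimate and `exp a` pays for the unit drop in height
  -- across the ball. The threshold ensures that `y - 1` exceeds `|k|` and `l`, so that `y² Δu = iky
  -- u_x - s(1-s) u`, divided by `y²`, has coefficients at most one.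
  refine ⟨a, 33 * (C' * Real.exp a), max Y 0 + |k| + l + 2, ha, by positivity, ?_, ?_⟩
  · have : 0 ≤ max Y 0 := le_max_right _ _
    have := abs_nonneg k
    have : 0 ≤ l := norm_nonneg _
    linarith
  intro z hB hz
  have y1 : 0 ≤ max Y 0 := le_max_right _ _
  have y2 : Y ≤ max Y 0 := le_max_left _ _
  have k0 := abs_nonneg k
  have l0 : 0 ≤ l := norm_nonneg _
  have hexp : Real.exp a * Real.exp (-a * z.im) = Real.exp (-a * (z.im - 1)) := by
    rw [← Real.exp_add]; congr 1; ring
  have hball : ∀ w ∈ Metric.closedBall z 1, |w.re| ≤ B + 1 ∧ z.im - 1 ≤ w.im := by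
    intro w hw
    rw [mem_closedBall_iff_norm] at hw
    have h1 := (Complex.abs_re_le_norm (w - z)).trans hw
    have h2 := (Complex.abs_im_le_norm (w - z)).trans hw
    simp only [sub_re, sub_im] at h1 h2
    rw [abs_le] at h1 h2 hB ⊢
    exact ⟨⟨by linarith [h1.1, hB.1], by linarith [h1.2, hB.2]⟩, by linarith [h2.1]⟩
  refine ⟨?_, ?_⟩
  · have := hdec z (by linarith) (by linarith) (by linarith)
    refine this.trans (mul_le_mul_of_nonneg_right ?_ (Real.exp_nonneg _))
    have : 1 ≤ Real.exp a := Real.one_le_exp ha.le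
    nlinarith
  · have key := norm_fderiv_le_of_norm_lap_le (f := lift u) (z₀ := z)
      (U := C' * Real.exp (-a * (z.im - 1))) (κ := |k| / (z.im - 1)) (μ := l / (z.im - 1))
      (by positivity) ((div_le_one (by linarith)).2 (by linarith))
      (div_nonneg k0 (by linarith)) ((div_le_one (by linarith)).2 (by linarith))
      (fun w hw => ?_) (fun w hw => ?_) (fun w hw => ?_)
    · refine key.trans (le_of_eq ?_)
      rw [← hexp]; ring
    · obtain ⟨h1, h2⟩ := hball w hw
      have hw0 : 0 < w.im := by linarith
      exact (hu ⟨w, hw0⟩).of_le (WithTop.coe_le_coe.2 le_top)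
    · obtain ⟨h1, h2⟩ := hball w hw
      refine (hdec w h1 (by linarith) (by linarith)).trans ?_
      refine mul_le_mul_of_nonneg_left (Real.exp_le_exp.2 ?_) hC'.le
      nlinarith
    · obtain ⟨h1, h2⟩ := hball w hw
      have hw0 : 0 < w.im := by linarith
      have hw1 : 1 ≤ w.im := by linarith
      have h3 := hL ⟨w, hw0⟩
      rw [maassLaplacian, ← lift_of_im_pos u hw0] at h3
      have h4 : ((w.im : ℂ) ^ 2) • lap (lift u) w =
          (Complex.I * k * w.im) • fderiv ℝ (lift u) w 1 - (s * (1 - s)) • lift u w := by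
        have h3' : -(((w.im : ℂ) ^ 2) • Laplacian.laplacian (lift u) w) +
          (Complex.I * k * w.im) • fderiv ℝ (lift u) w 1 = (s * (1 - s)) • lift u w := h3
        rw [lap_eq_laplacian, ← h3']
        abel
      have h5 := congrArg norm h4
      rw [norm_smul, norm_pow, Complex.norm_real, Real.norm_of_nonneg hw0.le] at h5
      have h6 := norm_sub_le ((Complex.I * k * w.im) • fderiv ℝ (lift u) w 1)
        ((s * (1 - s)) • lift u w)
      rw [← h5, norm_smul, norm_smul, norm_mul, norm_mul, Complex.norm_I, one_mul,
        Complex.norm_real, Complex.norm_real, Real.norm_of_nonneg hw0.le, Real.norm_eq_abs] at h6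
      have hz1 : 0 < z.im - 1 := by linarith
      have h7 : w.im * ‖lap (lift u) w‖ ≤ |k| * ‖fderiv ℝ (lift u) w 1‖ + l * ‖lift u w‖ := by
        have : w.im ^ 2 * ‖lap (lift u) w‖ ≤
            w.im * (|k| * ‖fderiv ℝ (lift u) w 1‖ + l * ‖lift u w‖) := by
          refine h6.trans ?_
          have : 0 ≤ l * ‖lift u w‖ := by positivity
          nlinarith
        have e : w.im ^ 2 * ‖lap (lift u) w‖ = w.im * (w.im * ‖lap (lift u) w‖) := by ring
        rw [e] at this
        exact le_of_mul_le_mul_left this hw0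
      rw [div_mul_eq_mul_div, div_mul_eq_mul_div, ← add_div, le_div_iff₀ hz1]
      refine le_trans ?_ h7
      rw [mul_comm]
      exact mul_le_mul_of_nonneg_right h2 (norm_nonneg _)

end MaassPeriod

end

/-! ### Growth of the Poisson kernel and decay of the Green form at `∞`. -/

noncomputable section

namespace MaassPeriod

open Filter Topology Complex

variable {V : Type*} [NormedAddCommGroup V] [InnerProductSpace ℂ V]

theorem norm_crossQuot_le (t : OnePoint ℝ) (p : ℂ) {q : ℂ} (hq : 0 < q.im) :
    ‖crossQuot t p q‖ ≤ 1 + ‖p - q‖ / q.im := by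
  cases t with
  | infty => simp only [crossQuot_infty, norm_one, le_add_iff_nonneg_right]; positivity
  | coe x =>
    have h := ofReal_sub_ne_zero x hq.ne'
    have h1 : q.im ≤ ‖(x : ℂ) - q‖ := by
      have := Complex.abs_im_le_norm ((x : ℂ) - q)
      simpa [abs_of_pos hq] using this
    have e : crossQuot (x : OnePoint ℝ) p q = 1 - (p - q) / ((x : ℂ) - q) := by
      rw [crossQuot_coe]; field_simp; ring
    rw [e]
    refine (norm_sub_le _ _).trans ?_
    rw [norm_one, norm_div]
    gcongr

theorem norm_poissonKernel (s : ℂ) (k : ℝ) (t : OnePoint ℝ) (z : ℍ) :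
    ‖poissonKernel s k t z‖ =
      Real.exp (s.re * Real.log (z.im * normSq (crossQuot t Complex.I z))) := by
  rw [poissonKernel_eq_exp, Complex.norm_exp]
  congr 1
  simp

/-- Polynomial growth in `y`, uniform in `t`. The quotient `(t-i)/(t-z)` is bounded above directly
and below through its inverse; both bounds are needed because `s.re` can have either sign. -/
theorem norm_poissonKernel_le (s : ℂ) (k : ℝ) (t : OnePoint ℝ) {z : ℍ} {B : ℝ}
    (hB : |z.re| ≤ B) (hy : 1 ≤ z.im) :
    ‖poissonKernel s k t z‖ ≤ Real.exp (|s.re| * Real.log ((2 + B) ^ 2 * z.im)) := by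
  have hB0 : 0 ≤ B := (abs_nonneg _).trans hB
  have hy0 : 0 < z.im := z.im_pos
  have hzI : ‖(z : ℂ) - Complex.I‖ ≤ B + z.im := by
    refine (Complex.norm_le_abs_re_add_abs_im _).trans ?_
    have h1 : ((z : ℂ) - Complex.I).re = z.re := by simp
    have h2 : ((z : ℂ) - Complex.I).im = z.im - 1 := by simp
    rw [h1, h2, abs_of_nonneg (a := z.im - 1) (by linarith)]
    linarith
  have h1 : ‖crossQuot t Complex.I z‖ ≤ 2 + B := by
    refine (norm_crossQuot_le t _ z.im_pos).trans ?_
    rw [norm_sub_rev]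
    have : ‖(z : ℂ) - Complex.I‖ / z.im ≤ 1 + B := by
      rw [div_le_iff₀ hy0]; nlinarith
    simp only [UpperHalfPlane.coe_im]
    linarith
  have h2 : ‖crossQuot t z Complex.I‖ ≤ (2 + B) * z.im := by
    refine (norm_crossQuot_le t _ (by simp)).trans ?_
    simp only [Complex.I_im, div_one]
    nlinarith
  have h3 : ‖crossQuot t Complex.I z‖ * ‖crossQuot t z Complex.I‖ = 1 := by
    rw [← norm_mul, crossQuot_mul t _ z.im_pos.ne', crossQuot_self t (by simp), norm_one]
  set q := ‖crossQuot t Complex.I z‖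
  have hq0 : 0 < q := norm_pos_iff.2 (crossQuot_ne_zero t (by simp) z.im_pos.ne')
  rw [norm_poissonKernel, normSq_eq_norm_sq]
  refine Real.exp_le_exp.2 ((le_abs_self _).trans ?_)
  rw [abs_mul]
  refine mul_le_mul_of_nonneg_left (abs_le.2 ⟨?_, ?_⟩) (abs_nonneg _)
  · rw [← Real.log_inv]
    refine Real.log_le_log (by positivity) ?_
    rw [inv_le_iff_one_le_mul₀ (by positivity)]
    have h4 : 1 ≤ q * ((2 + B) * z.im) := by
      rw [← h3]; exact mul_le_mul_of_nonneg_left h2 hq0.le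
    calc (1 : ℝ) ≤ (q * ((2 + B) * z.im)) ^ 2 := one_le_pow₀ h4
      _ = _ := by ring
  · refine Real.log_le_log (by positivity) ?_
    rw [mul_comm]
    exact mul_le_mul_of_nonneg_right (pow_le_pow_left₀ hq0.le h1 2) hy0.le

theorem norm_poissonLogZbar (s : ℂ) (k : ℝ) (t : OnePoint ℝ) (z : ℍ) :
    ‖poissonLogZbar s k t z‖ = ‖s + (k : ℂ) / 2‖ / (2 * z.im) := by
  have h : ‖crossQuot t z (starRingEnd ℂ (z : ℂ))‖ = 1 := by
    cases t with
    | infty => simp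
    | coe x =>
      have e : (x : ℂ) - starRingEnd ℂ (z : ℂ) = starRingEnd ℂ ((x : ℂ) - z) := by simp
      rw [crossQuot_coe, e, norm_div, Complex.norm_conj]
      exact div_self (norm_ne_zero_iff.2 (ofReal_sub_ne_zero x z.im_pos.ne'))
  rw [poissonLogZbar_eq, norm_mul, h, mul_one, norm_neg, norm_div]
  simp [abs_of_pos z.im_pos]

theorem exists_exp_log_le {σ D a : ℝ} (hσ : 0 ≤ σ) (hD : 0 < D) (ha : 0 < a) :
    ∃ C : ℝ, 0 < C ∧ ∀ y : ℝ, 0 < y → Real.exp (σ * Real.log (D * y)) ≤ C * Real.exp (a * y) := by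
  -- The bound is `log x ≤ x - 1` at `x = ε D y`. This `ε` gives `σ ε D = a σ/(σ + 1) ≤ a`, and `σ +
  -- 1` allows `σ = 0`.
  set ε := a / (D * (σ + 1))
  have hε : 0 < ε := by positivity
  refine ⟨Real.exp (-(σ * Real.log ε)), Real.exp_pos _, fun y hy => ?_⟩
  rw [← Real.exp_add]
  refine Real.exp_le_exp.2 ?_
  have h1 := Real.log_le_sub_one_of_pos (x := ε * (D * y)) (by positivity)
  rw [Real.log_mul hε.ne' (by positivity)] at h1
  have h2 : σ * Real.log (D * y) ≤ σ * (ε * (D * y) - Real.log ε) :=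
    mul_le_mul_of_nonneg_left (by linarith) hσ
  have h3 : σ * (ε * (D * y)) = a * y * (σ / (σ + 1)) := by
    simp only [ε]; field_simp
  have h4 : σ / (σ + 1) ≤ 1 := (div_le_one (by linarith)).2 (by linarith)
  have h5 : a * y * (σ / (σ + 1)) ≤ a * y := mul_le_of_le_one_right (by positivity) h4
  linarith

theorem norm_wirt_apply_le (α β : V) (w : ℂ) : ‖wirt α β w‖ ≤ (‖α‖ + ‖β‖) * ‖w‖ := by
  rw [wirt_apply]
  refine (norm_add_le _ _).trans (le_of_eq ?_)
  rw [norm_smul, norm_smul, Complex.norm_conj]; ring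

variable {ρ : SL(2, ℤ) →* (V ≃ₗᵢ[ℂ] V)} {k : ℝ} {s : ℂ} {u : ℍ → V}

theorem exists_decay_covD (hu : u ∈ cuspForms ρ k s) (B : ℝ) :
    ∃ a C Y : ℝ, 0 < a ∧ 0 < C ∧ 1 ≤ Y ∧ ∀ z : ℍ, |z.re| ≤ B → Y ≤ z.im →
      ‖u z‖ ≤ C * Real.exp (-a * z.im) ∧ ‖covD k u z‖ ≤ C * Real.exp (-a * z.im) := by
  obtain ⟨a, C, Y, ha, hC, hY, h⟩ := exists_decay_fderiv hu.1 hu.2.2.1 hu.2.2.2 B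
  refine ⟨a, C * (1 + |k|), Y, ha, by positivity, hY, fun z hB hz => ?_⟩
  have hk := abs_nonneg k
  obtain ⟨h1, h2⟩ := h z (by simpa using hB) (by simpa using hz)
  rw [lift_coe] at h1
  simp only [UpperHalfPlane.coe_im] at h1 h2
  set e := Real.exp (-a * z.im)
  have he : 0 < e := Real.exp_pos _
  have hCe : 0 < C * e := by positivity
  refine ⟨h1.trans ?_, ?_⟩
  · nlinarith
  · have h3 : ‖dZ (lift u) z‖ ≤ C * e := by
      rw [dZ, norm_smul]
      have : ‖(1 / 2 : ℂ)‖ = 1 / 2 := by norm_num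
      rw [this]
      have h4 := norm_sub_le (dX (lift u) (z : ℂ)) (Complex.I • dY (lift u) (z : ℂ))
      rw [norm_smul, Complex.norm_I, one_mul] at h4
      have h5 := h4.trans h2
      linarith
    have h6 : ‖((k : ℂ) / (4 * Complex.I * ((z : ℂ).im : ℂ)))‖ ≤ |k| := by
      simp only [UpperHalfPlane.coe_im]
      rw [norm_div, norm_mul, norm_mul, Complex.norm_I, Complex.norm_real, Complex.norm_real,
        Real.norm_of_nonneg z.im_pos.le, Real.norm_eq_abs]
      refine div_le_self hk ?_
      have : ‖(4 : ℂ)‖ = 4 := by norm_num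
      rw [this]; linarith
    rw [covD, lift_coe]
    refine (norm_add_le _ _).trans ?_
    rw [norm_smul]
    have : ‖((k : ℂ) / (4 * Complex.I * ((z : ℂ).im : ℂ)))‖ * ‖u z‖ ≤ |k| * (C * e) :=
      mul_le_mul h6 h1 (norm_nonneg _) hk
    linarith

/-- Uniform exponential decay of the Green form at the cusp `∞`. -/
theorem exists_decay_greenCLM (hu : u ∈ cuspForms ρ k s) (B : ℝ) :
    ∃ a C Y : ℝ, 0 < a ∧ 0 < C ∧ 1 ≤ Y ∧ ∀ (t : OnePoint ℝ) (z w : ℂ), |z.re| ≤ B → Y ≤ z.im →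
      ‖greenCLM s k u t z w‖ ≤ C * Real.exp (-a * z.im) * ‖w‖ := by
  obtain ⟨a, C, Y, ha, hC, hY, h⟩ := exists_decay_covD hu |B|
  have hB0 := abs_nonneg B
  obtain ⟨D, hD, hlog⟩ := exists_exp_log_le (abs_nonneg s.re) (D := (2 + |B|) ^ 2)
    (by positivity) (half_pos ha)
  refine ⟨a / 2, D * (C * (1 + ‖s + (k : ℂ) / 2‖)), Y, half_pos ha, by positivity, hY,
    fun t z w hB hz => ?_⟩
  have hz1 : 1 ≤ z.im := hY.trans hz
  have hz0 : 0 < z.im := by linarith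
  lift z to ℍ using hz0
  simp only [UpperHalfPlane.coe_im, UpperHalfPlane.coe_re] at hB hz hz1 ⊢
  obtain ⟨h1, h2⟩ := h z (hB.trans (le_abs_self _)) hz
  have h3 := (norm_poissonKernel_le s k t (hB.trans (le_abs_self _)) hz1).trans
    (hlog z.im z.im_pos)
  refine (norm_wirt_apply_le _ _ _).trans (mul_le_mul_of_nonneg_right ?_ (norm_nonneg _))
  rw [lift_coe, lift_coe, norm_smul, norm_smul, norm_mul, norm_poissonLogZbar]
  have h4 : ‖s + (k : ℂ) / 2‖ / (2 * z.im) ≤ ‖s + (k : ℂ) / 2‖ :=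
    div_le_self (norm_nonneg _) (by linarith)
  have e1 : Real.exp (-a * z.im) * Real.exp (a / 2 * z.im) = Real.exp (-(a / 2) * z.im) := by
    rw [← Real.exp_add]; congr 1; ring
  calc ‖poissonKernel s k t z‖ * ‖covD k u z‖ +
        ‖poissonKernel s k t z‖ * (‖s + (k : ℂ) / 2‖ / (2 * z.im)) * ‖u z‖
      = ‖poissonKernel s k t z‖ * (‖covD k u z‖ + ‖s + (k : ℂ) / 2‖ / (2 * z.im) * ‖u z‖) := by
        ring
    _ ≤ (D * Real.exp (a / 2 * z.im)) * (C * Real.exp (-a * z.im) +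
        ‖s + (k : ℂ) / 2‖ * (C * Real.exp (-a * z.im))) := by gcongr
    _ = D * (C * (1 + ‖s + (k : ℂ) / 2‖)) *
        (Real.exp (-a * z.im) * Real.exp (a / 2 * z.im)) := by ring
    _ = _ := by rw [e1]

theorem continuousAt_covD (hu : IsSmooth u) {z : ℂ} (hz : 0 < z.im) :
    ContinuousAt (covD k u) z := by
  have h : ContDiffAt ℝ ∞ (lift u) z := hu ⟨z, hz⟩
  have h1 : ContinuousAt (fderiv ℝ (lift u)) z :=
    (h.fderiv_right (m := 0) (WithTop.coe_le_coe.2 le_top)).continuousAt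
  have h2 : ∀ v : ℂ, ContinuousAt (fun z => fderiv ℝ (lift u) z v) z := fun v =>
    h1.clm_apply continuousAt_const
  have hy : 4 * Complex.I * (z.im : ℂ) ≠ 0 := by
    have : (z.im : ℂ) ≠ 0 := by exact_mod_cast hz.ne'
    simp [this]
  unfold covD dZ dX dY
  refine ContinuousAt.add (((h2 1).sub ((h2 Complex.I).const_smul _)).const_smul _) ?_
  refine ContinuousAt.smul (continuousAt_const.div ?_ hy) h.continuousAt
  fun_prop

theorem continuousAt_greenCLM_apply (hu : IsSmooth u) (t : OnePoint ℝ) {z : ℂ} (hz : 0 < z.im)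
    (w : ℂ) : ContinuousAt (fun z => greenCLM s k u t z w) z := by
  have h : ContDiffAt ℝ ∞ (lift u) z := hu ⟨z, hz⟩
  have hR := (hasFDerivAt_poissonKernel s k t hz).continuousAt
  obtain ⟨b, hb⟩ := hasFDerivAt_poissonLogZbar s k t hz
  simp only [greenCLM, wirt_apply]
  exact ((hR.smul (continuousAt_covD hu hz)).const_smul w).add
    (((hR.mul hb.continuousAt).smul h.continuousAt).const_smul _)

end MaassPeriod

end

noncomputable section

namespace MaassPeriod

open Filter Topology Complex

variable {V : Type*} [NormedAddCommGroup V] [InnerProductSpace ℂ V]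

/-! ### Paths between cusps -/

/-- Reversal of a geodesic is `τ ↦ τ⁻¹` in the chosen parametrization, so each end can be studied as
the end at `τ = ∞`. -/
theorem cuspPath_symm {ξ₁ ξ₂ : OnePoint ℚ} (h : ξ₁ ≠ ξ₂) {τ : ℝ} (hτ : 0 < τ) :
    cuspPath ξ₁ ξ₂ τ = cuspPath ξ₂ ξ₁ τ⁻¹ := by
  have hτ' : (τ : ℂ) ≠ 0 := by exact_mod_cast hτ.ne'
  cases ξ₁ with
  | infty => cases ξ₂ with
    | infty => exact absurd rfl h
    | coe b => rfl
  | coe a => cases ξ₂ with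
    | infty =>
      change (a : ℂ) + Complex.I * (τ : ℂ) = (a : ℂ) + Complex.I * ((τ⁻¹⁻¹ : ℝ) : ℂ)
      rw [inv_inv]
    | coe b =>
      have hab : a ≠ b := fun e => h (by rw [e])
      change ((a : ℂ) + Complex.I * ((SignType.sign (b - a) : ℤ) : ℂ) * (τ : ℂ) * (b : ℂ)) /
        (1 + Complex.I * ((SignType.sign (b - a) : ℤ) : ℂ) * (τ : ℂ)) =
        ((b : ℂ) + Complex.I * ((SignType.sign (a - b) : ℤ) : ℂ) * ((τ⁻¹ : ℝ) : ℂ) * (a : ℂ)) /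
        (1 + Complex.I * ((SignType.sign (a - b) : ℤ) : ℂ) * ((τ⁻¹ : ℝ) : ℂ))
      have hne : ∀ r : ℝ, (1 : ℂ) + Complex.I * r ≠ 0 := fun r e => by
        have := congrArg Complex.re e; simp at this
      rcases lt_or_gt_of_ne hab with h1 | h1
      · rw [sign_pos (sub_pos.2 h1), sign_neg (sub_neg.2 h1)]
        have e1 := hne τ
        have e2 := hne (-τ⁻¹)
        push_cast at e2 ⊢
        simp only [SignType.coe_one, mul_one]
        rw [div_eq_div_iff e1 (by convert e2 using 1; ring)]
        field_simp
        ring_nf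
        simp only [Complex.I_sq]
        ring
      · rw [sign_neg (sub_neg.2 h1), sign_pos (sub_pos.2 h1)]
        have e1 := hne (-τ)
        have e2 := hne τ⁻¹
        push_cast at e1 e2 ⊢
        simp only [SignType.coe_one, mul_one]
        rw [div_eq_div_iff (by convert e1 using 1; ring) e2]
        field_simp
        ring_nf
        simp only [Complex.I_sq]
        ring

theorem mapGL_rat_smul_infty (g : SL(2, ℤ)) :
    Matrix.SpecialLinearGroup.mapGL ℚ g • (OnePoint.infty : OnePoint ℚ) =
      if (g 1 0 : ℚ) = 0 then OnePoint.infty else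
        (((g 0 0 : ℚ) / (g 1 0 : ℚ) : ℚ) : OnePoint ℚ) := by
  rw [OnePoint.smul_infty_eq_ite]; simp

/-- A geodesic ending at the cusp `g ∞` is the image under `g` of a vertical half-line, with height
proportional to `τ`. Convergence at any cusp thereby becomes convergence at `i∞`. -/
theorem exists_cuspPath_eq {ξ₁ ξ₂ : OnePoint ℚ} (h : ξ₁ ≠ ξ₂) {g : SL(2, ℤ)}
    (hg : Matrix.SpecialLinearGroup.mapGL ℚ g • OnePoint.infty = ξ₂) :
    ∃ x r : ℝ, 0 < r ∧ ∀ τ : ℝ, 0 < τ →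
      cuspPath ξ₁ ξ₂ τ = moeb g ((x : ℂ) + Complex.I * ((r * τ : ℝ) : ℂ)) := by
  have hdet := det_eq_one g
  have hdet' : g 0 0 * g 1 1 - g 0 1 * g 1 0 = 1 := by exact_mod_cast hdet
  rw [mapGL_rat_smul_infty] at hg
  by_cases hc : g 1 0 = 0
  · rw [if_pos (by simpa using hc)] at hg
    subst hg
    cases ξ₁ with
    | infty => exact absurd rfl h
    | coe p =>
      rw [hc] at hdet'
      have had : g 0 0 = g 1 1 := by
        rcases Int.mul_eq_one_iff_eq_one_or_neg_one.1 (by linarith : g 0 0 * g 1 1 = 1) with h | h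
        · rw [h.1, h.2]
        · rw [h.1, h.2]
      have hd2 : (g 1 1 : ℂ) * g 1 1 = 1 := by
        have : g 1 1 * g 1 1 = 1 := by rw [had] at hdet'; linarith
        exact_mod_cast this
      have hd0 : (g 1 1 : ℂ) ≠ 0 := left_ne_zero_of_mul_eq_one hd2
      refine ⟨p - g 0 1 * g 1 1, 1, one_pos, fun τ hτ => ?_⟩
      change (p : ℂ) + Complex.I * (τ : ℂ) = _
      rw [moeb, hc, had, eq_div_iff (by simpa using hd0)]
      push_cast
      linear_combination (g 0 1 : ℂ) * hd2
  · rw [if_neg (by simpa using hc)] at hg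
    subst hg
    have hc' : (g 1 0 : ℂ) ≠ 0 := by exact_mod_cast hc
    -- The transformation in a coordinate centred at its pole `-d/c`.
    have key : ∀ v : ℂ, v ≠ 0 → moeb g (-(g 1 1 : ℂ) / g 1 0 + v) =
        (g 0 0 : ℂ) / g 1 0 - 1 / ((g 1 0 : ℂ) ^ 2 * v) := by
      intro v hv
      rw [moeb]
      have e : (g 1 0 : ℂ) * (-(g 1 1 : ℂ) / g 1 0 + v) + g 1 1 = g 1 0 * v := by
        field_simp; ring
      rw [e]
      field_simp
      linear_combination (-1 : ℂ) * hdet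
    cases ξ₁ with
    | infty =>
      refine ⟨-(g 1 1 : ℝ) / g 1 0, 1 / (g 1 0 : ℝ) ^ 2, by positivity, fun τ hτ => ?_⟩
      have hτ' : (τ : ℂ) ≠ 0 := by exact_mod_cast hτ.ne'
      have := key (Complex.I * ((1 / (g 1 0 : ℂ) ^ 2) * τ)) (by simp [hτ', hc'])
      push_cast
      rw [this]
      change (((g 0 0 : ℚ) / g 1 0 : ℚ) : ℂ) + Complex.I * ((τ⁻¹ : ℝ) : ℂ) = _
      push_cast
      field_simp
      ring_nf
      simp only [Complex.I_sq]
      ring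
    | coe p =>
      set q : ℚ := (g 0 0 : ℚ) / g 1 0 with hq
      have hpq : p ≠ q := fun e => h (by rw [e])
      have hqC : (g 0 0 : ℂ) / g 1 0 = (q : ℂ) := by rw [hq]; push_cast; rfl
      have hpqC : (q : ℂ) - p ≠ 0 := by
        rw [sub_ne_zero]; exact_mod_cast hpq.symm
      have hpqR : (q : ℝ) - p ≠ 0 := by
        rw [sub_ne_zero]; exact_mod_cast hpq.symm
      -- The sign in `cuspPath` is what makes the slope `r` positive, that is, what keeps the path
      -- in the upper half-plane.
      obtain ⟨ε, hε, hε1, hε2⟩ : ∃ ε : ℤ, (SignType.sign (q - p) : ℤ) = ε ∧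
          0 < (ε : ℝ) / ((q : ℝ) - p) ∧ ε ^ 2 = 1 := by
        rcases lt_or_gt_of_ne hpq with h1 | h1
        · refine ⟨1, by rw [sign_pos (sub_pos.2 h1)]; rfl, ?_, by norm_num⟩
          have : (p : ℝ) < q := by exact_mod_cast h1
          have : (0 : ℝ) < q - p := sub_pos.2 this
          push_cast; positivity
        · refine ⟨-1, by rw [sign_neg (sub_neg.2 h1)]; rfl, ?_, by norm_num⟩
          have : (q : ℝ) < p := by exact_mod_cast h1
          have : (q : ℝ) - p < 0 := sub_neg.2 this
          push_cast; exact div_pos_of_neg_of_neg (by norm_num) this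
      refine ⟨-(g 1 1 : ℝ) / g 1 0 + 1 / ((g 1 0 : ℝ) ^ 2 * (q - p)),
        ε / (q - p) / (g 1 0 : ℝ) ^ 2, by positivity, fun τ hτ => ?_⟩
      have hne : (1 : ℂ) + Complex.I * ε * τ ≠ 0 := fun e => by
        have := congrArg Complex.re e; simp at this
      have := key ((1 + Complex.I * ε * τ) / ((g 1 0 : ℂ) ^ 2 * (q - p))) (by
        refine div_ne_zero hne (mul_ne_zero (pow_ne_zero _ hc') hpqC))
      have e : (((-(g 1 1 : ℝ) / g 1 0 + 1 / ((g 1 0 : ℝ) ^ 2 * (q - p)) : ℝ)) : ℂ) +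
          Complex.I * ((ε / (q - p) / (g 1 0 : ℝ) ^ 2 * τ : ℝ) : ℂ) =
          -(g 1 1 : ℂ) / g 1 0 + (1 + Complex.I * ε * τ) / ((g 1 0 : ℂ) ^ 2 * (q - p)) := by
        push_cast; field_simp; ring
      rw [e, this, hqC]
      change ((p : ℂ) + Complex.I * ((SignType.sign (q - p) : ℤ) : ℂ) * (τ : ℂ) * (q : ℂ)) /
        (1 + Complex.I * ((SignType.sign (q - p) : ℤ) : ℂ) * (τ : ℂ)) = _
      rw [hε]
      field_simp
      ring

/-! ### Primitives near cusps -/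

section Primitive

variable {Ψ : ℂ → V} {A : ℂ → ℂ →L[ℝ] V}

/-- The vertical limit at `i∞` of a primitive of an exponentially decaying form. -/
theorem exists_tendsto_vertical [CompleteSpace V]
    (hΨ : ∀ z : ℂ, 0 < z.im → HasFDerivAt Ψ (A z) z)
    (hA : ∀ B : ℝ, ∃ a C Y : ℝ, 0 < a ∧ 0 < C ∧ 1 ≤ Y ∧ ∀ z w : ℂ, |z.re| ≤ B → Y ≤ z.im →
      ‖A z w‖ ≤ C * Real.exp (-a * z.im) * ‖w‖)
    (hc : ∀ z w : ℂ, 0 < z.im → ContinuousAt (fun z => A z w) z) :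
    ∃ L : V, ∀ x r : ℝ, 0 < r →
      Tendsto (fun y : ℝ => Ψ ((x : ℂ) + Complex.I * ((r * y : ℝ) : ℂ))) atTop (𝓝 L) := by
  have hpath : ∀ x y : ℝ, HasDerivAt (fun y : ℝ => (x : ℂ) + Complex.I * (y : ℂ)) Complex.I y :=
    fun x y => by
      simpa using ((Complex.ofRealCLM.hasDerivAt (x := y)).const_mul Complex.I).const_add (x : ℂ)
  have him : ∀ x y : ℝ, ((x : ℂ) + Complex.I * (y : ℂ)).im = y := fun x y => by simp
  have hre : ∀ x y : ℝ, ((x : ℂ) + Complex.I * (y : ℂ)).re = x := fun x y => by simp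
  have hder : ∀ y : ℝ, 0 < y → HasDerivAt (fun y : ℝ => Ψ ((0 : ℝ) + Complex.I * (y : ℂ)))
      (A ((0 : ℝ) + Complex.I * (y : ℂ)) Complex.I) y := fun y hy =>
    (hΨ _ (by rw [him]; exact hy)).comp_hasDerivAt y (hpath 0 y)
  have hlim : ∃ L : V, Tendsto (fun y : ℝ => Ψ ((0 : ℝ) + Complex.I * (y : ℂ))) atTop (𝓝 L) := by
    obtain ⟨a, C, Y, ha, hC, hY, h⟩ := hA 0
    have hcont : ContinuousOn (fun y : ℝ => A ((0 : ℝ) + Complex.I * (y : ℂ)) Complex.I)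
        (Set.Ici Y) := fun y hy => by
      have hy0 : 0 < y := lt_of_lt_of_le one_pos (hY.trans hy)
      have := (hc ((0 : ℝ) + Complex.I * (y : ℂ)) Complex.I (by rw [him]; exact hy0)).comp
        (f := fun y : ℝ => ((0 : ℝ) : ℂ) + Complex.I * (y : ℂ)) (x := y)
        (hpath 0 y).continuousAt
      exact this.continuousWithinAt
    have hint : MeasureTheory.IntegrableOn
        (fun y : ℝ => A ((0 : ℝ) + Complex.I * (y : ℂ)) Complex.I) (Set.Ioi Y) := by
      refine (MeasureTheory.integrable_norm_iff ((hcont.mono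
        Set.Ioi_subset_Ici_self).aestronglyMeasurable measurableSet_Ioi)).1 ?_
      refine integrable_of_isBigO_exp_neg ha hcont.norm ?_
      refine Asymptotics.IsBigO.of_bound C ?_
      filter_upwards [eventually_ge_atTop Y] with y hy
      have := h ((0 : ℝ) + Complex.I * (y : ℂ)) Complex.I (by rw [hre]; simp) (by rw [him]; exact hy)
      rw [him, Complex.norm_I, mul_one] at this
      simpa using this
    exact ⟨_, MeasureTheory.tendsto_limUnder_of_hasDerivAt_of_integrableOn_Ioi
      (fun y hy => hder y (lt_trans (lt_of_lt_of_le one_pos hY) hy)) hint⟩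
  obtain ⟨L, hL⟩ := hlim
  refine ⟨L, fun x r hr => ?_⟩
  have hL' : Tendsto (fun y : ℝ => Ψ ((x : ℂ) + Complex.I * (y : ℂ))) atTop (𝓝 L) := by
    obtain ⟨a, C, Y, ha, hC, hY, h⟩ := hA |x|
    have hz : Tendsto (fun y : ℝ => C * Real.exp (-a * y) * |x|) atTop (𝓝 0) := by
      have h1 : Tendsto (fun y : ℝ => Real.exp (-a * y)) atTop (𝓝 0) := by
        refine Real.tendsto_exp_atBot.comp ?_
        exact tendsto_id.const_mul_atTop_of_neg (by linarith)
      simpa using (h1.const_mul C).mul_const |x|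
    -- Two vertical lines are joined by horizontal segments of fixed length on which the form is
    -- exponentially small, so the limit does not depend on `x`.
    have hdiff : Tendsto (fun y : ℝ => Ψ ((x : ℂ) + Complex.I * (y : ℂ)) -
        Ψ ((0 : ℝ) + Complex.I * (y : ℂ))) atTop (𝓝 0) := by
      refine squeeze_zero_norm' ?_ hz
      filter_upwards [eventually_ge_atTop Y] with y hy
      have hy0 : 0 < y := lt_of_lt_of_le one_pos (hY.trans hy)
      have hp : ∀ v : ℝ, HasDerivAt (fun v : ℝ => Ψ ((v : ℂ) + Complex.I * (y : ℂ)))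
          (A ((v : ℂ) + Complex.I * (y : ℂ)) 1) v := fun v =>
        (hΨ _ (by rw [him]; exact hy0)).comp_hasDerivAt v
          ((Complex.ofRealCLM.hasDerivAt (x := v)).add_const (Complex.I * (y : ℂ)))
      have key := (convex_Icc (-|x|) |x|).norm_image_sub_le_of_norm_hasDerivWithin_le
        (f := fun v : ℝ => Ψ ((v : ℂ) + Complex.I * (y : ℂ)))
        (C := C * Real.exp (-a * y)) (fun v _ => (hp v).hasDerivWithinAt)
        (fun v hv => by
          have := h ((v : ℂ) + Complex.I * (y : ℂ)) 1 (by rw [hre]; exact abs_le.2 hv)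
            (by rw [him]; exact hy)
          rw [him, norm_one, mul_one] at this
          exact this)
        (x := 0) (y := x) ⟨by simp, abs_nonneg x⟩ (abs_le.1 le_rfl)
      simpa using key
    simpa using hdiff.add hL
  exact hL'.comp (tendsto_id.const_mul_atTop hr)

end Primitive

variable {ρ : SL(2, ℤ) →* (V ≃ₗᵢ[ℂ] V)} {k : ℝ} {s : ℂ} {u : ℍ → V}

theorem bdFactor_ne_zero (s : ℂ) (k : ℝ) (γ : SL(2, ℤ)) (t : OnePoint ℝ) :
    bdFactor s k γ t ≠ 0 := by
  rw [bdFactor, intFactor_eq_exp]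
  exact mul_ne_zero (inv_ne_zero (mult_ne_zero k γ)) (Complex.exp_ne_zero _)

/-- `Φ` is a primitive of the Green form for the boundary point `t`. -/
def IsGreenPrimitive (s : ℂ) (k : ℝ) (u : ℍ → V) (t : OnePoint ℝ) (Φ : ℂ → V) : Prop :=
  ∀ z : ℂ, 0 < z.im → HasFDerivAt Φ (greenCLM s k u t z) z

/-- The pull-back of the Green form under `g`. -/
def greenPull (ρ : SL(2, ℤ) →* (V ≃ₗᵢ[ℂ] V)) (s : ℂ) (k : ℝ) (u : ℍ → V) (t : OnePoint ℝ)
    (g : SL(2, ℤ)) (z : ℂ) : ℂ →L[ℝ] V :=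
  (bdFactor s k g (bdAct g⁻¹ t))⁻¹ • (((ρ g).toContinuousLinearEquiv :
    V →L[ℂ] V).restrictScalars ℝ).comp (greenCLM s k u (bdAct g⁻¹ t) z)

theorem greenPull_apply (t : OnePoint ℝ) (g : SL(2, ℤ)) (z w : ℂ) :
    greenPull ρ s k u t g z w =
      (bdFactor s k g (bdAct g⁻¹ t))⁻¹ • ρ g (greenCLM s k u (bdAct g⁻¹ t) z w) := rfl

/-- Near the cusp `g ∞` the Green form is, up to a scalar and a unitary map, the Green form near `∞`
for the boundary point `g⁻¹ t`. Estimates at `∞` therefore suffice. -/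
theorem greenCLM_moeb (hu : u ∈ cuspForms ρ k s) (t : OnePoint ℝ) (g : SL(2, ℤ)) (z : ℍ) (w : ℂ) :
    greenCLM s k u t (moeb g z) (1 / autFactor g z ^ 2 * w) = greenPull ρ s k u t g z w := by
  have h := greenCLM_smul (s := s) hu.1 (hu.2.1 g) (bdAct g⁻¹ t) z w
  rw [greenPull_apply, h, ← bdAct_mul, mul_inv_cancel, bdAct_one, map_smul, smul_smul,
    inv_mul_cancel₀ (bdFactor_ne_zero _ _ _ _), one_smul, moeb_coe]
  have e : ∀ v : V, ρ g (ρ g⁻¹ v) = v := fun v => by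
    rw [map_inv]; exact (ρ g).apply_symm_apply v
  rw [e]
  congr 1
  ring

theorem IsGreenPrimitive.comp_moeb (hu : u ∈ cuspForms ρ k s) {t : OnePoint ℝ} {Φ : ℂ → V}
    (hΦ : IsGreenPrimitive s k u t Φ) (g : SL(2, ℤ)) {z : ℂ} (hz : 0 < z.im) :
    HasFDerivAt (fun z => Φ (moeb g z)) (greenPull ρ s k u t g z) z := by
  lift z to ℍ using hz
  have h1 := hΦ (moeb g z) (by rw [moeb_coe]; exact (g • z).im_pos)
  have h2 := (hasDerivAt_moeb g z).hasFDerivAt.restrictScalars ℝ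
  refine (h1.comp (z : ℂ) h2).congr_fderiv ?_
  ext w
  rw [← greenCLM_moeb hu]
  simp [mul_comm]

/-- Transport of primitives under the group. -/
theorem IsGreenPrimitive.smul (hu : u ∈ cuspForms ρ k s) {t : OnePoint ℝ} {Φ : ℂ → V}
    {γ : SL(2, ℤ)} (hΦ : IsGreenPrimitive s k u (bdAct γ t) Φ) :
    IsGreenPrimitive s k u t (fun z => bdFactor s k γ t • ρ γ⁻¹ (Φ (moeb γ z))) := by
  intro z hz
  have h1 := hΦ.comp_moeb hu γ hz
  have h2 := ((((ρ γ⁻¹).toContinuousLinearEquiv : V →L[ℂ] V).restrictScalars ℝ).hasFDerivAt.comp z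
    h1).const_smul (bdFactor s k γ t)
  refine h2.congr_fderiv ?_
  ext w
  have e : ∀ v : V, ρ γ⁻¹ (ρ γ v) = v := fun v => by
    rw [map_inv]; exact (ρ γ).symm_apply_apply v
  have e2 : bdAct γ⁻¹ (bdAct γ t) = t := by rw [← bdAct_mul, inv_mul_cancel, bdAct_one]
  change bdFactor s k γ t • ρ γ⁻¹ (greenPull ρ s k u (bdAct γ t) γ z w) = _
  rw [greenPull_apply, e2, map_smul, e, smul_smul, mul_inv_cancel₀ (bdFactor_ne_zero _ _ _ _),
    one_smul]

theorem greenPull_decay (hu : u ∈ cuspForms ρ k s) (t : OnePoint ℝ) (g : SL(2, ℤ)) (B : ℝ) :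
    ∃ a C Y : ℝ, 0 < a ∧ 0 < C ∧ 1 ≤ Y ∧ ∀ z w : ℂ, |z.re| ≤ B → Y ≤ z.im →
      ‖greenPull ρ s k u t g z w‖ ≤ C * Real.exp (-a * z.im) * ‖w‖ := by
  obtain ⟨a, C, Y, ha, hC, hY, h⟩ := exists_decay_greenCLM hu B
  have hn : 0 < ‖(bdFactor s k g (bdAct g⁻¹ t))⁻¹‖ :=
    norm_pos_iff.2 (inv_ne_zero (bdFactor_ne_zero _ _ _ _))
  refine ⟨a, ‖(bdFactor s k g (bdAct g⁻¹ t))⁻¹‖ * C, Y, ha, by positivity, hY,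
    fun z w h1 h2 => ?_⟩
  rw [greenPull_apply, norm_smul, LinearIsometryEquiv.norm_map, mul_assoc, mul_assoc, ← mul_assoc C]
  exact mul_le_mul_of_nonneg_left (h _ z w h1 h2) hn.le

theorem continuousAt_greenPull_apply (hu : u ∈ cuspForms ρ k s) (t : OnePoint ℝ) (g : SL(2, ℤ))
    (z w : ℂ) (hz : 0 < z.im) : ContinuousAt (fun z => greenPull ρ s k u t g z w) z := by
  simp only [greenPull_apply]
  exact ((ρ g).continuous.continuousAt.comp (continuousAt_greenCLM_apply hu.1 _ hz w)).const_smul _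

theorem IsGreenPrimitive.exists_tendsto [CompleteSpace V] (hu : u ∈ cuspForms ρ k s)
    {t : OnePoint ℝ} {Φ : ℂ → V} (hΦ : IsGreenPrimitive s k u t Φ) (g : SL(2, ℤ)) :
    ∃ L : V, ∀ x r : ℝ, 0 < r → Tendsto
      (fun y : ℝ => Φ (moeb g ((x : ℂ) + Complex.I * ((r * y : ℝ) : ℂ)))) atTop (𝓝 L) :=
  exists_tendsto_vertical (Ψ := fun z => Φ (moeb g z)) (fun _ hz => hΦ.comp_moeb hu g hz)
    (greenPull_decay hu t g) (fun z w hz => continuousAt_greenPull_apply hu t g z w hz)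

end MaassPeriod

end

/-! ### Integrals between cusps: convergence, additivity, equivariance. -/

noncomputable section

namespace MaassPeriod

open Filter Topology Complex

variable {V : Type*} [NormedAddCommGroup V] [InnerProductSpace ℂ V]
variable {ρ : SL(2, ℤ) →* (V ≃ₗᵢ[ℂ] V)} {k : ℝ} {s : ℂ} {u : ℍ → V}

theorem im_add_I_mul (x y : ℝ) : ((x : ℂ) + Complex.I * (y : ℂ)).im = y := by simp

theorem re_add_I_mul (x y : ℝ) : ((x : ℂ) + Complex.I * (y : ℂ)).re = x := by simp

theorem hasDerivAt_of_cuspPath_eq {ξ₁ ξ₂ : OnePoint ℚ} {g : SL(2, ℤ)} {z : ℝ → ℂ} {z' : ℂ} {τ : ℝ}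
    (hz : HasDerivAt z z' τ) (hpos : 0 < (z τ).im)
    (hp : cuspPath ξ₁ ξ₂ =ᶠ[𝓝 τ] fun τ => moeb g (z τ)) :
    0 < (cuspPath ξ₁ ξ₂ τ).im ∧
    HasDerivAt (cuspPath ξ₁ ξ₂) (1 / autFactor g ⟨z τ, hpos⟩ ^ 2 * z') τ := by
  constructor
  · rw [hp.self_of_nhds]
    have : moeb g (z τ) = (g • (⟨z τ, hpos⟩ : ℍ) : ℍ) := moeb_coe g ⟨z τ, hpos⟩
    simp only [this]
    exact (g • (⟨z τ, hpos⟩ : ℍ)).im_pos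
  · refine HasDerivAt.congr_of_eventuallyEq ?_ hp
    exact (hasDerivAt_moeb g ⟨z τ, hpos⟩).comp_of_eq τ hz rfl

theorem etaPullback_eq (hu : u ∈ cuspForms ρ k s) {ξ₁ ξ₂ : OnePoint ℚ} (t : OnePoint ℝ)
    {g : SL(2, ℤ)} {z : ℝ → ℂ} {z' : ℂ} {τ : ℝ}
    (hz : HasDerivAt z z' τ) (hpos : 0 < (z τ).im)
    (hp : cuspPath ξ₁ ξ₂ =ᶠ[𝓝 τ] fun τ => moeb g (z τ)) :
    etaPullback k s u ξ₁ ξ₂ t τ = greenPull ρ s k u t g (z τ) z' := by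
  obtain ⟨h1, h2⟩ := hasDerivAt_of_cuspPath_eq hz hpos hp
  rw [etaPullback, greenForm_eq _ _ _ _ h1, h2.deriv, hp.self_of_nhds]
  exact greenCLM_moeb hu t g ⟨z τ, hpos⟩ z'

theorem hasDerivAt_verticalLine (x r τ : ℝ) :
    HasDerivAt (fun τ : ℝ => (x : ℂ) + Complex.I * ((r * τ : ℝ) : ℂ)) (Complex.I * r) τ := by
  have h : HasDerivAt (fun τ : ℝ => ((r * τ : ℝ) : ℂ)) (r : ℂ) τ := by
    simpa using ((hasDerivAt_id τ).const_mul r).ofReal_comp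
  exact (h.const_mul Complex.I).const_add _

theorem hasDerivAt_verticalLine_inv (x r : ℝ) {τ : ℝ} (hτ : τ ≠ 0) :
    HasDerivAt (fun τ : ℝ => (x : ℂ) + Complex.I * ((r * τ⁻¹ : ℝ) : ℂ))
      (Complex.I * ((r * -(τ ^ 2)⁻¹ : ℝ) : ℂ)) τ :=
  (((hasDerivAt_inv hτ).const_mul r).ofReal_comp.const_mul Complex.I).const_add _

/-- Absolute convergence of the integrals between cusps, and their value in terms of limits of a
primitive. -/
theorem etaPullback_integral [CompleteSpace V] (hu : u ∈ cuspForms ρ k s) {ξ₁ ξ₂ : OnePoint ℚ}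
    (hξ : ξ₁ ≠ ξ₂) {g₁ g₂ : SL(2, ℤ)}
    (h₁ : Matrix.SpecialLinearGroup.mapGL ℚ g₁ • OnePoint.infty = ξ₁)
    (h₂ : Matrix.SpecialLinearGroup.mapGL ℚ g₂ • OnePoint.infty = ξ₂) (t : OnePoint ℝ) :
    MeasureTheory.IntegrableOn (etaPullback k s u ξ₁ ξ₂ t) (Set.Ioi (0 : ℝ)) ∧
    ∀ Φ : ℂ → V, IsGreenPrimitive s k u t Φ → ∀ L₁ L₂ : V,
      (∀ x r : ℝ, 0 < r → Tendsto
        (fun y : ℝ => Φ (moeb g₁ ((x : ℂ) + Complex.I * ((r * y : ℝ) : ℂ)))) atTop (𝓝 L₁)) →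
      (∀ x r : ℝ, 0 < r → Tendsto
        (fun y : ℝ => Φ (moeb g₂ ((x : ℂ) + Complex.I * ((r * y : ℝ) : ℂ)))) atTop (𝓝 L₂)) →
      parCocycle k s u ξ₁ ξ₂ t = L₂ - L₁ := by
  -- One coordinate per end: `g₂` serves for large `τ`, and `g₁` combined with the reversal `τ ↦
  -- τ⁻¹` for small `τ`.
  obtain ⟨x₂, r₂, hr₂, hp₂⟩ := exists_cuspPath_eq hξ h₂
  obtain ⟨x₁, r₁, hr₁, hp₁'⟩ := exists_cuspPath_eq hξ.symm h₁
  have hp₁ : ∀ τ : ℝ, 0 < τ →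
      cuspPath ξ₁ ξ₂ τ = moeb g₁ ((x₁ : ℂ) + Complex.I * ((r₁ * τ⁻¹ : ℝ) : ℂ)) := fun τ hτ => by
    rw [cuspPath_symm hξ hτ, hp₁' _ (inv_pos.2 hτ)]
  have hev : ∀ τ : ℝ, 0 < τ → ∀ᶠ σ in 𝓝 τ, 0 < σ := fun τ hτ => lt_mem_nhds hτ
  have hη₂ : ∀ τ : ℝ, 0 < τ → etaPullback k s u ξ₁ ξ₂ t τ =
      greenPull ρ s k u t g₂ ((x₂ : ℂ) + Complex.I * ((r₂ * τ : ℝ) : ℂ)) (Complex.I * r₂) :=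
    fun τ hτ => etaPullback_eq (z := fun τ : ℝ => (x₂ : ℂ) + Complex.I * ((r₂ * τ : ℝ) : ℂ)) hu t
      (hasDerivAt_verticalLine x₂ r₂ τ) (by rw [im_add_I_mul]; positivity)
      ((hev τ hτ).mono fun σ hσ => hp₂ σ hσ)
  have hη₁ : ∀ τ : ℝ, 0 < τ → etaPullback k s u ξ₁ ξ₂ t τ =
      greenPull ρ s k u t g₁ ((x₁ : ℂ) + Complex.I * ((r₁ * τ⁻¹ : ℝ) : ℂ))
        (Complex.I * ((r₁ * -(τ ^ 2)⁻¹ : ℝ) : ℂ)) :=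
    fun τ hτ => etaPullback_eq (z := fun τ : ℝ => (x₁ : ℂ) + Complex.I * ((r₁ * τ⁻¹ : ℝ) : ℂ)) hu t
      (hasDerivAt_verticalLine_inv x₁ r₁ hτ.ne') (by rw [im_add_I_mul]; positivity)
      ((hev τ hτ).mono fun σ hσ => hp₁ σ hσ)
  have hcont : ContinuousOn (etaPullback k s u ξ₁ ξ₂ t) (Set.Ioi 0) := by
    refine ContinuousOn.congr (fun τ hτ => ?_) hη₂
    have hτ' : 0 < τ := hτ
    have := (continuousAt_greenPull_apply hu t g₂ ((x₂ : ℂ) + Complex.I * ((r₂ * τ : ℝ) : ℂ))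
      (Complex.I * r₂) (by rw [im_add_I_mul]; positivity)).comp
      (f := fun τ : ℝ => (x₂ : ℂ) + Complex.I * ((r₂ * τ : ℝ) : ℂ)) (x := τ)
      (hasDerivAt_verticalLine x₂ r₂ τ).continuousAt
    exact this.continuousWithinAt
  have hint : MeasureTheory.IntegrableOn (etaPullback k s u ξ₁ ξ₂ t) (Set.Ioi (0 : ℝ)) := by
    obtain ⟨a, C, Y, ha, hC, hY, h⟩ := greenPull_decay (g := g₁) hu t |x₁|
    have hY0 : 0 < Y := lt_of_lt_of_le one_pos hY
    -- For `τ ≤ T` the height `r₁/τ` in the first coordinate is at least `Y`.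
    set T := r₁ / Y
    have hT : 0 < T := by positivity
    rw [← Set.Ioc_union_Ioi_eq_Ioi hT.le]
    refine MeasureTheory.IntegrableOn.union ?_ ?_
    · refine MeasureTheory.IntegrableOn.of_bound (C := 2 * C / (a ^ 2 * r₁)) (by simp)
        ((hcont.mono fun τ hτ => hτ.1).aestronglyMeasurable measurableSet_Ioc) ?_
      refine (MeasureTheory.ae_restrict_iff' measurableSet_Ioc).2 (Eventually.of_forall ?_)
      rintro τ ⟨hτ, hτT⟩
      rw [hη₁ τ hτ]
      have hYτ : Y ≤ r₁ * τ⁻¹ := by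
        rw [le_div_iff₀ hY0] at hτT
        rw [← div_eq_mul_inv, le_div_iff₀ hτ]; linarith
      refine (h _ _ (by rw [re_add_I_mul]) (by rw [im_add_I_mul]; exact hYτ)).trans ?_
      rw [im_add_I_mul, norm_mul, Complex.norm_I, one_mul, Complex.norm_real, Real.norm_eq_abs,
        mul_neg, abs_neg, abs_of_pos (by positivity)]
      -- `exp (-v) ≤ 2/v²` absorbs the factor `τ⁻²` from the derivative of `τ⁻¹` and leaves a
      -- bounded integrand.
      set v := a * (r₁ * τ⁻¹) with hv
      have hv0 : 0 < v := by positivity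
      have h2 : v ^ 2 / 2 ≤ Real.exp v := by
        have := Real.quadratic_le_exp_of_nonneg hv0.le; linarith
      have h3 : Real.exp (-a * (r₁ * τ⁻¹)) ≤ 2 / v ^ 2 := by
        rw [neg_mul, ← hv, Real.exp_neg, inv_le_comm₀ (Real.exp_pos _) (by positivity), inv_div]
        exact h2
      calc C * Real.exp (-a * (r₁ * τ⁻¹)) * (r₁ * (τ ^ 2)⁻¹)
          ≤ C * (2 / v ^ 2) * (r₁ * (τ ^ 2)⁻¹) := by gcongr
        _ = 2 * C / (a ^ 2 * r₁) := by rw [hv]; field_simp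
    · obtain ⟨a, C, Y', ha, hC, hY', h⟩ := greenPull_decay (g := g₂) hu t |x₂|
      have hcont' := hcont.mono fun τ (hτ : T ≤ τ) => lt_of_lt_of_le hT hτ
      refine (MeasureTheory.integrable_norm_iff ((hcont'.mono
        Set.Ioi_subset_Ici_self).aestronglyMeasurable measurableSet_Ioi)).1 ?_
      refine integrable_of_isBigO_exp_neg (b := a * r₂) (by positivity) hcont'.norm ?_
      refine Asymptotics.IsBigO.of_bound (C * r₂) ?_
      filter_upwards [eventually_ge_atTop (Y' / r₂), eventually_gt_atTop 0] with τ h3 h4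
      rw [hη₂ τ h4, norm_norm, Real.norm_of_nonneg (Real.exp_nonneg _)]
      rw [div_le_iff₀ hr₂] at h3
      refine (h _ _ (by rw [re_add_I_mul]) (by rw [im_add_I_mul]; linarith)).trans (le_of_eq ?_)
      rw [im_add_I_mul, norm_mul, Complex.norm_I, one_mul, Complex.norm_real,
        Real.norm_of_nonneg hr₂.le]
      ring_nf
  refine ⟨hint, fun Φ hΦ L₁ L₂ hL₁ hL₂ => ?_⟩
  have hder : ∀ τ ∈ Set.Ioi (0 : ℝ), HasDerivAt (fun τ => Φ (cuspPath ξ₁ ξ₂ τ))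
      (etaPullback k s u ξ₁ ξ₂ t τ) τ := by
    intro τ hτ
    have hτ' : 0 < τ := hτ
    obtain ⟨e1, e2⟩ := hasDerivAt_of_cuspPath_eq
      (z := fun τ : ℝ => (x₂ : ℂ) + Complex.I * ((r₂ * τ : ℝ) : ℂ))
      (hasDerivAt_verticalLine x₂ r₂ τ) (by rw [im_add_I_mul]; positivity)
      ((hev τ hτ).mono fun σ hσ => hp₂ σ hσ)
    rw [etaPullback, greenForm_eq _ _ _ _ e1, e2.deriv]
    exact (hΦ _ e1).comp_hasDerivAt τ e2
  have hlim₂ : Tendsto (fun τ => Φ (cuspPath ξ₁ ξ₂ τ)) atTop (𝓝 L₂) := by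
    refine (hL₂ x₂ r₂ hr₂).congr' ?_
    filter_upwards [eventually_gt_atTop 0] with τ hτ
    rw [hp₂ τ hτ]
  have hlim₁ : Tendsto (fun τ => Φ (cuspPath ξ₁ ξ₂ τ)) (𝓝[>] 0) (𝓝 L₁) := by
    refine ((hL₁ x₁ r₁ hr₁).comp tendsto_inv_nhdsGT_zero).congr' ?_
    filter_upwards [self_mem_nhdsWithin] with τ hτ
    rw [Function.comp_apply, hp₁ τ hτ]
  -- The primitive means nothing at the cusp `τ = 0`; its value there is replaced by the limit `L₁`
  -- to obtain continuity at the end point.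
  have key := MeasureTheory.integral_Ioi_of_hasDerivAt_of_tendsto
    (f := Function.update (fun τ => Φ (cuspPath ξ₁ ξ₂ τ)) 0 L₁)
    (f' := etaPullback k s u ξ₁ ξ₂ t) (a := 0) (m := L₂) ?_ ?_ hint ?_
  · rw [parCocycle, key, Function.update_self]
  · rw [continuousWithinAt_update_same, Set.Ici_sdiff_left]
    exact hlim₁
  · intro τ hτ
    refine (hder τ hτ).congr_of_eventuallyEq ?_
    filter_upwards [hev τ hτ] with σ hσ
    rw [Function.update_of_ne hσ.ne']
  · refine hlim₂.congr' ?_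
    filter_upwards [eventually_gt_atTop 0] with σ hσ
    rw [Function.update_of_ne hσ.ne']

theorem etaPullback_self (ξ : OnePoint ℚ) (t : OnePoint ℝ) (τ : ℝ) :
    etaPullback k s u ξ ξ t τ = 0 := by
  have h : cuspPath ξ ξ = fun _ => cuspPath ξ ξ 0 := by
    cases ξ with
    | infty => rfl
    | coe a =>
      funext τ
      change ((a : ℂ) + Complex.I * ((SignType.sign (a - a) : ℤ) : ℂ) * (τ : ℂ) * (a : ℂ)) /
        (1 + Complex.I * ((SignType.sign (a - a) : ℤ) : ℂ) * (τ : ℂ)) =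
        ((a : ℂ) + Complex.I * ((SignType.sign (a - a) : ℤ) : ℂ) * ((0 : ℝ) : ℂ) * (a : ℂ)) /
        (1 + Complex.I * ((SignType.sign (a - a) : ℤ) : ℂ) * ((0 : ℝ) : ℂ))
      simp
  have h2 : deriv (cuspPath ξ ξ) τ = 0 := by rw [h]; simp
  rw [etaPullback, h2]
  simp [greenForm]

theorem parCocycle_self (ξ : OnePoint ℚ) (t : OnePoint ℝ) : parCocycle k s u ξ ξ t = 0 := by
  simp [parCocycle, etaPullback_self]

theorem integrableOn_etaPullback [CompleteSpace V] (hu : u ∈ cuspForms ρ k s) (ξ₁ ξ₂ : OnePoint ℚ)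
    (t : OnePoint ℝ) :
    MeasureTheory.IntegrableOn (etaPullback k s u ξ₁ ξ₂ t) (Set.Ioi (0 : ℝ)) := by
  obtain ⟨g₁, h₁⟩ := OnePoint.exists_mem_SL2 ℤ ξ₁
  obtain ⟨g₂, h₂⟩ := OnePoint.exists_mem_SL2 ℤ ξ₂
  by_cases h : ξ₁ = ξ₂
  · subst h
    have : etaPullback k s u ξ₁ ξ₁ t = fun _ => 0 := funext (etaPullback_self ξ₁ t)
    rw [this]
    exact MeasureTheory.integrableOn_zero
  · exact (etaPullback_integral hu h h₁ h₂ t).1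

/-- The integrals between cusps are differences of boundary values. -/
theorem exists_parCocycle_eq_sub [CompleteSpace V] (hu : u ∈ cuspForms ρ k s) (t : OnePoint ℝ) :
    ∃ L : OnePoint ℚ → V, ∀ ξ₁ ξ₂, parCocycle k s u ξ₁ ξ₂ t = L ξ₂ - L ξ₁ := by
  obtain ⟨Φ, hΦ⟩ := green_closed hu.1 hu.2.2.1 t
  have hΦ' : IsGreenPrimitive s k u t Φ := hΦ
  choose g hg using fun ξ : OnePoint ℚ => OnePoint.exists_mem_SL2 ℤ ξ
  choose L hL using fun ξ : OnePoint ℚ => hΦ'.exists_tendsto hu (g ξ)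
  refine ⟨L, fun ξ₁ ξ₂ => ?_⟩
  by_cases h : ξ₁ = ξ₂
  · subst h; rw [parCocycle_self, sub_self]
  · exact (etaPullback_integral hu h (hg ξ₁) (hg ξ₂) t).2 Φ hΦ' _ _ (hL ξ₁) (hL ξ₂)

theorem parCocycle_add [CompleteSpace V] (hu : u ∈ cuspForms ρ k s) (ξ₁ ξ₂ ξ₃ : OnePoint ℚ) :
    parCocycle k s u ξ₁ ξ₂ + parCocycle k s u ξ₂ ξ₃ = parCocycle k s u ξ₁ ξ₃ := by
  funext t
  obtain ⟨L, hL⟩ := exists_parCocycle_eq_sub hu t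
  simp only [Pi.add_apply, hL]
  abel

theorem parCocycle_symm [CompleteSpace V] (hu : u ∈ cuspForms ρ k s) (ξ₁ ξ₂ : OnePoint ℚ) :
    parCocycle k s u ξ₂ ξ₁ = -parCocycle k s u ξ₁ ξ₂ := by
  funext t
  obtain ⟨L, hL⟩ := exists_parCocycle_eq_sub hu t
  simp only [Pi.neg_apply, hL]
  abel

/-- Equivariance of the integrals between cusps. -/
theorem prs_parCocycle [CompleteSpace V] (hu : u ∈ cuspForms ρ k s) (γ : SL(2, ℤ))
    (ξ₁ ξ₂ : OnePoint ℚ) :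
    prs ρ k s γ (parCocycle k s u (Matrix.SpecialLinearGroup.mapGL ℚ γ • ξ₁)
      (Matrix.SpecialLinearGroup.mapGL ℚ γ • ξ₂)) = parCocycle k s u ξ₁ ξ₂ := by
  funext t
  rw [prs_apply]
  by_cases h : ξ₁ = ξ₂
  · subst h; simp [parCocycle_self]
  obtain ⟨g₁, h₁⟩ := OnePoint.exists_mem_SL2 ℤ ξ₁
  obtain ⟨g₂, h₂⟩ := OnePoint.exists_mem_SL2 ℤ ξ₂
  obtain ⟨Φ, hΦ⟩ := green_closed hu.1 hu.2.2.1 (bdAct γ t)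
  have hΦ' : IsGreenPrimitive s k u (bdAct γ t) Φ := hΦ
  obtain ⟨L₁, hL₁⟩ := hΦ'.exists_tendsto hu (γ * g₁)
  obtain ⟨L₂, hL₂⟩ := hΦ'.exists_tendsto hu (γ * g₂)
  have e1 := (etaPullback_integral hu (fun e => h (smul_left_cancel _ e))
    (g₁ := γ * g₁) (g₂ := γ * g₂) (by rw [map_mul, mul_smul, h₁]) (by rw [map_mul, mul_smul, h₂])
    (bdAct γ t)).2 Φ hΦ' L₁ L₂ hL₁ hL₂
  have hmul : ∀ (g : SL(2, ℤ)) (z : ℂ), 0 < z.im → moeb (γ * g) z = moeb γ (moeb g z) := by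
    intro g z hz
    lift z to ℍ using hz
    rw [moeb_coe, moeb_coe, moeb_coe, mul_smul]
  have hlim : ∀ (g : SL(2, ℤ)) (L : V), (∀ x r : ℝ, 0 < r → Tendsto
        (fun y : ℝ => Φ (moeb (γ * g) ((x : ℂ) + Complex.I * ((r * y : ℝ) : ℂ)))) atTop (𝓝 L)) →
      ∀ x r : ℝ, 0 < r → Tendsto (fun y : ℝ => bdFactor s k γ t •
        ρ γ⁻¹ (Φ (moeb γ (moeb g ((x : ℂ) + Complex.I * ((r * y : ℝ) : ℂ)))))) atTop
        (𝓝 (bdFactor s k γ t • ρ γ⁻¹ L)) := by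
    intro g L hL x r hr
    have h3 := (((ρ γ⁻¹).continuous.tendsto L).comp (hL x r hr)).const_smul (bdFactor s k γ t)
    refine h3.congr' ?_
    filter_upwards [eventually_gt_atTop 0] with y hy
    rw [Function.comp_apply, hmul g _ (by rw [im_add_I_mul]; positivity)]
  have e2 := (etaPullback_integral hu h h₁ h₂ t).2 _ (hΦ'.smul hu) _ _ (hlim g₁ L₁ hL₁)
    (hlim g₂ L₂ hL₂)
  rw [e1, e2, map_sub, smul_sub]

/-! ### Algebraic properties of the period integral -/

theorem mapGL_rat_smul_coe (g : SL(2, ℤ)) (x : ℚ) :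
    Matrix.SpecialLinearGroup.mapGL ℚ g • (x : OnePoint ℚ) =
      if (g 1 0 : ℚ) * x + (g 1 1 : ℚ) = 0 then OnePoint.infty else
        ((((g 0 0 : ℚ) * x + (g 0 1 : ℚ)) / ((g 1 0 : ℚ) * x + (g 1 1 : ℚ)) : ℚ) :
          OnePoint ℚ) := by
  rw [OnePoint.smul_some_eq_ite]; simp

theorem periodIntegral_eigen [CompleteSpace V] (hu : u ∈ cuspForms ρ k s) :
    EigenNegOne ρ k s (periodIntegral k s u) := by
  have h := prs_parCocycle hu (-1) ((0 : ℚ) : OnePoint ℚ) OnePoint.infty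
  rw [mapGL_rat_smul_infty, mapGL_rat_smul_coe] at h
  simpa [EigenNegOne, periodIntegral] using h

/-- `S` exchanges `0` and `∞`, which reverses the path. `T` carries the path from `-1` to `∞`, and
`T'` the path from `0` to `-1`, to the path from `0` to `∞`; these two pieces add up to the path
from `0` to `∞`. -/
theorem periodIntegral_relations [CompleteSpace V] (hu : u ∈ cuspForms ρ k s) :
    PeriodRelations ρ k s (periodIntegral k s u) := by
  have hS := prs_parCocycle hu matS OnePoint.infty ((0 : ℚ) : OnePoint ℚ)
  have hT := prs_parCocycle hu matT ((-1 : ℚ) : OnePoint ℚ) OnePoint.infty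
  have hT' := prs_parCocycle hu matT' ((0 : ℚ) : OnePoint ℚ) ((-1 : ℚ) : OnePoint ℚ)
  have s1 : Matrix.SpecialLinearGroup.mapGL ℚ matS • (OnePoint.infty : OnePoint ℚ) =
      ((0 : ℚ) : OnePoint ℚ) := by rw [mapGL_rat_smul_infty]; simp [matS]
  have s2 : Matrix.SpecialLinearGroup.mapGL ℚ matS • ((0 : ℚ) : OnePoint ℚ) =
      OnePoint.infty := by rw [mapGL_rat_smul_coe]; simp [matS]
  have t1 : Matrix.SpecialLinearGroup.mapGL ℚ matT • (OnePoint.infty : OnePoint ℚ) =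
      OnePoint.infty := by rw [mapGL_rat_smul_infty]; simp [matT]
  have t2 : Matrix.SpecialLinearGroup.mapGL ℚ matT • ((-1 : ℚ) : OnePoint ℚ) =
      ((0 : ℚ) : OnePoint ℚ) := by rw [mapGL_rat_smul_coe]; simp [matT]
  have r1 : Matrix.SpecialLinearGroup.mapGL ℚ matT' • ((-1 : ℚ) : OnePoint ℚ) =
      OnePoint.infty := by rw [mapGL_rat_smul_coe]; simp [matT']
  have r2 : Matrix.SpecialLinearGroup.mapGL ℚ matT' • ((0 : ℚ) : OnePoint ℚ) =
      ((0 : ℚ) : OnePoint ℚ) := by rw [mapGL_rat_smul_coe]; simp [matT']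
  rw [s1, s2] at hS
  rw [t1, t2] at hT
  rw [r1, r2] at hT'
  constructor
  · rw [periodIntegral, hS, parCocycle_symm hu]
  · rw [periodIntegral, hT, hT', add_comm, parCocycle_add hu]

/-- The finite sums of translates of `φ` under the action of the modular group. -/
def translates (ρ : SL(2, ℤ) →* (V ≃ₗᵢ[ℂ] V)) (k : ℝ) (s : ℂ) (φ : OnePoint ℝ → V) :
    AddSubmonoid (OnePoint ℝ → V) :=
  AddSubmonoid.closure (Set.range fun γ => prs ρ k s γ φ)

theorem exists_sum_of_mem_translates {φ ψ : OnePoint ℝ → V} (h : ψ ∈ translates ρ k s φ) :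
    ∃ (m : ℕ) (γ : Fin m → SL(2, ℤ)), ψ = ∑ j, prs ρ k s (γ j) φ := by
  induction h using AddSubmonoid.closure_induction with
  | mem x hx =>
    obtain ⟨γ, rfl⟩ := hx
    exact ⟨1, fun _ => γ, by simp⟩
  | zero => exact ⟨0, fun _ => 1, by simp⟩
  | add x y _ _ hx hy =>
    obtain ⟨m, γ, rfl⟩ := hx
    obtain ⟨n, δ, rfl⟩ := hy
    refine ⟨m + n, Fin.append γ δ, ?_⟩
    rw [Fin.sum_univ_add]
    simp

theorem prs_neg (γ : SL(2, ℤ)) (φ : OnePoint ℝ → V) : prs ρ k s γ (-φ) = -prs ρ k s γ φ := by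
  funext t; simp [prs]

theorem prs_mem_translates {φ ψ : OnePoint ℝ → V} (h : ψ ∈ translates ρ k s φ) (γ : SL(2, ℤ)) :
    prs ρ k s γ ψ ∈ translates ρ k s φ := by
  induction h using AddSubmonoid.closure_induction with
  | mem x hx =>
    obtain ⟨δ, rfl⟩ := hx
    rw [prs_prs]
    exact AddSubmonoid.subset_closure ⟨δ * γ, rfl⟩
  | zero => rw [prs_zero]; exact zero_mem _
  | add x y _ _ hx hy => rw [prs_add]; exact add_mem hx hy

/-- The relation `φ = -φ|S` absorbs signs: `-φ|δ = φ|(Sδ)`. Hence sums without signs, which form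
only a monoid a priori, are closed under negation. -/
theorem neg_mem_translates {φ ψ : OnePoint ℝ → V} (hφ : φ = -prs ρ k s matS φ)
    (h : ψ ∈ translates ρ k s φ) : -ψ ∈ translates ρ k s φ := by
  induction h using AddSubmonoid.closure_induction with
  | mem x hx =>
    obtain ⟨δ, rfl⟩ := hx
    have e : -prs ρ k s δ φ = prs ρ k s (matS * δ) φ := by
      rw [← prs_neg, ← prs_prs]
      congr 1
      exact neg_eq_iff_eq_neg.2 hφ
    simp only [e]
    exact AddSubmonoid.subset_closure ⟨matS * δ, rfl⟩
  | zero => rw [neg_zero]; exact zero_mem _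
  | add x y _ _ hx hy => rw [neg_add]; exact add_mem hx hy

/-- Induction along the generators: the integral is `P(u)` for `S` and zero for `T`. For a product
`x y` the path from `x y ∞` to `∞` is broken at `x ∞`, and its first piece is the `x`-image of the
path from `y ∞` to `∞`. -/
theorem parCocycle_infty_mem_translates [CompleteSpace V] (hu : u ∈ cuspForms ρ k s)
    (γ : SL(2, ℤ)) :
    parCocycle k s u (Matrix.SpecialLinearGroup.mapGL ℚ γ • OnePoint.infty) OnePoint.infty ∈
      translates ρ k s (periodIntegral k s u) := by
  have hneg := fun ψ => neg_mem_translates (ψ := ψ) (periodIntegral_relations hu).1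
  have hγ : γ ∈ Subgroup.closure {ModularGroup.S, ModularGroup.T} := by
    rw [SpecialLinearGroup.SL2Z_generators]; trivial
  induction hγ using Subgroup.closure_induction with
  | mem x hx =>
    rcases hx with rfl | rfl
    · rw [mapGL_rat_smul_infty, if_neg (by simp [ModularGroup.S])]
      refine AddSubmonoid.subset_closure ⟨1, ?_⟩
      have h := prs_parCocycle hu 1 ((0 : ℚ) : OnePoint ℚ) OnePoint.infty
      rw [map_one, one_smul, one_smul] at h
      have e : (((ModularGroup.S 0 0 : ℚ) / (ModularGroup.S 1 0 : ℚ) : ℚ) : OnePoint ℚ) =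
        ((0 : ℚ) : OnePoint ℚ) := by simp [ModularGroup.S]
      rw [e]
      exact h
    · rw [mapGL_rat_smul_infty, if_pos (by simp [ModularGroup.T])]
      have : parCocycle k s u OnePoint.infty OnePoint.infty = 0 :=
        funext (parCocycle_self OnePoint.infty)
      rw [this]
      exact zero_mem _
  | one =>
    have : parCocycle k s u OnePoint.infty OnePoint.infty = 0 :=
      funext (parCocycle_self OnePoint.infty)
    rw [map_one, one_smul, this]
    exact zero_mem _
  | mul x y _ _ hx hy =>
    rw [← parCocycle_add hu _ (Matrix.SpecialLinearGroup.mapGL ℚ x • OnePoint.infty)]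
    refine add_mem ?_ hx
    rw [← prs_parCocycle hu x⁻¹, ← mul_smul, ← mul_smul, ← map_mul, ← map_mul, inv_mul_cancel_left,
      inv_mul_cancel, map_one, one_smul]
    exact prs_mem_translates hy _
  | inv x _ hx =>
    rw [← prs_parCocycle hu x, ← mul_smul, ← map_mul, mul_inv_cancel, map_one, one_smul,
      parCocycle_symm hu]
    exact prs_mem_translates (hneg _ hx) _

theorem exists_parCocycle_eq_sum [CompleteSpace V] (hu : u ∈ cuspForms ρ k s) (ξ₁ ξ₂ : OnePoint ℚ) :
    ∃ (m : ℕ) (γ : Fin m → SL(2, ℤ)),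
      parCocycle k s u ξ₁ ξ₂ = ∑ j, prs ρ k s (γ j) (periodIntegral k s u) := by
  refine exists_sum_of_mem_translates ?_
  obtain ⟨g₁, rfl⟩ := OnePoint.exists_mem_SL2 ℤ ξ₁
  obtain ⟨g₂, rfl⟩ := OnePoint.exists_mem_SL2 ℤ ξ₂
  rw [← parCocycle_add hu _ OnePoint.infty, parCocycle_symm hu _ OnePoint.infty]
  exact add_mem (parCocycle_infty_mem_translates hu g₁)
    (neg_mem_translates (periodIntegral_relations hu).1 (parCocycle_infty_mem_translates hu g₂))

end MaassPeriod

end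

/-! ### Decay along the imaginary axis and continuity of the period integral. -/

noncomputable section

namespace MaassPeriod

open Filter Topology Complex

variable {V : Type*} [NormedAddCommGroup V] [InnerProductSpace ℂ V]
variable {ρ : SL(2, ℤ) →* (V ≃ₗᵢ[ℂ] V)} {k : ℝ} {s : ℂ} {u : ℍ → V}

/-- The point `iτ`. -/
def imPt (τ : ℝ) (hτ : 0 < τ) : ℍ := ⟨Complex.I * τ, by simpa using hτ⟩

theorem coe_imPt (τ : ℝ) (hτ : 0 < τ) : ((imPt τ hτ : ℍ) : ℂ) = Complex.I * τ := rfl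

theorem imPt_im (τ : ℝ) (hτ : 0 < τ) : (imPt τ hτ).im = τ := by
  change (Complex.I * (τ : ℂ)).im = τ; simp

theorem imPt_re (τ : ℝ) (hτ : 0 < τ) : (imPt τ hτ).re = 0 := by
  change (Complex.I * (τ : ℂ)).re = 0; simp

theorem matS_smul_imPt (τ : ℝ) (hτ : 0 < τ) : matS • imPt τ hτ = imPt τ⁻¹ (inv_pos.2 hτ) := by
  have hτ' : (τ : ℂ) ≠ 0 := by exact_mod_cast hτ.ne'
  ext
  rw [coe_smul_eq, coe_imPt, autFactor, coe_imPt]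
  simp only [matS, Matrix.cons_val', Matrix.cons_val_zero, Matrix.cons_val_one,
    Matrix.cons_val_fin_one, Matrix.of_apply]
  push_cast
  field_simp
  rw [coe_imPt]
  push_cast
  field_simp
  linear_combination (-(τ : ℂ)) * Complex.I_mul_I

theorem norm_phase (k : ℝ) (γ : SL(2, ℤ)) (z : ℍ) : ‖phase k γ z‖ = 1 := by
  rw [phase, Complex.norm_exp]; simp

theorem autFactor_matS (z : ℍ) : autFactor matS z = z := by simp [autFactor, matS]

/-- `S` exchanges the ends of the imaginary axis, so decay at `∞` gives decay at `0`, with an extra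
`τ⁻²` for the covariant derivative; on the compact middle part continuity is enough. The rate drops
to a quarter to absorb that power and to pass to `τ + τ⁻¹`. -/
theorem exists_decay_imPt (hu : u ∈ cuspForms ρ k s) :
    ∃ a C : ℝ, 0 < a ∧ 0 < C ∧ ∀ (τ : ℝ), 0 < τ →
      ‖lift u (Complex.I * τ)‖ ≤ C * Real.exp (-a * (τ + τ⁻¹)) ∧
      ‖covD k u (Complex.I * τ)‖ ≤ C * Real.exp (-a * (τ + τ⁻¹)) := by
  obtain ⟨a, C, Y, ha, hC, hY, h⟩ := exists_decay_covD hu 0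
  have hY0 : 0 < Y := lt_of_lt_of_le one_pos hY
  set m := ‖(mult k matS)⁻¹‖
  have hm : 0 ≤ m := norm_nonneg _
  set b := a / 4
  have hb : 0 < b := by positivity
  have hinf : ∀ τ : ℝ, Y ≤ τ → ‖lift u (Complex.I * τ)‖ ≤ C * Real.exp (-a * τ) ∧
      ‖covD k u (Complex.I * τ)‖ ≤ C * Real.exp (-a * τ) := by
    intro τ hτ
    have hτ0 : 0 < τ := by linarith
    have := h (imPt τ hτ0) (by rw [imPt_re]; simp) (by rw [imPt_im]; exact hτ)
    rw [imPt_im, coe_imPt, ← lift_coe u, coe_imPt] at this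
    exact this
  have hzero : ∀ τ : ℝ, 0 < τ → ‖lift u (Complex.I * τ)‖ = m * ‖lift u (Complex.I * (τ⁻¹ : ℝ))‖ ∧
      ‖covD k u (Complex.I * τ)‖ = m / τ ^ 2 * ‖covD k u (Complex.I * (τ⁻¹ : ℝ))‖ := by
    intro τ hτ
    have h1 := apply_eq_of_slash (hu.2.1 matS) (imPt τ hτ)
    have h2 := covD_eq_of_slash hu.1 (hu.2.1 matS) (imPt τ hτ)
    rw [matS_smul_imPt, ← lift_coe u, ← lift_coe u, coe_imPt, coe_imPt] at h1
    rw [matS_smul_imPt, coe_imPt, coe_imPt, autFactor_matS, coe_imPt] at h2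
    constructor
    · rw [h1, norm_smul, LinearIsometryEquiv.norm_map, mul_inv, norm_mul, norm_inv (phase _ _ _),
        norm_phase, inv_one, mul_one]
    · rw [h2, norm_smul, LinearIsometryEquiv.norm_map, norm_div, mul_inv, norm_mul,
        norm_inv (phase _ _ _), norm_phase, inv_one, mul_one, norm_pow, norm_mul, Complex.norm_I,
        one_mul, Complex.norm_real, Real.norm_of_nonneg hτ.le]
  have hcont : ContinuousOn (fun τ : ℝ => ‖lift u (Complex.I * τ)‖ + ‖covD k u (Complex.I * τ)‖)
      (Set.Icc Y⁻¹ Y) := by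
    intro τ hτ
    have hτ0 : 0 < τ := lt_of_lt_of_le (inv_pos.2 hY0) hτ.1
    have him : 0 < (Complex.I * (τ : ℂ)).im := by simpa using hτ0
    have hc : ContinuousAt (fun τ : ℝ => Complex.I * (τ : ℂ)) τ := by fun_prop
    have h1 : ContinuousAt (fun τ : ℝ => lift u (Complex.I * τ)) τ :=
      ContinuousAt.comp (f := fun τ : ℝ => Complex.I * (τ : ℂ)) (g := lift u)
        (hu.1 ⟨_, him⟩).continuousAt hc
    have h2 : ContinuousAt (fun τ : ℝ => covD k u (Complex.I * τ)) τ :=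
      ContinuousAt.comp (f := fun τ : ℝ => Complex.I * (τ : ℂ)) (g := covD k u)
        (continuousAt_covD hu.1 him) hc
    exact (h1.norm.add h2.norm).continuousWithinAt
  obtain ⟨M, hM⟩ := isCompact_Icc.exists_bound_of_continuousOn hcont
  set e := Real.exp (b * (Y + Y))
  have hM0 : 0 ≤ M := (norm_nonneg _).trans (hM 1 ⟨inv_le_one_of_one_le₀ hY, hY⟩)
  set C' := C + M * e + m * C + m * C * (2 / (2 * b) ^ 2) with hC'
  have p1 : 0 ≤ M * e := by positivity
  have p2 : 0 ≤ m * C := by positivity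
  have p3 : 0 ≤ m * C * (2 / (2 * b) ^ 2) := by positivity
  refine ⟨b, C', hb, by linarith, fun τ hτ => ?_⟩
  set E := Real.exp (-b * (τ + τ⁻¹))
  have hE : 0 < E := Real.exp_pos _
  have hti : 0 < τ⁻¹ := inv_pos.2 hτ
  rcases le_total Y τ with h1 | h1
  · obtain ⟨e1, e2⟩ := hinf τ h1
    have e3 : C * Real.exp (-a * τ) ≤ C' * E := by
      refine mul_le_mul (by linarith) (Real.exp_le_exp.2 ?_) (Real.exp_nonneg _) (by linarith)
      have : τ⁻¹ ≤ 1 := inv_le_one_of_one_le₀ (hY.trans h1)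
      have : a = 4 * b := by simp only [b]; ring
      nlinarith
    exact ⟨e1.trans e3, e2.trans e3⟩
  rcases le_total τ Y⁻¹ with h2 | h2
  · have h3 : Y ≤ τ⁻¹ := (le_inv_comm₀ hτ hY0).1 h2
    obtain ⟨e1, e2⟩ := hinf τ⁻¹ h3
    obtain ⟨z1, z2⟩ := hzero τ hτ
    have hτ1 : τ ≤ τ⁻¹ := (h2.trans (inv_le_one_of_one_le₀ hY)).trans (hY.trans h3)
    have hab : a = 4 * b := by simp only [b]; ring
    have e4 : Real.exp (-a * τ⁻¹) ≤ E := Real.exp_le_exp.2 (by nlinarith)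
    constructor
    · rw [z1]
      calc m * ‖lift u (Complex.I * (τ⁻¹ : ℝ))‖ ≤ m * (C * Real.exp (-a * τ⁻¹)) := by gcongr
        _ = m * C * Real.exp (-a * τ⁻¹) := by ring
        _ ≤ C' * E := mul_le_mul (by linarith) e4 (Real.exp_nonneg _) (by linarith)
    · rw [z2]
      set v := 2 * b * τ⁻¹ with hv
      have hv0 : 0 < v := by positivity
      have q1 : v ^ 2 / 2 ≤ Real.exp v := by
        have := Real.quadratic_le_exp_of_nonneg hv0.le; linarith
      have q2 : Real.exp (-v) ≤ 2 / v ^ 2 := by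
        rw [Real.exp_neg, inv_le_comm₀ (Real.exp_pos _) (by positivity), inv_div]
        exact q1
      have q3 : Real.exp (-a * τ⁻¹) ≤ 2 / v ^ 2 * E := by
        have : Real.exp (-a * τ⁻¹) ≤ Real.exp (-v) * E := by
          rw [← Real.exp_add]
          refine Real.exp_le_exp.2 ?_
          rw [hv]; nlinarith
        exact this.trans (mul_le_mul_of_nonneg_right q2 hE.le)
      calc m / τ ^ 2 * ‖covD k u (Complex.I * (τ⁻¹ : ℝ))‖
          ≤ m / τ ^ 2 * (C * (2 / v ^ 2 * E)) := by
            gcongr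
            exact e2.trans (mul_le_mul_of_nonneg_left q3 hC.le)
        _ = m * C * (2 / (2 * b) ^ 2) * E := by rw [hv]; field_simp
        _ ≤ C' * E := mul_le_mul_of_nonneg_right (by linarith) hE.le
  · have h3 := hM τ ⟨h2, h1⟩
    rw [Real.norm_of_nonneg (by positivity)] at h3
    have e1 : 1 ≤ e * E := by
      rw [← Real.exp_add]
      refine Real.one_le_exp ?_
      have : τ⁻¹ ≤ Y := by rw [inv_le_comm₀ hτ hY0]; exact h2
      nlinarith
    have e2 : M ≤ C' * E := by
      calc M = M * 1 := by ring
        _ ≤ M * (e * E) := mul_le_mul_of_nonneg_left e1 hM0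
        _ = M * e * E := by ring
        _ ≤ C' * E := mul_le_mul_of_nonneg_right (by linarith) hE.le
    constructor
    · linarith [norm_nonneg (covD k u (Complex.I * τ))]
    · linarith [norm_nonneg (lift u (Complex.I * τ))]

theorem abs_log_le_log_add_inv {τ : ℝ} (hτ : 0 < τ) : |Real.log τ| ≤ Real.log (τ + τ⁻¹) := by
  have hti : 0 < τ⁻¹ := inv_pos.2 hτ
  refine abs_le.2 ⟨?_, Real.log_le_log hτ (by linarith)⟩
  rw [neg_le, ← Real.log_inv]
  exact Real.log_le_log hti (by linarith)

theorem one_le_add_inv {τ : ℝ} (hτ : 0 < τ) : 1 ≤ τ + τ⁻¹ := by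
  have hti : 0 < τ⁻¹ := inv_pos.2 hτ
  rcases le_total 1 τ with h | h
  · linarith
  · have := (one_le_inv₀ hτ).2 h; linarith

theorem cuspPath_zero_infty : cuspPath ((0 : ℚ) : OnePoint ℚ) OnePoint.infty =
    fun τ : ℝ => Complex.I * τ := by
  funext τ
  change ((0 : ℚ) : ℂ) + Complex.I * (τ : ℂ) = _
  simp

theorem etaPullback_zero_infty (t : OnePoint ℝ) {τ : ℝ} (hτ : 0 < τ) :
    etaPullback k s u ((0 : ℚ) : OnePoint ℚ) OnePoint.infty t τ =
      greenCLM s k u t (Complex.I * τ) Complex.I := by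
  have hd : HasDerivAt (fun τ : ℝ => Complex.I * (τ : ℂ)) Complex.I τ := by
    simpa using (Complex.ofRealCLM.hasDerivAt (x := τ)).const_mul Complex.I
  rw [etaPullback, cuspPath_zero_infty, hd.deriv, greenForm_eq]
  simpa using hτ

/-- The `3` counts logarithms: that of `τ` once and that of `‖(t-i)/(t-iτ)‖` twice, each at most
`log (2(τ + τ⁻¹))` in absolute value. -/
theorem norm_poissonKernel_imPt_le (t : OnePoint ℝ) {τ : ℝ} (hτ : 0 < τ) :
    ‖poissonKernel s k t (imPt τ hτ)‖ ≤ Real.exp (3 * |s.re| * Real.log (2 * (τ + τ⁻¹))) := by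
  have hti : 0 < τ⁻¹ := inv_pos.2 hτ
  have hh := one_le_add_inv hτ
  have hzI : ‖Complex.I - (imPt τ hτ : ℂ)‖ = |τ - 1| := by
    have : Complex.I - (imPt τ hτ : ℂ) = -(Complex.I * ((τ - 1 : ℝ) : ℂ)) := by
      rw [coe_imPt]; push_cast; ring
    rw [this, norm_neg, norm_mul, Complex.norm_I, one_mul, Complex.norm_real, Real.norm_eq_abs]
  have habs : |τ - 1| ≤ τ + 1 := abs_le.2 ⟨by linarith, by linarith⟩
  have h1 : ‖crossQuot t Complex.I (imPt τ hτ)‖ ≤ 2 * (τ + τ⁻¹) := by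
    refine (norm_crossQuot_le t _ (imPt τ hτ).im_pos).trans ?_
    rw [hzI]
    simp only [UpperHalfPlane.coe_im, imPt_im]
    have : |τ - 1| / τ ≤ 1 + τ⁻¹ := by
      rw [div_le_iff₀ hτ, add_mul, inv_mul_cancel₀ hτ.ne']; linarith
    nlinarith [sq_nonneg (τ - 1), mul_inv_cancel₀ hτ.ne', sq_nonneg (τ⁻¹ - 1)]
  have h2 : ‖crossQuot t (imPt τ hτ) Complex.I‖ ≤ 2 * (τ + τ⁻¹) := by
    refine (norm_crossQuot_le t _ (by simp)).trans ?_
    rw [norm_sub_rev, hzI]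
    simp only [Complex.I_im, div_one]
    nlinarith [sq_nonneg (τ - 1), mul_inv_cancel₀ hτ.ne', sq_nonneg (τ⁻¹ - 1)]
  have h3 : ‖crossQuot t Complex.I (imPt τ hτ)‖ * ‖crossQuot t (imPt τ hτ) Complex.I‖ = 1 := by
    rw [← norm_mul, crossQuot_mul t _ (imPt τ hτ).im_pos.ne', crossQuot_self t (by simp), norm_one]
  set q := ‖crossQuot t Complex.I (imPt τ hτ)‖
  have hq0 : 0 < q := norm_pos_iff.2 (crossQuot_ne_zero t (by simp) (imPt τ hτ).im_pos.ne')
  have hlq : |Real.log q| ≤ Real.log (2 * (τ + τ⁻¹)) := by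
    refine abs_le.2 ⟨?_, Real.log_le_log hq0 h1⟩
    rw [neg_le, ← Real.log_inv]
    refine Real.log_le_log (by positivity) ?_
    rw [inv_eq_of_mul_eq_one_right h3]; exact h2
  have hlτ : |Real.log τ| ≤ Real.log (2 * (τ + τ⁻¹)) :=
    (abs_log_le_log_add_inv hτ).trans (Real.log_le_log (by linarith) (by linarith))
  rw [norm_poissonKernel, normSq_eq_norm_sq, imPt_im]
  refine Real.exp_le_exp.2 ((le_abs_self _).trans ?_)
  rw [abs_mul, Real.log_mul hτ.ne' (by positivity), Real.log_pow]
  have h4 : |Real.log τ + ((2 : ℕ) : ℝ) * Real.log q| ≤ 3 * Real.log (2 * (τ + τ⁻¹)) := by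
    refine (abs_add_le _ _).trans ?_
    rw [abs_mul]
    push_cast
    rw [abs_two]
    linarith
  calc |s.re| * |Real.log τ + ((2 : ℕ) : ℝ) * Real.log q|
      ≤ |s.re| * (3 * Real.log (2 * (τ + τ⁻¹))) := mul_le_mul_of_nonneg_left h4 (abs_nonneg _)
    _ = _ := by ring

/-- The integrand of the period integral is dominated uniformly in `t`. -/
theorem exists_etaPullback_le (hu : u ∈ cuspForms ρ k s) :
    ∃ a C : ℝ, 0 < a ∧ ∀ (t : OnePoint ℝ) (τ : ℝ), 0 < τ →
      ‖etaPullback k s u ((0 : ℚ) : OnePoint ℚ) OnePoint.infty t τ‖ ≤ C * Real.exp (-a * τ) := by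
  obtain ⟨a, C, ha, hC, h⟩ := exists_decay_imPt hu
  obtain ⟨D, hD, hlog⟩ := exists_exp_log_le (σ := 3 * |s.re| + 1) (D := 2) (by positivity)
    two_pos (half_pos ha)
  refine ⟨a / 2, D * (C * (1 + ‖s + (k : ℂ) / 2‖)), half_pos ha, fun t τ hτ => ?_⟩
  have hti : 0 < τ⁻¹ := inv_pos.2 hτ
  have hh := one_le_add_inv hτ
  obtain ⟨h1, h2⟩ := h τ hτ
  rw [etaPullback_zero_infty t hτ, ← coe_imPt τ hτ]
  refine (norm_wirt_apply_le _ _ _).trans ?_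
  rw [Complex.norm_I, mul_one, lift_coe, norm_smul, norm_smul, norm_mul, norm_poissonLogZbar,
    imPt_im, coe_imPt]
  set H := τ + τ⁻¹ with hH
  have h3 : ‖poissonKernel s k t (imPt τ hτ)‖ * (2 * H) ≤ D * Real.exp (a / 2 * H) := by
    refine le_trans ?_ (hlog H (by linarith))
    have e : Real.exp ((3 * |s.re| + 1) * Real.log (2 * H)) =
        Real.exp (3 * |s.re| * Real.log (2 * H)) * (2 * H) := by
      rw [add_mul, one_mul, Real.exp_add, Real.exp_log (by linarith)]
    rw [e]
    exact mul_le_mul_of_nonneg_right (norm_poissonKernel_imPt_le t hτ) (by linarith)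
  set R := ‖poissonKernel s k t (imPt τ hτ)‖
  have hR : 0 ≤ R := norm_nonneg _
  have h4 : ‖s + (k : ℂ) / 2‖ / (2 * τ) ≤ ‖s + (k : ℂ) / 2‖ * (2 * H) := by
    rw [div_eq_mul_inv, mul_inv]
    refine mul_le_mul_of_nonneg_left ?_ (norm_nonneg _)
    rw [hH]; linarith
  have e1 : Real.exp (-a * H) * Real.exp (a / 2 * H) = Real.exp (-(a / 2) * H) := by
    rw [← Real.exp_add]; congr 1; ring
  calc R * ‖covD k u (Complex.I * τ)‖ +
        R * (‖s + (k : ℂ) / 2‖ / (2 * τ)) * ‖lift u (Complex.I * τ)‖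
      ≤ R * (C * Real.exp (-a * H)) +
        R * (‖s + (k : ℂ) / 2‖ * (2 * H)) * (C * Real.exp (-a * H)) := by gcongr
    _ ≤ R * (2 * H) * (C * Real.exp (-a * H)) +
        R * (‖s + (k : ℂ) / 2‖ * (2 * H)) * (C * Real.exp (-a * H)) := by
        gcongr
        exact le_mul_of_one_le_right hR (by linarith)
    _ = (R * (2 * H)) * (C * (1 + ‖s + (k : ℂ) / 2‖) * Real.exp (-a * H)) := by ring
    _ ≤ (D * Real.exp (a / 2 * H)) * (C * (1 + ‖s + (k : ℂ) / 2‖) * Real.exp (-a * H)) := by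
        gcongr
    _ = D * (C * (1 + ‖s + (k : ℂ) / 2‖)) * (Real.exp (-a * H) * Real.exp (a / 2 * H)) := by ring
    _ = D * (C * (1 + ‖s + (k : ℂ) / 2‖)) * Real.exp (-(a / 2) * H) := by rw [e1]
    _ ≤ _ := by
        refine mul_le_mul_of_nonneg_left (Real.exp_le_exp.2 ?_) (by positivity)
        rw [hH]; nlinarith

theorem continuous_crossQuot_left (p : ℂ) {q : ℂ} (hq : q.im ≠ 0) :
    Continuous fun t : OnePoint ℝ => crossQuot t p q := by
  rw [OnePoint.continuous_iff]
  have hne := fun x : ℝ => ofReal_sub_ne_zero x hq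
  constructor
  · simp only [crossQuot_infty, crossQuot_coe]
    have h1 : Tendsto (fun x : ℝ => ((x : ℂ) - q)⁻¹) (coclosedCompact ℝ) (𝓝 0) := by
      rw [coclosedCompact_eq_cocompact]
      refine tendsto_inv₀_cobounded.comp ?_
      rw [← Metric.cobounded_eq_cocompact]
      have : Tendsto (fun x : ℝ => (x : ℂ)) (Bornology.cobounded ℝ) (Bornology.cobounded ℂ) := by
        rw [← tendsto_norm_atTop_iff_cobounded]
        exact (tendsto_norm_cobounded_atTop (E := ℝ)).congr fun x => by simp
      rw [← tendsto_norm_atTop_iff_cobounded] at this ⊢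
      refine tendsto_atTop_mono (fun x => ?_) (tendsto_atTop_add_const_right _ (-‖q‖) this)
      have := norm_sub_norm_le (x : ℂ) q
      linarith
    have h2 : Tendsto (fun x : ℝ => 1 + (q - p) * ((x : ℂ) - q)⁻¹) (coclosedCompact ℝ)
        (𝓝 (1 + (q - p) * 0)) := tendsto_const_nhds.add (h1.const_mul _)
    rw [mul_zero, add_zero] at h2
    refine h2.congr fun x => ?_
    have := hne x
    field_simp
    ring
  · simp only [crossQuot_coe]
    exact Continuous.div (by fun_prop) (by fun_prop) hne

theorem continuous_crossQuot_cpow (z : ℍ) (α : ℂ) :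
    Continuous fun t : OnePoint ℝ => crossQuot t Complex.I (z : ℂ) ^ α :=
  (continuous_crossQuot_left Complex.I z.im_pos.ne').cpow continuous_const fun t =>
    crossQuot_mem_slitPlane t z

theorem continuous_crossQuot_conj_cpow (z : ℍ) (α : ℂ) :
    Continuous fun t : OnePoint ℝ =>
      crossQuot t (-Complex.I) (starRingEnd ℂ (z : ℂ)) ^ α := by
  have hI : (-Complex.I) = starRingEnd ℂ Complex.I := by simp
  simp only [hI, crossQuot_conj]
  refine (Complex.continuous_conj.comp
    (continuous_crossQuot_left Complex.I z.im_pos.ne')).cpow continuous_const fun t => ?_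
  have := crossQuot_mem_slitPlane t z
  rw [Complex.mem_slitPlane_iff] at this ⊢
  simpa using this

theorem continuous_etaPullback_left {τ : ℝ} (hτ : 0 < τ) :
    Continuous fun t => etaPullback k s u ((0 : ℚ) : OnePoint ℚ) OnePoint.infty t τ := by
  simp only [fun t => etaPullback_zero_infty (k := k) (s := s) (u := u) t hτ]
  have hz := coe_imPt τ hτ
  rw [← hz]
  set z := imPt τ hτ
  have hc : (starRingEnd ℂ (z : ℂ)).im ≠ 0 := by simpa using z.im_pos.ne'
  have h2 := continuous_crossQuot_left (z : ℂ) (q := starRingEnd ℂ (z : ℂ)) hc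
  have hR : Continuous fun t => poissonKernel s k t z :=
    (continuous_const.mul (continuous_crossQuot_cpow z _)).mul (continuous_crossQuot_conj_cpow z _)
  have hL : Continuous fun t => poissonLogZbar s k t z := by
    simp only [poissonLogZbar_eq]
    exact continuous_const.mul h2
  simp only [greenCLM, wirt_apply, lift_coe]
  exact ((hR.smul continuous_const).const_smul _).add
    (((hR.mul hL).smul continuous_const).const_smul _)

/-- Dominated convergence with a majorant independent of `t`, applied along countably generated
filters on `ℝ`, to which continuity on `P¹(ℝ)` reduces. -/
theorem continuous_periodIntegral [CompleteSpace V] (hu : u ∈ cuspForms ρ k s) :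
    Continuous (periodIntegral k s u) := by
  obtain ⟨a, C, ha, hb⟩ := exists_etaPullback_le hu
  have hint : MeasureTheory.IntegrableOn (fun τ : ℝ => C * Real.exp (-a * τ)) (Set.Ioi 0) :=
    (exp_neg_integrableOn_Ioi 0 ha).const_mul C
  have key : ∀ (l : Filter ℝ) [l.IsCountablyGenerated] (t₀ : OnePoint ℝ),
      Tendsto (fun x : ℝ => (x : OnePoint ℝ)) l (𝓝 t₀) →
      Tendsto (fun x : ℝ => periodIntegral k s u (x : OnePoint ℝ)) l
        (𝓝 (periodIntegral k s u t₀)) := by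
    intro l _ t₀ hl
    refine MeasureTheory.tendsto_integral_filter_of_dominated_convergence
      (fun τ : ℝ => C * Real.exp (-a * τ)) ?_ ?_ hint ?_
    · exact Eventually.of_forall fun x => (integrableOn_etaPullback hu _ _ _).aestronglyMeasurable
    · refine Eventually.of_forall fun x => ?_
      exact (MeasureTheory.ae_restrict_iff' measurableSet_Ioi).2
        (Eventually.of_forall fun τ hτ => hb x τ hτ)
    · refine (MeasureTheory.ae_restrict_iff' measurableSet_Ioi).2
        (Eventually.of_forall fun τ hτ => ?_)
      exact ((continuous_etaPullback_left hτ).tendsto t₀).comp hl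
  rw [OnePoint.continuous_iff]
  constructor
  · have : (coclosedCompact ℝ).IsCountablyGenerated := by
      rw [coclosedCompact_eq_cocompact, cocompact_eq_atBot_atTop]
      infer_instance
    exact key _ _ OnePoint.tendsto_coe_infty
  · exact continuous_iff_continuousAt.2 fun x => key _ _ (OnePoint.continuous_coe.tendsto x)

end MaassPeriod

end

noncomputable section

namespace MaassPeriod

open Filter Topology Complex

variable {V : Type*} [NormedAddCommGroup V] [InnerProductSpace ℂ V]

/-! ### Holomorphic dependence of integrals on a parameter -/

/-- A locally uniform majorant of the functions alone suffices: Cauchy's estimate bounds the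
derivative by `g / ε`, and the derivative is measurable as a limit of difference quotients. -/
theorem differentiableOn_integral_of_dominated {E α : Type*} [NormedAddCommGroup E]
    [NormedSpace ℂ E] [CompleteSpace E] [MeasurableSpace α] {μ : MeasureTheory.Measure α}
    {K : ℂ → α → E} {U : Set ℂ} (hU : IsOpen U)
    (hmeas : ∀ ζ ∈ U, MeasureTheory.AEStronglyMeasurable (K ζ) μ)
    (hdiff : ∀ᵐ τ ∂μ, DifferentiableOn ℂ (fun ζ => K ζ τ) U)
    (hbound : ∀ ζ₀ ∈ U, ∃ r : ℝ, 0 < r ∧ ∃ g : α → ℝ, MeasureTheory.Integrable g μ ∧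
      ∀ᵐ τ ∂μ, ∀ ζ ∈ Metric.closedBall ζ₀ r, ‖K ζ τ‖ ≤ g τ) :
    DifferentiableOn ℂ (fun ζ => ∫ τ, K ζ τ ∂μ) U := by
  intro ζ₀ hζ₀
  obtain ⟨r, hr, g, hg, hb⟩ := hbound ζ₀ hζ₀
  obtain ⟨r', hr', hball⟩ := Metric.isOpen_iff.1 hU ζ₀ hζ₀
  set ε := min r r' / 4 with hε
  have hm : 0 < min r r' := lt_min hr hr'
  have hε0 : 0 < ε := by positivity
  have hsub : ∀ ζ ∈ Metric.closedBall ζ₀ (2 * ε), ζ ∈ U ∧ ζ ∈ Metric.closedBall ζ₀ r := by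
    intro ζ hζ
    rw [Metric.mem_closedBall] at hζ
    have h1 : min r r' ≤ r := min_le_left _ _
    have h2 : min r r' ≤ r' := min_le_right _ _
    exact ⟨hball (Metric.mem_ball.2 (by linarith)), Metric.mem_closedBall.2 (by linarith)⟩
  have hderiv : ∀ᵐ τ ∂μ, ∀ ζ ∈ Metric.ball ζ₀ ε,
      HasDerivAt (fun ζ => K ζ τ) (deriv (fun ζ => K ζ τ) ζ) ζ := by
    filter_upwards [hdiff] with τ hτ ζ hζ
    have hζU := (hsub ζ (Metric.mem_closedBall.2 (by have := Metric.mem_ball.1 hζ; linarith))).1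
    exact ((hτ ζ hζU).differentiableAt (hU.mem_nhds hζU)).hasDerivAt
  refine (hasDerivAt_integral_of_dominated_loc_of_deriv_le (F := K)
    (F' := fun ζ τ => deriv (fun ζ => K ζ τ) ζ) (bound := fun τ => g τ / ε)
    (Metric.ball_mem_nhds ζ₀ hε0) ?_ ?_ ?_ ?_ (hg.div_const ε)
    hderiv).2.differentiableAt.differentiableWithinAt
  · filter_upwards [hU.mem_nhds hζ₀] with ζ hζ using hmeas ζ hζ
  · refine hg.mono' (hmeas ζ₀ hζ₀) ?_
    filter_upwards [hb] with τ hτ using hτ ζ₀ (Metric.mem_closedBall_self hr.le)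
  · have hlim : ∀ᵐ τ ∂μ, Tendsto (fun n : ℕ => ((ε / 2 / ((n : ℝ) + 1) : ℝ) : ℂ)⁻¹ •
        (K (ζ₀ + ((ε / 2 / ((n : ℝ) + 1) : ℝ) : ℂ)) τ - K ζ₀ τ)) atTop
        (𝓝 (deriv (fun ζ => K ζ τ) ζ₀)) := by
      filter_upwards [hderiv] with τ hτ
      have h1 := (hτ ζ₀ (Metric.mem_ball_self hε0)).tendsto_slope_zero
      refine h1.comp (tendsto_nhdsWithin_iff.2 ⟨?_, Eventually.of_forall fun n => ?_⟩)
      · have h2 : Tendsto (fun n : ℕ => ε / 2 / ((n : ℝ) + 1)) atTop (𝓝 0) := by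
          have := (tendsto_one_div_add_atTop_nhds_zero_nat (𝕜 := ℝ)).const_mul (ε / 2)
          simpa [div_eq_mul_inv] using this
        exact (Complex.continuous_ofReal.tendsto' 0 0 (by simp)).comp h2
      · simp only [Set.mem_compl_iff, Set.mem_singleton_iff, Complex.ofReal_eq_zero]
        positivity
    refine aestronglyMeasurable_of_tendsto_ae atTop (fun n => ?_) hlim
    refine MeasureTheory.AEStronglyMeasurable.const_smul
      (MeasureTheory.AEStronglyMeasurable.sub (hmeas _ (hsub _ ?_).1) (hmeas ζ₀ hζ₀)) _
    have hn : (0 : ℝ) < (n : ℝ) + 1 := by positivity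
    rw [mem_closedBall_iff_norm, add_sub_cancel_left, Complex.norm_real,
      Real.norm_of_nonneg (by positivity), div_le_iff₀ hn]
    nlinarith
  · filter_upwards [hb, hdiff] with τ hτ hd ζ hζ
    have hζ' := Metric.mem_ball.1 hζ
    have hin : ∀ w ∈ Metric.closedBall ζ ε, w ∈ Metric.closedBall ζ₀ (2 * ε) := fun w hw => by
      rw [Metric.mem_closedBall] at hw ⊢
      have := dist_triangle w ζ ζ₀
      linarith
    refine Complex.norm_deriv_le_of_forall_mem_sphere_norm_le hε0 ?_ fun w hw =>
      hτ w (hsub w (hin w (Metric.sphere_subset_closedBall hw))).2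
    refine DifferentiableOn.diffContOnCl ?_
    rw [closure_ball ζ hε0.ne']
    exact hd.mono fun w hw => (hsub w (hin w hw)).1

/-! ### The holomorphic extension of the period integral -/

/-- The imaginary part is `Re ζ · (b - a)` over a positive number, and for `a = b` the quotient is
`1`. The branch cuts of the powers, as sets of `ζ`, therefore lie on the imaginary axis. -/
theorem quot_mem_slitPlane {ζ : ℂ} (hζ : ζ.re ≠ 0) (a b : ℝ) :
    (ζ - Complex.I * a) / (ζ - Complex.I * b) ∈ Complex.slitPlane := by
  have hn : 0 < normSq (ζ - Complex.I * b) := by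
    refine normSq_pos.2 fun h => hζ ?_
    have := congrArg Complex.re h
    simpa using this
  have hre : (ζ - Complex.I * a).re = ζ.re ∧ (ζ - Complex.I * b).re = ζ.re := by simp
  have him : (ζ - Complex.I * a).im = ζ.im - a ∧ (ζ - Complex.I * b).im = ζ.im - b := by simp
  rw [Complex.mem_slitPlane_iff]
  by_cases hab : a = b
  · left
    subst hab
    rw [div_self (normSq_pos.1 hn)]
    simp
  · right
    rw [Complex.div_im, hre.1, hre.2, him.1, him.2, ← sub_div]
    refine div_ne_zero ?_ hn.ne'
    have : (ζ.im - a) * ζ.re - ζ.re * (ζ.im - b) = ζ.re * (b - a) := by ring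
    rw [this]
    exact mul_ne_zero hζ (sub_ne_zero.2 (Ne.symm hab))

theorem norm_cpow_le_exp {w : ℂ} (hw : w ≠ 0) (c : ℂ) {l : ℝ} (hl : |Real.log ‖w‖| ≤ l) :
    ‖w ^ c‖ ≤ Real.exp (|c.re| * l + Real.pi * |c.im|) := by
  rw [Complex.cpow_def_of_ne_zero hw, Complex.norm_exp, Complex.mul_re, Complex.log_re,
    Complex.log_im]
  refine Real.exp_le_exp.2 ?_
  have h1 : Real.log ‖w‖ * c.re ≤ |c.re| * l := by
    refine (le_abs_self _).trans ?_
    rw [abs_mul, mul_comm]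
    exact mul_le_mul_of_nonneg_left hl (abs_nonneg _)
  have h2 : -(w.arg * c.im) ≤ Real.pi * |c.im| := by
    refine (neg_le_abs _).trans ?_
    rw [abs_mul]
    exact mul_le_mul_of_nonneg_right (Complex.abs_arg_le_pi w) (abs_nonneg _)
  linarith

/-- Numerator and denominator both have modulus between `ε` and `(M + 1) H`, so the quotient and its
inverse obey the same bound. -/
theorem abs_log_norm_quot_le {ζ : ℂ} {M ε : ℝ} (hε : 0 < ε) (h1 : ε ≤ |ζ.re|) (h2 : ‖ζ‖ ≤ M)
    {a b H : ℝ} (ha : |a| ≤ H) (hb : |b| ≤ H) (hH : 1 ≤ H) :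
    |Real.log ‖(ζ - Complex.I * a) / (ζ - Complex.I * b)‖| ≤ Real.log ((M + 1) / ε * H) := by
  have hM : 0 ≤ M := (norm_nonneg _).trans h2
  have hlow : ∀ c : ℝ, ε ≤ ‖ζ - Complex.I * c‖ := fun c => by
    refine h1.trans ?_
    have := Complex.abs_re_le_norm (ζ - Complex.I * c)
    simpa using this
  have hup : ∀ c : ℝ, |c| ≤ H → ‖ζ - Complex.I * c‖ ≤ (M + 1) * H := fun c hc => by
    refine (norm_sub_le _ _).trans ?_
    rw [norm_mul, Complex.norm_I, one_mul, Complex.norm_real, Real.norm_eq_abs]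
    nlinarith
  have pa := hε.trans_le (hlow a)
  have pb := hε.trans_le (hlow b)
  have key : ∀ x y : ℝ, 0 < x → ε ≤ y → x ≤ (M + 1) * H →
      Real.log (x / y) ≤ Real.log ((M + 1) / ε * H) := fun x y hx hy hxH => by
    refine Real.log_le_log (div_pos hx (hε.trans_le hy)) ?_
    rw [div_mul_eq_mul_div]
    exact div_le_div₀ (by positivity) hxH hε hy
  rw [norm_div]
  refine abs_le.2 ⟨?_, key _ _ pa (hlow b) (hup a ha)⟩
  rw [neg_le, ← Real.log_inv, inv_div]
  exact key _ _ pb (hlow a) (hup b hb)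

variable {ρ : SL(2, ℤ) →* (V ≃ₗᵢ[ℂ] V)} {k : ℝ} {s : ℂ} {u : ℍ → V}

/-- The Poisson kernel at `iτ`, extended holomorphically in the boundary variable. -/
def extPoisson (s : ℂ) (k : ℝ) (ζ : ℂ) (τ : ℝ) : ℂ :=
  (τ : ℂ) ^ s * ((ζ - Complex.I * (1 : ℝ)) / (ζ - Complex.I * τ)) ^ (s - (k : ℂ) / 2) *
    ((ζ - Complex.I * (-1 : ℝ)) / (ζ - Complex.I * (-τ : ℝ))) ^ (s + (k : ℂ) / 2)

/-- The integrand of the period integral, extended holomorphically in the boundary variable. -/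
def extKernel (s : ℂ) (k : ℝ) (u : ℍ → V) (ζ : ℂ) (τ : ℝ) : V :=
  extPoisson s k ζ τ • (Complex.I • covD k u (Complex.I * τ) -
    (Complex.I * ((s + (k : ℂ) / 2) * (1 / (ζ - Complex.I * (-τ : ℝ)) -
      1 / (2 * Complex.I * τ)))) • lift u (Complex.I * τ))

theorem extKernel_ofReal (x : ℝ) {τ : ℝ} (hτ : 0 < τ) :
    extKernel s k u (x : ℂ) τ =
      etaPullback k s u ((0 : ℚ) : OnePoint ℚ) OnePoint.infty (x : OnePoint ℝ) τ := by
  rw [etaPullback_zero_infty _ hτ, greenCLM, wirt_apply, ← coe_imPt τ hτ, lift_coe, poissonKernel,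
    imPt_im, crossQuot_coe, crossQuot_coe, coe_imPt, poissonLogZbar, extKernel, extPoisson]
  have h1 : starRingEnd ℂ (Complex.I * (τ : ℂ)) = Complex.I * ((-τ : ℝ) : ℂ) := by simp
  have h2 : (Complex.I * (τ : ℂ)).im = τ := by simp
  have h3 : bdInv (x : OnePoint ℝ) (Complex.I * ((-τ : ℝ) : ℂ)) =
    1 / ((x : ℂ) - Complex.I * ((-τ : ℝ) : ℂ)) := rfl
  have h4 : Complex.I * ((1 : ℝ) : ℂ) = Complex.I := by simp
  have h5 : Complex.I * ((-1 : ℝ) : ℂ) = -Complex.I := by simp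
  rw [h1, h2, h3, h4, h5, Complex.conj_I]
  module

theorem sub_I_mul_ne_zero {ζ : ℂ} (hζ : ζ.re ≠ 0) (b : ℝ) : ζ - Complex.I * b ≠ 0 := by
  intro h
  have := congrArg Complex.re h
  simp at this
  exact hζ this

theorem differentiableOn_extKernel (τ : ℝ) :
    DifferentiableOn ℂ (fun ζ => extKernel s k u ζ τ) {ζ | ζ.re ≠ 0} := by
  intro ζ hζ
  have hne := sub_I_mul_ne_zero hζ
  have hq : ∀ a b : ℝ, DifferentiableAt ℂ (fun ζ : ℂ => (ζ - Complex.I * a) / (ζ - Complex.I * b))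
      ζ := fun a b => (by fun_prop : DifferentiableAt ℂ (fun ζ : ℂ => ζ - Complex.I * a) ζ).div
        (by fun_prop) (hne b)
  refine DifferentiableAt.differentiableWithinAt ?_
  unfold extKernel extPoisson
  refine DifferentiableAt.smul (((differentiableAt_const _).mul ((hq _ _).cpow
    (differentiableAt_const _) (quot_mem_slitPlane hζ _ _))).mul ((hq _ _).cpow
    (differentiableAt_const _) (quot_mem_slitPlane hζ _ _))) ?_
  refine (differentiableAt_const _).sub (DifferentiableAt.smul_const ?_ _)
  have h1 : DifferentiableAt ℂ (fun ζ : ℂ => 1 / (ζ - Complex.I * (-τ : ℝ))) ζ :=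
    (differentiableAt_const _).div (by fun_prop) (hne _)
  exact ((h1.sub_const _).const_mul _).const_mul _

theorem continuousOn_extKernel (hu : u ∈ cuspForms ρ k s) {ζ : ℂ} (hζ : ζ.re ≠ 0) :
    ContinuousOn (extKernel s k u ζ) (Set.Ioi 0) := by
  intro τ hτ
  have hτ0 : 0 < τ := hτ
  have hτC : (τ : ℂ) ≠ 0 := by exact_mod_cast hτ0.ne'
  refine ContinuousAt.continuousWithinAt ?_
  have him : 0 < (Complex.I * (τ : ℂ)).im := by simpa using hτ0
  have hc : ContinuousAt (fun τ : ℝ => Complex.I * (τ : ℂ)) τ := by fun_prop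
  have h1 : ContinuousAt (fun τ : ℝ => lift u (Complex.I * τ)) τ :=
    ContinuousAt.comp (f := fun τ : ℝ => Complex.I * (τ : ℂ)) (g := lift u)
      (hu.1 ⟨_, him⟩).continuousAt hc
  have h2 : ContinuousAt (fun τ : ℝ => covD k u (Complex.I * τ)) τ :=
    ContinuousAt.comp (f := fun τ : ℝ => Complex.I * (τ : ℂ)) (g := covD k u)
      (continuousAt_covD hu.1 him) hc
  have hne := sub_I_mul_ne_zero hζ
  have h3 : ContinuousAt (fun τ : ℝ => (ζ - Complex.I * (1 : ℝ)) / (ζ - Complex.I * τ)) τ :=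
    continuousAt_const.div (by fun_prop) (hne τ)
  have h4 : ContinuousAt
      (fun τ : ℝ => (ζ - Complex.I * (-1 : ℝ)) / (ζ - Complex.I * (-τ : ℝ))) τ :=
    continuousAt_const.div (by fun_prop) (hne (-τ))
  have h5 : ContinuousAt (fun τ : ℝ => (τ : ℂ) ^ s) τ :=
    (Complex.continuous_ofReal.continuousAt).cpow continuousAt_const (Or.inl (by simpa using hτ0))
  have h6 : ContinuousAt (fun τ : ℝ => 1 / (ζ - Complex.I * (-τ : ℝ))) τ :=
    continuousAt_const.div (by fun_prop) (hne (-τ))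
  have h7 : ContinuousAt (fun τ : ℝ => 1 / (2 * Complex.I * (τ : ℂ))) τ :=
    continuousAt_const.div (by fun_prop) (by simp [hτC])
  unfold extKernel extPoisson
  refine ContinuousAt.smul ((h5.mul (h3.cpow continuousAt_const
    (quot_mem_slitPlane hζ _ _))).mul (h4.cpow continuousAt_const
    (quot_mem_slitPlane hζ _ _))) ?_
  exact (h2.const_smul _).sub
    (ContinuousAt.smul (continuousAt_const.mul (continuousAt_const.mul (h6.sub h7))) h1)

theorem norm_extPoisson_le {ζ : ℂ} {M ε : ℝ} (hε : 0 < ε) (h1 : ε ≤ |ζ.re|) (h2 : ‖ζ‖ ≤ M)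
    {τ : ℝ} (hτ : 0 < τ) :
    ‖extPoisson s k ζ τ‖ ≤ Real.exp (2 * Real.pi * |s.im|) * Real.exp
      ((|s.re| + |(s - (k : ℂ) / 2).re| + |(s + (k : ℂ) / 2).re|) *
        Real.log ((M + 1) / ε * (τ + τ⁻¹))) := by
  have hζ : ζ.re ≠ 0 := by
    intro h; rw [h, abs_zero] at h1; linarith
  have hti : 0 < τ⁻¹ := inv_pos.2 hτ
  have hH := one_le_add_inv hτ
  set H := τ + τ⁻¹ with hHd
  set l := Real.log ((M + 1) / ε * H) with hl
  have hτH : |τ| ≤ H := by rw [abs_of_pos hτ, hHd]; linarith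
  have q1 := abs_log_norm_quot_le hε h1 h2 (a := 1) (b := τ) (by simpa using hH) hτH hH
  have q2 := abs_log_norm_quot_le hε h1 h2 (a := -1) (b := -τ) (by simpa using hH)
    (by simpa using hτH) hH
  have hne := sub_I_mul_ne_zero hζ
  have b1 := norm_cpow_le_exp (div_ne_zero (hne 1) (hne τ)) (s - (k : ℂ) / 2) q1
  have b2 := norm_cpow_le_exp (div_ne_zero (hne (-1)) (hne (-τ))) (s + (k : ℂ) / 2) q2
  have hM1 : 1 ≤ (M + 1) / ε := by
    rw [one_le_div hε]
    have := (h1.trans (Complex.abs_re_le_norm ζ)).trans h2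
    linarith
  have b3 : ‖(τ : ℂ) ^ s‖ ≤ Real.exp (|s.re| * l) := by
    rw [Complex.norm_cpow_eq_rpow_re_of_pos hτ, Real.rpow_def_of_pos hτ]
    refine Real.exp_le_exp.2 ((le_abs_self _).trans ?_)
    rw [abs_mul, mul_comm]
    refine mul_le_mul_of_nonneg_left ((abs_log_le_log_add_inv hτ).trans ?_) (abs_nonneg _)
    refine Real.log_le_log (by linarith) ?_
    nlinarith
  have i1 : (s - (k : ℂ) / 2).im = s.im := by simp
  have i2 : (s + (k : ℂ) / 2).im = s.im := by simp
  rw [i1] at b1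
  rw [i2] at b2
  rw [extPoisson, norm_mul, norm_mul]
  refine (mul_le_mul (mul_le_mul b3 b1 (norm_nonneg _) (Real.exp_nonneg _)) b2 (norm_nonneg _)
    (by positivity)).trans (le_of_eq ?_)
  rw [← Real.exp_add, ← Real.exp_add, ← Real.exp_add]
  congr 1
  ring

/-- On this region the kernel grows at most like a power of `τ + τ⁻¹`, against exponential decay of
`u` and `covD k u`. A quarter of the exponent pays for the kernel, another quarter for the single
factor `τ + τ⁻¹`, and half remains. -/
theorem exists_extKernel_le (hu : u ∈ cuspForms ρ k s) {M ε : ℝ} (hε : 0 < ε) (hM : 0 ≤ M) :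
    ∃ a C : ℝ, 0 < a ∧ ∀ ζ : ℂ, ε ≤ |ζ.re| → ‖ζ‖ ≤ M → ∀ τ : ℝ, 0 < τ →
      ‖extKernel s k u ζ τ‖ ≤ C * Real.exp (-a * τ) := by
  obtain ⟨a, C, ha, hC, h⟩ := exists_decay_imPt hu
  set N := |s.re| + |(s - (k : ℂ) / 2).re| + |(s + (k : ℂ) / 2).re| with hN
  have hN0 : 0 ≤ N := by positivity
  set W := Real.exp (2 * Real.pi * |s.im|) with hW
  have hW0 : 0 < W := Real.exp_pos _
  obtain ⟨D, hD, hlog⟩ := exists_exp_log_le (σ := N) (D := (M + 1) / ε) hN0 (by positivity)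
    (by positivity : 0 < a / 4)
  obtain ⟨D', hD', hlog'⟩ := exists_exp_log_le (σ := 1) (D := 1) zero_le_one one_pos
    (by positivity : 0 < a / 4)
  set q := ‖s + (k : ℂ) / 2‖ with hq
  have hq0 : 0 ≤ q := norm_nonneg _
  refine ⟨a / 2, W * D * (D' * ((1 + q * (1 / ε + 1)) * C)), by positivity,
    fun ζ h1 h2 τ hτ => ?_⟩
  have hti : 0 < τ⁻¹ := inv_pos.2 hτ
  have hH := one_le_add_inv hτ
  obtain ⟨e1, e2⟩ := h τ hτ
  have e3 := norm_extPoisson_le (s := s) (k := k) hε h1 h2 hτ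
  set H := τ + τ⁻¹ with hHd
  have e4 := hlog H (by linarith)
  have e5 : H ≤ D' * Real.exp (a / 4 * H) := by
    have := hlog' H (by linarith)
    rwa [one_mul, one_mul, Real.exp_log (by linarith)] at this
  have hR : ‖extPoisson s k ζ τ‖ ≤ W * (D * Real.exp (a / 4 * H)) :=
    e3.trans (mul_le_mul_of_nonneg_left e4 hW0.le)
  have hden : ‖1 / (ζ - Complex.I * (-τ : ℝ)) - 1 / (2 * Complex.I * τ)‖ ≤ (1 / ε + 1) * H := by
    have d1 : ‖1 / (ζ - Complex.I * (-τ : ℝ))‖ ≤ 1 / ε := by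
      rw [norm_div, norm_one]
      refine one_div_le_one_div_of_le hε (h1.trans ?_)
      have := Complex.abs_re_le_norm (ζ - Complex.I * (-τ : ℝ))
      simpa using this
    have d2 : ‖1 / (2 * Complex.I * (τ : ℂ))‖ ≤ H := by
      rw [norm_div, norm_mul, norm_mul, Complex.norm_I, norm_one, Complex.norm_real,
        Real.norm_of_nonneg hτ.le, mul_one, Complex.norm_two, one_div, mul_inv, hHd]
      linarith
    refine (norm_sub_le _ _).trans ((add_le_add d1 d2).trans ?_)
    have : 1 / ε ≤ 1 / ε * H := le_mul_of_one_le_right (by positivity) hH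
    linarith
  set E := Real.exp (-a * H)
  have hvec : ‖Complex.I • covD k u (Complex.I * τ) -
      (Complex.I * ((s + (k : ℂ) / 2) * (1 / (ζ - Complex.I * (-τ : ℝ)) -
      1 / (2 * Complex.I * τ)))) • lift u (Complex.I * τ)‖ ≤
      H * ((1 + q * (1 / ε + 1)) * C) * E := by
    refine (norm_sub_le _ _).trans ?_
    rw [norm_smul, norm_smul, Complex.norm_I, one_mul, norm_mul, Complex.norm_I, one_mul, norm_mul,
      ← hq]
    calc ‖covD k u (Complex.I * τ)‖ + q * ‖1 / (ζ - Complex.I * (-τ : ℝ)) -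
          1 / (2 * Complex.I * τ)‖ * ‖lift u (Complex.I * τ)‖
        ≤ C * E + q * ((1 / ε + 1) * H) * (C * E) := by gcongr
      _ ≤ H * (C * E) + q * ((1 / ε + 1) * H) * (C * E) := by
          exact add_le_add (le_mul_of_one_le_left (by positivity) hH) le_rfl
      _ = _ := by ring
  rw [extKernel, norm_smul]
  have e6 : Real.exp (a / 4 * H) * Real.exp (a / 4 * H) * E = Real.exp (-(a / 2) * H) := by
    rw [← Real.exp_add, ← Real.exp_add]; congr 1; ring
  set G := Real.exp (a / 4 * H)
  have hG : 0 < G := Real.exp_pos _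
  calc _ ≤ W * (D * G) * (H * ((1 + q * (1 / ε + 1)) * C) * E) := by gcongr
    _ ≤ W * (D * G) * (D' * G * ((1 + q * (1 / ε + 1)) * C) * E) := by gcongr
    _ = W * D * (D' * ((1 + q * (1 / ε + 1)) * C)) * (G * G * E) := by ring
    _ ≤ _ := by
      rw [e6]
      refine mul_le_mul_of_nonneg_left (Real.exp_le_exp.2 ?_) (by positivity)
      rw [hHd]; nlinarith

theorem isOpen_re_ne_zero : IsOpen {ζ : ℂ | ζ.re ≠ 0} :=
  isOpen_ne_fun Complex.continuous_re continuous_const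

/-- The holomorphic extension of the period integral to `ℂ ∖ iℝ`. -/
def extPeriod (s : ℂ) (k : ℝ) (u : ℍ → V) (ζ : ℂ) : V :=
  ∫ τ in Set.Ioi (0 : ℝ), extKernel s k u ζ τ

theorem extPeriod_ofReal (x : ℝ) :
    extPeriod s k u (x : ℂ) = periodIntegral k s u (x : OnePoint ℝ) :=
  MeasureTheory.setIntegral_congr_fun measurableSet_Ioi fun _ hτ => extKernel_ofReal x hτ

theorem differentiableOn_extPeriod [CompleteSpace V] (hu : u ∈ cuspForms ρ k s) :
    DifferentiableOn ℂ (extPeriod s k u) {ζ | ζ.re ≠ 0} := by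
  refine differentiableOn_integral_of_dominated isOpen_re_ne_zero
    (fun ζ hζ => (continuousOn_extKernel hu hζ).aestronglyMeasurable measurableSet_Ioi)
    (Eventually.of_forall differentiableOn_extKernel) fun ζ₀ hζ₀ => ?_
  have hr : 0 < |ζ₀.re| / 2 := half_pos (abs_pos.2 hζ₀)
  obtain ⟨a, C, ha, hb⟩ := exists_extKernel_le hu (M := ‖ζ₀‖ + |ζ₀.re| / 2) hr (by positivity)
  refine ⟨|ζ₀.re| / 2, hr, fun τ => C * Real.exp (-a * τ),
    (exp_neg_integrableOn_Ioi 0 ha).const_mul C, ?_⟩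
  refine (MeasureTheory.ae_restrict_iff' measurableSet_Ioi).2
    (Eventually.of_forall fun τ hτ ζ hζ => hb ζ ?_ ?_ τ hτ)
  · rw [mem_closedBall_iff_norm'] at hζ
    have h1 := (Complex.abs_re_le_norm (ζ₀ - ζ)).trans hζ
    have h2 := abs_sub_abs_le_abs_sub ζ₀.re ζ.re
    rw [Complex.sub_re] at h1
    linarith
  · rw [mem_closedBall_iff_norm] at hζ
    have := norm_sub_norm_le ζ ζ₀
    linarith

theorem periodIntegral_hasHolomorphicExtension [CompleteSpace V] (hu : u ∈ cuspForms ρ k s) :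
    HasHolomorphicExtension (periodIntegral k s u) :=
  ⟨extPeriod s k u, differentiableOn_extPeriod hu, fun t _ => extPeriod_ofReal t⟩

theorem periodIntegral_analytic [CompleteSpace V] (hu : u ∈ cuspForms ρ k s) :
    AnalyticOffZeroInfty (periodIntegral k s u) := by
  refine ⟨fun t ht => ?_, continuous_periodIntegral hu⟩
  change AnalyticAt ℝ (fun x : ℝ => periodIntegral k s u (x : OnePoint ℝ)) t
  have h1 : AnalyticAt ℂ (extPeriod s k u) (t : ℂ) :=
    (differentiableOn_extPeriod hu).analyticAt (isOpen_re_ne_zero.mem_nhds (by simpa using ht))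
  have h2 : AnalyticAt ℝ (fun x : ℝ => extPeriod s k u (x : ℂ)) t :=
    AnalyticAt.fun_comp (f := fun x : ℝ => (x : ℂ)) h1.restrictScalars
      (Complex.ofRealCLM.analyticAt t)
  simpa only [extPeriod_ofReal] using h2

end MaassPeriod

end

noncomputable section

namespace MaassPeriod

open Filter Topology Complex

variable {V : Type*} [NormedAddCommGroup V] [InnerProductSpace ℂ V]

/-! ### Continuity of the action on the projective line -/

/-- The Cayley transform. Being continuous and injective on a compact space it is an embedding,
through which continuity of maps into `P¹(ℝ)` can be tested. -/
theorem crossQuot_I_injective :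
    Function.Injective fun t : OnePoint ℝ => crossQuot t Complex.I (-Complex.I) := by
  have hne : ∀ x : ℝ, (x : ℂ) - -Complex.I ≠ 0 := fun x => ofReal_sub_ne_zero x (by simp)
  have h1 : ∀ x : ℝ, crossQuot (x : OnePoint ℝ) Complex.I (-Complex.I) ≠ 1 := fun x h => by
    rw [crossQuot_coe, div_eq_one_iff_eq (hne x)] at h
    have := congrArg Complex.im h
    simp at this
    norm_num at this
  intro a b hab
  cases a with
  | infty => cases b with
    | infty => rfl
    | coe y => exact absurd hab.symm (h1 y)
  | coe x => cases b with
    | infty => exact absurd hab (h1 x)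
    | coe y =>
      simp only [crossQuot_coe] at hab
      rw [div_eq_div_iff (hne x) (hne y)] at hab
      have h2 : (2 * Complex.I) * ((x : ℂ) - y) = 0 := by linear_combination hab
      have h3 : (x : ℂ) - y = 0 := by simpa using h2
      have h4 : x = y := by exact_mod_cast sub_eq_zero.1 h3
      rw [h4]

theorem continuous_bdAct (γ : SL(2, ℤ)) : Continuous (bdAct γ) := by
  have hemb := (continuous_crossQuot_left Complex.I (q := -Complex.I)
    (by simp)).isClosedEmbedding crossQuot_I_injective
  rw [hemb.isInducing.continuous_iff]
  set p : ℍ := γ⁻¹ • UpperHalfPlane.I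
  have hp : ((γ • p : ℍ) : ℂ) = Complex.I := by rw [smul_inv_smul]; rfl
  have hj := autFactor_ne_zero γ p
  have hm := smul_mul_autFactor γ p
  rw [hp] at hm
  have hc : (starRingEnd ℂ (p : ℂ)).im ≠ 0 := by simpa using p.im_pos.ne'
  have key : ∀ t, crossQuot (bdAct γ t) Complex.I (-Complex.I) =
      starRingEnd ℂ (autFactor γ p) / autFactor γ p * crossQuot t p (starRingEnd ℂ (p : ℂ)) := by
    intro t
    have := crossQuot_smul γ t (p := p) (q := starRingEnd ℂ (p : ℂ)) (p' := Complex.I)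
      (q' := -Complex.I) (jp := autFactor γ p) (jq := starRingEnd ℂ (autFactor γ p)) hc rfl
      (by simp [autFactor]) hm (by
        have h := congrArg (starRingEnd ℂ) hm
        simpa using h) (by simp) hj ((map_ne_zero _).2 hj)
    field_simp
    linear_combination this
  simp only [Function.comp_def, key]
  exact continuous_const.mul (continuous_crossQuot_left _ hc)

theorem continuous_bdFactor (s : ℂ) (k : ℝ) (γ : SL(2, ℤ)) : Continuous (bdFactor s k γ) := by
  unfold bdFactor intFactor prsFactor
  exact continuous_const.mul ((continuous_const.mul (continuous_crossQuot_cpow _ _)).mul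
    (continuous_crossQuot_conj_cpow _ _))

variable {ρ : SL(2, ℤ) →* (V ≃ₗᵢ[ℂ] V)} {k : ℝ} {s : ℂ} {u : ℍ → V}

theorem continuous_prs {φ : OnePoint ℝ → V} (hφ : Continuous φ) (γ : SL(2, ℤ)) :
    Continuous (prs ρ k s γ φ) :=
  (continuous_bdFactor s k γ).smul
    ((ρ γ⁻¹).continuous.comp (hφ.comp (continuous_bdAct γ)))

/-! ### The action of `S` and `-1` -/

/-- `S` fixes `i`, where the kernel equals `1` for all `t`, so the factor is the inverse of `v_k(S)
e^{ikπ/2}`; this number is `1` by the definition of the multiplier at `i`. Hence `|S` involves only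
`ρ(S)⁻¹` and `t ↦ -1/t`, which explains the shape of the condition `a₀ = -ρ(S) a_∞`. -/
theorem bdFactor_matS (t : OnePoint ℝ) : bdFactor s k matS t = 1 := by
  have hS : matS • UpperHalfPlane.I = UpperHalfPlane.I := by
    have h := matS_smul_imPt 1 one_pos
    have e : ∀ h : (0 : ℝ) < 1, imPt 1 h = UpperHalfPlane.I := fun h => by
      ext; rw [coe_imPt]; simp
    simp only [inv_one, e] at h
    exact h
  have hR : ∀ t, poissonKernel s k t UpperHalfPlane.I = 1 := fun t => by
    rw [poissonKernel_eq_exp]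
    simp [crossQuot_self t (p := Complex.I) (by simp)]
  have h := bdFactor_mul_poissonKernel s k matS t UpperHalfPlane.I
  rw [hS, hR, hR, mul_one] at h
  have hm : mult k matS * phase k matS UpperHalfPlane.I = 1 := by
    have h0 := mult_ne_zero k matS
    rw [mult, hS] at h0 ⊢
    have hη : etaPow k UpperHalfPlane.I ≠ 0 := fun h => h0 (by rw [h]; simp)
    rw [phase, autFactor_matS, UpperHalfPlane.coe_I, Complex.cpow_def_of_ne_zero Complex.I_ne_zero,
      Complex.log_I, Complex.arg_I, div_mul_eq_mul_div, div_eq_one_iff_eq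
        (mul_ne_zero (Complex.exp_ne_zero _) hη), mul_comm]
    congr 2
    push_cast
    ring
  rw [hm, mul_one] at h
  exact h

theorem matS_mul_matS : matS * matS = -1 := by decide

theorem bdFactor_neg_one (t : OnePoint ℝ) : bdFactor s k (-1) t = 1 := by
  rw [← matS_mul_matS, bdFactor_mul, bdFactor_matS, bdFactor_matS, mul_one]

theorem bdAct_neg_one (t : OnePoint ℝ) : bdAct (-1) t = t := by
  cases t with
  | infty => rw [bdAct_infty]; simp
  | coe x => rw [bdAct_coe]; simp

theorem prs_neg_one (φ : OnePoint ℝ → V) (t : OnePoint ℝ) :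
    prs ρ k s (-1) φ t = ρ (-1)⁻¹ (φ t) := by
  rw [prs_apply, bdFactor_neg_one, one_smul, bdAct_neg_one]

theorem prs_matS (φ : OnePoint ℝ → V) (t : OnePoint ℝ) :
    prs ρ k s matS φ t = ρ matS⁻¹ (φ (bdAct matS t)) := by
  rw [prs_apply, bdFactor_matS, one_smul]

theorem bdAct_matS_infty : bdAct matS OnePoint.infty = ((0 : ℝ) : OnePoint ℝ) := by
  rw [bdAct_infty]; simp [matS]

theorem bdAct_matS_zero : bdAct matS ((0 : ℝ) : OnePoint ℝ) = OnePoint.infty := by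
  rw [bdAct_coe]; simp [matS]

theorem bdAct_matS_coe {x : ℝ} (hx : x ≠ 0) :
    bdAct matS (x : OnePoint ℝ) = ((-x⁻¹ : ℝ) : OnePoint ℝ) := by
  rw [bdAct_coe]; simp [matS, hx, neg_div]

theorem bdAct_matT_coe (x : ℝ) : bdAct matT (x : OnePoint ℝ) = ((x + 1 : ℝ) : OnePoint ℝ) := by
  rw [bdAct_coe]; simp [matT]

theorem bdAct_matT'_coe {x : ℝ} (hx : x + 1 ≠ 0) :
    bdAct matT' (x : OnePoint ℝ) = ((x / (x + 1) : ℝ) : OnePoint ℝ) := by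
  rw [bdAct_coe]; simp [matT', hx]

theorem map_mul_inv_apply (γ : SL(2, ℤ)) (v : V) : ρ γ (ρ γ⁻¹ v) = v := by
  rw [map_inv]; exact (ρ γ).apply_symm_apply v

theorem extZero_of_pos {W : Type*} [NormedAddCommGroup W] (f : Set.Ioi (0 : ℝ) → W)
    {t : ℝ} (ht : 0 < t) :
    extZero f (t : OnePoint ℝ) = f ⟨t, ht⟩ := by
  have hinj : Function.Injective fun t : Set.Ioi (0 : ℝ) => ((t : ℝ) : OnePoint ℝ) :=
    fun a b h => Subtype.ext (OnePoint.coe_injective h)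
  exact hinj.extend_apply f 0 ⟨t, ht⟩

/-! ### Restriction of the period integral to the positive half-line -/

theorem re_pos_of_mem_wedge {δ : ℝ} (hδ : δ < Real.pi / 2) {z : ℂ} (hz : z ∈ wedge δ) :
    0 < z.re :=
  (Complex.abs_arg_lt_pi_div_two_iff.1 (hz.2.trans hδ)).resolve_right hz.1

theorem periodIntegral_restrict_mem [CompleteSpace V] (hu : u ∈ cuspForms ρ k s) :
    (fun t : Set.Ioi (0 : ℝ) => periodIntegral k s u ((t : ℝ) : OnePoint ℝ)) ∈
      periodFunctions ρ k s := by
  set f : Set.Ioi (0 : ℝ) → V := fun t => periodIntegral k s u ((t : ℝ) : OnePoint ℝ) with hf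
  have hext : ∀ t : ℝ, 0 < t → extZero f (t : OnePoint ℝ) =
      periodIntegral k s u (t : OnePoint ℝ) := fun t ht => extZero_of_pos f ht
  have hc := continuous_periodIntegral hu
  obtain ⟨hr1, hr2⟩ := periodIntegral_relations hu
  refine ⟨fun t ht => ?_, fun t ht => ?_, fun t ht => ?_,
    ⟨periodIntegral k s u ((0 : ℝ) : OnePoint ℝ), periodIntegral k s u OnePoint.infty, ?_, ?_, ?_⟩,
    Real.pi / 4, by positivity, by linarith [Real.pi_pos], extPeriod s k u, ?_, fun t ht => ?_⟩
  · have h := (periodIntegral_analytic hu).1 t ht.ne'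
    change AnalyticAt ℝ (fun x : ℝ => periodIntegral k s u (x : OnePoint ℝ)) t at h
    refine h.congr ?_
    filter_upwards [lt_mem_nhds ht] with x hx using (hext x hx).symm
  · rw [prs_neg_one, hext t ht, ← prs_neg_one (k := k) (s := s)]
    exact congrFun (periodIntegral_eigen hu) _
  · have ht1 : 0 < t + 1 := by linarith
    rw [prs_apply, prs_apply, bdAct_matT_coe, bdAct_matT'_coe ht1.ne', hext t ht, hext _ ht1,
      hext _ (div_pos ht ht1), ← bdAct_matT_coe, ← bdAct_matT'_coe ht1.ne']
    exact congrFun hr2 _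
  · have h1 : Tendsto (fun x : ℝ => (x : OnePoint ℝ)) atTop (𝓝 OnePoint.infty) := by
      refine OnePoint.tendsto_coe_infty.mono_left ?_
      rw [coclosedCompact_eq_cocompact, cocompact_eq_atBot_atTop]
      exact le_sup_right
    refine ((hc.tendsto _).comp h1).congr' ?_
    filter_upwards [eventually_gt_atTop 0] with x hx using (hext x hx).symm
  · have h1 : Tendsto (fun x : ℝ => (x : OnePoint ℝ)) (𝓝[>] 0) (𝓝 ((0 : ℝ) : OnePoint ℝ)) :=
      (OnePoint.continuous_coe.tendsto 0).mono_left nhdsWithin_le_nhds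
    refine ((hc.tendsto _).comp h1).congr' ?_
    filter_upwards [self_mem_nhdsWithin] with x hx using (hext x hx).symm
  -- The boundary condition is `P(u) = -P(u)|S` evaluated at `∞`, which `S` sends to `0`.
  · have h := congrFun hr1 OnePoint.infty
    rw [Pi.neg_apply, prs_matS, bdAct_matS_infty] at h
    rw [h, map_neg, map_mul_inv_apply, neg_neg]
  · exact (differentiableOn_extPeriod hu).mono fun z hz =>
      (re_pos_of_mem_wedge (by linarith [Real.pi_pos]) hz).ne'
  · rw [hext t ht, extPeriod_ofReal]

theorem covD_add {v : ℍ → V} (hu : IsSmooth u) (hv : IsSmooth v) {z : ℂ} (hz : 0 < z.im) :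
    covD k (u + v) z = covD k u z + covD k v z := by
  have h1 : DifferentiableAt ℝ (lift u) z := (hu ⟨z, hz⟩).differentiableAt (by simp)
  have h2 : DifferentiableAt ℝ (lift v) z := (hv ⟨z, hz⟩).differentiableAt (by simp)
  have hl : lift (u + v) = lift u + lift v := rfl
  simp only [covD, dZ, dX, dY, hl, fderiv_add h1 h2, Pi.add_apply, add_apply]
  module

theorem covD_smul (c : ℂ) (hu : IsSmooth u) {z : ℂ} (hz : 0 < z.im) :
    covD k (c • u) z = c • covD k u z := by
  have h1 : DifferentiableAt ℝ (lift u) z := (hu ⟨z, hz⟩).differentiableAt (by simp)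
  have hl : lift (c • u) = c • lift u := rfl
  simp only [covD, dZ, dX, dY, hl, fderiv_const_smul h1 c, Pi.smul_apply, smul_apply]
  module

theorem periodIntegral_add [CompleteSpace V] {v : ℍ → V} (hu : u ∈ cuspForms ρ k s)
    (hv : v ∈ cuspForms ρ k s) :
    periodIntegral k s (u + v) = periodIntegral k s u + periodIntegral k s v := by
  funext t
  rw [Pi.add_apply, periodIntegral, periodIntegral, periodIntegral, parCocycle, parCocycle,
    parCocycle, ← MeasureTheory.integral_add (integrableOn_etaPullback hu _ _ _)
      (integrableOn_etaPullback hv _ _ _)]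
  refine MeasureTheory.setIntegral_congr_fun measurableSet_Ioi fun τ hτ => ?_
  have hl : ∀ z, lift (u + v) z = lift u z + lift v z := fun _ => rfl
  simp only [etaPullback_zero_infty t hτ, greenCLM, wirt_apply, hl,
    covD_add hu.1 hv.1 (z := Complex.I * τ) (by simpa using hτ)]
  module

theorem periodIntegral_smul (c : ℂ) (hu : u ∈ cuspForms ρ k s) :
    periodIntegral k s (c • u) = c • periodIntegral k s u := by
  funext t
  rw [Pi.smul_apply, periodIntegral, periodIntegral, parCocycle, parCocycle,
    ← MeasureTheory.integral_smul]
  refine MeasureTheory.setIntegral_congr_fun measurableSet_Ioi fun τ hτ => ?_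
  have hl : ∀ z, lift (c • u) z = c • lift u z := fun _ => rfl
  simp only [etaPullback_zero_infty t hτ, greenCLM, wirt_apply, hl,
    covD_smul c hu.1 (z := Complex.I * τ) (by simpa using hτ)]
  module

/-- The map from cusp forms to period functions. -/
def periodMap [CompleteSpace V] (ρ : SL(2, ℤ) →* (V ≃ₗᵢ[ℂ] V)) (k : ℝ) (s : ℂ) :
    cuspForms ρ k s →ₗ[ℂ] periodFunctions ρ k s where
  toFun u := ⟨_, periodIntegral_restrict_mem u.2⟩
  map_add' u v := by
    ext t
    exact congrFun (periodIntegral_add u.2 v.2) _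
  map_smul' c u := by
    ext t
    exact congrFun (periodIntegral_smul c u.2) _

end MaassPeriod

end

noncomputable section

namespace MaassPeriod

open Filter Topology Complex

variable {V : Type*} [NormedAddCommGroup V] [InnerProductSpace ℂ V]
variable {ρ : SL(2, ℤ) →* (V ≃ₗᵢ[ℂ] V)} {k : ℝ} {s : ℂ}

/-! ### Extension of period functions to the projective line -/

/-- The extension of a function `φ` on the positive half-line with boundary values `a₀` and `a₁`
at `0` and `∞` to a function on the projective line that is anti-invariant under `S`. -/
def extendP1 (ρ : SL(2, ℤ) →* (V ≃ₗᵢ[ℂ] V)) (φ : OnePoint ℝ → V) (a₀ a₁ : V)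
    (t : OnePoint ℝ) : V :=
  t.elim a₁ fun x : ℝ => if 0 < x then φ (x : OnePoint ℝ) else if x = 0 then a₀ else
    -ρ matS⁻¹ (φ ((-x⁻¹ : ℝ) : OnePoint ℝ))

section Extension

variable {φ : OnePoint ℝ → V} {a₀ a₁ : V}

theorem extendP1_infty : extendP1 ρ φ a₀ a₁ OnePoint.infty = a₁ := rfl

theorem extendP1_zero : extendP1 ρ φ a₀ a₁ ((0 : ℝ) : OnePoint ℝ) = a₀ := by
  change (if (0 : ℝ) < 0 then _ else if (0 : ℝ) = 0 then a₀ else _) = a₀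
  simp

theorem extendP1_of_pos {x : ℝ} (hx : 0 < x) :
    extendP1 ρ φ a₀ a₁ (x : OnePoint ℝ) = φ (x : OnePoint ℝ) := if_pos hx

theorem extendP1_of_neg {x : ℝ} (hx : x < 0) :
    extendP1 ρ φ a₀ a₁ (x : OnePoint ℝ) = -ρ matS⁻¹ (φ ((-x⁻¹ : ℝ) : OnePoint ℝ)) := by
  change (if 0 < x then _ else if x = 0 then a₀ else _) = _
  rw [if_neg hx.not_gt, if_neg hx.ne]

/-- At negative points the relation is the definition; at positive points and at `0` it rests on `S²
= -1` and invariance under `-1`. -/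
theorem extendP1_eq_neg_prs (h1 : ∀ t : ℝ, 0 < t → ρ (-1)⁻¹ (φ (t : OnePoint ℝ)) = φ t)
    (h₁ : ρ (-1)⁻¹ a₁ = a₁) (ha : a₀ = -ρ matS a₁) :
    extendP1 ρ φ a₀ a₁ = -prs ρ k s matS (extendP1 ρ φ a₀ a₁) := by
  have hSS : ∀ v : V, ρ matS⁻¹ (ρ matS⁻¹ v) = ρ (-1)⁻¹ v := fun v => by
    rw [← matS_mul_matS, mul_inv_rev, map_mul]; rfl
  funext t
  rw [Pi.neg_apply, prs_matS]
  cases t with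
  | infty =>
    have : ρ matS⁻¹ (ρ matS a₁) = a₁ := by
      rw [map_inv]; exact (ρ matS).symm_apply_apply a₁
    rw [bdAct_matS_infty, extendP1_zero, extendP1_infty, ha, map_neg, neg_neg, this]
  | coe x =>
    rcases lt_trichotomy x 0 with hx | rfl | hx
    · rw [bdAct_matS_coe hx.ne, extendP1_of_neg hx, extendP1_of_pos (by
        rw [← inv_neg]; exact inv_pos.2 (neg_pos.2 hx))]
    · have : ρ matS⁻¹ a₁ = ρ matS a₁ := by
        conv_lhs => rw [← map_mul_inv_apply (ρ := ρ) matS (ρ matS⁻¹ a₁), hSS, h₁]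
      rw [bdAct_matS_zero, extendP1_zero, extendP1_infty, ha, this]
    · have hx' : -x⁻¹ < 0 := neg_neg_of_pos (inv_pos.2 hx)
      rw [bdAct_matS_coe hx.ne', extendP1_of_pos hx, extendP1_of_neg hx', map_neg, neg_neg, hSS,
        neg_inv, neg_neg, inv_inv, h1 x hx]

theorem analyticAt_extendP1 (hφ : ∀ t : ℝ, 0 < t → AnalyticAtP1 φ (t : OnePoint ℝ)) {t : ℝ}
    (ht : t ≠ 0) : AnalyticAtP1 (extendP1 ρ φ a₀ a₁) (t : OnePoint ℝ) := by
  change AnalyticAt ℝ (fun x : ℝ => extendP1 ρ φ a₀ a₁ (x : OnePoint ℝ)) t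
  rcases lt_or_gt_of_ne ht with h | h
  · have ht' : 0 < -t⁻¹ := by rw [← inv_neg]; exact inv_pos.2 (neg_pos.2 h)
    have h1 : AnalyticAt ℝ (fun x : ℝ => φ (x : OnePoint ℝ)) (-t⁻¹) := hφ _ ht'
    have h2 : AnalyticAt ℝ (fun x : ℝ => -x⁻¹) t := (analyticAt_id.inv ht).neg
    have h3 : AnalyticAt ℝ (fun x : ℝ => φ ((-x⁻¹ : ℝ) : OnePoint ℝ)) t :=
      AnalyticAt.fun_comp (g := fun x : ℝ => φ (x : OnePoint ℝ)) (f := fun x : ℝ => -x⁻¹) h1 h2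
    have h4 := (((((ρ matS⁻¹).toContinuousLinearEquiv :
      V →L[ℂ] V).restrictScalars ℝ).analyticAt _).fun_comp h3).neg
    refine h4.congr ?_
    filter_upwards [gt_mem_nhds h] with x hx
    exact (extendP1_of_neg hx).symm
  · have h1 : AnalyticAt ℝ (fun x : ℝ => φ (x : OnePoint ℝ)) t := hφ _ h
    refine h1.congr ?_
    filter_upwards [lt_mem_nhds h] with x hx
    exact (extendP1_of_pos hx).symm

/-- `x ↦ -1/x` carries `-∞` to `0` from the right and `0` from the left to `+∞`. The limits from the
negative side are thus `-ρ(S)⁻¹ a₀` at `∞` and `-ρ(S)⁻¹ a₁` at `0`, and `e0`, `e1` say that they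
match. -/
theorem continuous_extendP1 (hφ : ∀ t : ℝ, 0 < t → AnalyticAtP1 φ (t : OnePoint ℝ))
    (h0 : Tendsto (fun t : ℝ => φ (t : OnePoint ℝ)) (𝓝[>] 0) (𝓝 a₀))
    (h1 : Tendsto (fun t : ℝ => φ (t : OnePoint ℝ)) atTop (𝓝 a₁))
    (e0 : a₀ = -ρ matS⁻¹ a₁) (e1 : a₁ = -ρ matS⁻¹ a₀) :
    Continuous (extendP1 ρ φ a₀ a₁) := by
  have hcoe : ∀ t : ℝ, t ≠ 0 →
      ContinuousAt (fun x : ℝ => extendP1 ρ φ a₀ a₁ (x : OnePoint ℝ)) t := fun t ht =>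
    AnalyticAt.continuousAt (𝕜 := ℝ) (analyticAt_extendP1 hφ ht)
  have hneg : ∀ (l : Filter ℝ) (v : V), (∀ᶠ x in l, x < 0) →
      Tendsto (fun x : ℝ => φ ((-x⁻¹ : ℝ) : OnePoint ℝ)) l (𝓝 v) →
      Tendsto (fun x : ℝ => extendP1 ρ φ a₀ a₁ (x : OnePoint ℝ)) l (𝓝 (-ρ matS⁻¹ v)) := by
    intro l v hl hv
    refine ((((ρ matS⁻¹).continuous.tendsto v).comp hv).neg).congr' ?_
    filter_upwards [hl] with x hx
    exact (extendP1_of_neg hx).symm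
  rw [OnePoint.continuous_iff]
  constructor
  · rw [coclosedCompact_eq_cocompact, cocompact_eq_atBot_atTop, extendP1_infty]
    refine Tendsto.sup ?_ ?_
    · have h := hneg _ _ (eventually_lt_atBot 0) (h0.comp (tendsto_nhdsWithin_iff.2
        ⟨?_, ?_⟩) : Tendsto (fun x : ℝ => φ ((-x⁻¹ : ℝ) : OnePoint ℝ)) atBot (𝓝 a₀))
      · rwa [← e1] at h
      · simpa using (tendsto_inv_atBot_zero (𝕜 := ℝ)).neg
      · filter_upwards [eventually_lt_atBot (0 : ℝ)] with x hx
        rw [← inv_neg]; exact inv_pos.2 (neg_pos.2 hx)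
    · refine h1.congr' ?_
      filter_upwards [eventually_gt_atTop 0] with x hx
      exact (extendP1_of_pos hx).symm
  · refine continuous_iff_continuousAt.2 fun t => ?_
    rcases ne_or_eq t 0 with ht | rfl
    · exact hcoe t ht
    · rw [continuousAt_iff_continuous_left'_right']
      constructor
      · have h := hneg (𝓝[<] 0) a₁ self_mem_nhdsWithin
          (h1.comp (tendsto_neg_atBot_atTop.comp tendsto_inv_nhdsLT_zero))
        rw [← e0] at h
        rwa [ContinuousWithinAt, extendP1_zero]
      · rw [ContinuousWithinAt, extendP1_zero]
        refine h0.congr' ?_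
        filter_upwards [self_mem_nhdsWithin] with x hx
        exact (extendP1_of_pos hx).symm

end Extension

/-! ### The three-term relation -/

/-- For `g = S T'` this product and the next show, given `p|S = -p` and `p|(-1) = p`, that `|g`
takes `p|T` to `-p`, `-p` to `p|T'` and `p|T'` to `p|T`: it permutes the three terms of the relation
cyclically. -/
theorem matT_mul_matS_mul_matT' : matT * (matS * matT') = matS := by decide

theorem matT'_mul_matS_mul_matT' : matT' * (matS * matT') = -1 * matT := by decide

theorem dense_coe_compl_finite {A : Set ℝ} (hA : A.Finite) :
    Dense ((fun x : ℝ => (x : OnePoint ℝ)) '' Aᶜ) :=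
  OnePoint.denseRange_coe.dense_image OnePoint.continuous_coe (hA.countable.dense_compl ℝ)

/-- The three-term relation on the positive half-line implies the relation on the whole projective
line. -/
theorem three_term_of_pos {p : OnePoint ℝ → V} (hp : Continuous p)
    (hN : prs ρ k s (-1) p = p) (hS : p = -prs ρ k s matS p)
    (hpos : ∀ t : ℝ, 0 < t → p (t : OnePoint ℝ) =
      prs ρ k s matT p t + prs ρ k s matT' p t) :
    p = prs ρ k s matT p + prs ρ k s matT' p := by
  -- The defect `q` is invariant under `g = S T'`, acting as `x ↦ -1 - 1/x`. This map has order
  -- three and carries `(0, ∞)` to `(-∞, -1)`, that to `(-1, 0)`, and that back to `(0, ∞)`, so the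
  -- zeros on `(0, ∞)` propagate.
  set q := prs ρ k s matT p + prs ρ k s matT' p - p with hq
  have g1 := matT_mul_matS_mul_matT'
  have g2 := matT'_mul_matS_mul_matT'
  set g := matS * matT' with hg
  have hS' : prs ρ k s matS p = -p := by rw [eq_neg_iff_add_eq_zero]; nth_rw 2 [hS]; simp
  have hinv : prs ρ k s g q = q := by
    have e1 : prs ρ k s g (prs ρ k s matT p) = -p := by rw [prs_prs, g1, hS']
    have e2 : prs ρ k s g (prs ρ k s matT' p) = prs ρ k s matT p := by
      rw [prs_prs, g2, ← prs_prs, hN]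
    have e3 : prs ρ k s g p = -prs ρ k s matT' p := by
      rw [hg, ← prs_prs, hS', prs_neg]
    rw [hq, sub_eq_add_neg, prs_add, prs_add, prs_neg, e1, e2, e3]
    abel
  have hcq : Continuous q := ((continuous_prs hp _).add (continuous_prs hp _)).sub hp
  have hzero : ∀ t, q t = 0 ↔ q (bdAct g t) = 0 := by
    intro t
    have h := congrFun hinv t
    rw [prs_apply] at h
    rw [← h, smul_eq_zero_iff_right (bdFactor_ne_zero s k g t)]
    exact (ρ g⁻¹).map_eq_zero_iff
  have hq0 : ∀ t : ℝ, 0 < t → q (t : OnePoint ℝ) = 0 := fun t ht => by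
    rw [hq, Pi.sub_apply, Pi.add_apply, ← hpos t ht, sub_self]
  have hgt : ∀ x : ℝ, x ≠ 0 → x + 1 ≠ 0 →
      bdAct g (x : OnePoint ℝ) = ((-(x / (x + 1))⁻¹ : ℝ) : OnePoint ℝ) := fun x h1 h2 => by
    rw [hg, bdAct_mul, bdAct_matT'_coe h2, bdAct_matS_coe (div_ne_zero h1 h2)]
  have hall : ∀ x : ℝ, x ∈ ({0, -1} : Set ℝ)ᶜ → q (x : OnePoint ℝ) = 0 := by
    intro x hx
    simp only [Set.mem_compl_iff, Set.mem_insert_iff, Set.mem_singleton_iff, not_or] at hx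
    have hx1 : x + 1 ≠ 0 := fun h => hx.2 (by linarith)
    rcases lt_or_gt_of_ne hx.1 with h | h
    · rcases lt_or_gt_of_ne hx1 with h' | h'
      -- `-1/(x + 1)` is the positive point that `g` maps to `x`.
      · have hy : 0 < (-(x + 1))⁻¹ := inv_pos.2 (neg_pos.2 h')
        have hy1 : (-(x + 1))⁻¹ + 1 = x / (x + 1) := by
          field_simp; ring
        have := (hzero _).1 (hq0 _ hy)
        rw [hgt _ hy.ne' (by linarith), hy1] at this
        have e : -((-(x + 1))⁻¹ / (x / (x + 1)))⁻¹ = x := by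
          have := hx.1
          field_simp
        rwa [e] at this
      · rw [hzero, hgt x hx.1 hx1]
        refine hq0 _ ?_
        rw [← inv_neg]
        exact inv_pos.2 (neg_pos.2 (div_neg_of_neg_of_pos h h'))
    · exact hq0 x h
  -- The points `0`, `-1` and `∞` left over are reached by density and continuity.
  have hfin : q = 0 := by
    refine Continuous.ext_on (dense_coe_compl_finite (A := {0, -1}) (by simp)) hcq
      continuous_const ?_
    rintro _ ⟨x, hx, rfl⟩
    exact hall x hx
  exact (sub_eq_zero.1 hfin).symm

/-- `p = -p|S` determines `p` on the negative half-line from the positive one, and continuity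
settles `0` and `∞`. -/
theorem ext_of_pos {p p' : OnePoint ℝ → V} (hp : Continuous p) (hp' : Continuous p')
    (hS : p = -prs ρ k s matS p) (hS' : p' = -prs ρ k s matS p')
    (h : ∀ t : ℝ, 0 < t → p (t : OnePoint ℝ) = p' (t : OnePoint ℝ)) : p = p' := by
  refine Continuous.ext_on (dense_coe_compl_finite (A := {0}) (by simp)) hp hp' ?_
  rintro _ ⟨x, hx, rfl⟩
  have hx0 : x ≠ 0 := hx
  rcases lt_or_gt_of_ne hx0 with h' | h'
  · have hy : 0 < -x⁻¹ := by rw [← inv_neg]; exact inv_pos.2 (neg_pos.2 h')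
    have e1 := congrFun hS (x : OnePoint ℝ)
    have e2 := congrFun hS' (x : OnePoint ℝ)
    rw [Pi.neg_apply, prs_matS, bdAct_matS_coe hx0] at e1 e2
    simp only
    rw [e1, e2, h _ hy]
  · exact h x h'

/-- Period functions extend uniquely to the projective line. -/
theorem existsUnique_extension {f : Set.Ioi (0 : ℝ) → V} (hf : f ∈ periodFunctions ρ k s) :
    ∃! p : OnePoint ℝ → V, IsSemiAnalytic p ∧ EigenNegOne ρ k s p ∧ PeriodRelations ρ k s p ∧
      AnalyticOffZeroInfty p ∧ ∀ t : Set.Ioi (0 : ℝ), p ((t : ℝ) : OnePoint ℝ) = f t := by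
  classical
  obtain ⟨f1, f2, f3, ⟨a₀, a₁, f4, f5, f6⟩, -⟩ := hf
  set φ := extZero f with hφ
  have n1 : ∀ t : ℝ, 0 < t → ρ (-1)⁻¹ (φ (t : OnePoint ℝ)) = φ t := fun t ht => by
    rw [← prs_neg_one (k := k) (s := s)]; exact f2 t ht
  -- The fixed space of `ρ(-1)⁻¹` is closed, so the boundary values inherit invariance under `-1`.
  have nlim : ∀ (l : Filter ℝ) [l.NeBot] (v : V), (∀ᶠ x in l, 0 < x) →
      Tendsto (fun t : ℝ => φ (t : OnePoint ℝ)) l (𝓝 v) → ρ (-1)⁻¹ v = v := by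
    intro l _ v hl hv
    refine tendsto_nhds_unique ((((ρ (-1)⁻¹).continuous.tendsto v).comp hv).congr' ?_) hv
    filter_upwards [hl] with x hx using n1 x hx
  have nI : ρ (-1)⁻¹ a₁ = a₁ := nlim atTop a₁ (eventually_gt_atTop 0) f4
  have n0 : ρ (-1)⁻¹ a₀ = a₀ := nlim (𝓝[>] 0) a₀ self_mem_nhdsWithin f5
  set p := extendP1 ρ φ a₀ a₁ with hp
  have hS : p = -prs ρ k s matS p := extendP1_eq_neg_prs n1 nI f6
  have e0 : a₀ = -ρ matS⁻¹ a₁ := by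
    have h := congrFun hS ((0 : ℝ) : OnePoint ℝ)
    rwa [Pi.neg_apply, prs_matS, bdAct_matS_zero, hp, extendP1_zero, extendP1_infty] at h
  have e1 : a₁ = -ρ matS⁻¹ a₀ := by
    have h := congrFun hS OnePoint.infty
    rwa [Pi.neg_apply, prs_matS, bdAct_matS_infty, hp, extendP1_zero, extendP1_infty] at h
  have hc : Continuous p := continuous_extendP1 f1 f5 f4 e0 e1
  have ha : ∀ t : ℝ, t ≠ 0 → AnalyticAtP1 p (t : OnePoint ℝ) := fun t ht =>
    analyticAt_extendP1 f1 ht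
  have hcomm : ∀ v : V, ρ (-1)⁻¹ (ρ matS⁻¹ v) = ρ matS⁻¹ (ρ (-1)⁻¹ v) := fun v => by
    have e : (-1 : SL(2, ℤ))⁻¹ * matS⁻¹ = matS⁻¹ * (-1)⁻¹ := by decide
    have : ρ ((-1)⁻¹ * matS⁻¹) v = ρ (matS⁻¹ * (-1)⁻¹) v := by rw [e]
    rw [map_mul, map_mul] at this
    exact this
  have hN : prs ρ k s (-1) p = p := by
    funext t
    rw [prs_neg_one]
    cases t with
    | infty => exact nI
    | coe x =>
      rcases lt_trichotomy x 0 with hx | rfl | hx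
      · have hy : 0 < -x⁻¹ := by rw [← inv_neg]; exact inv_pos.2 (neg_pos.2 hx)
        rw [hp, extendP1_of_neg hx, map_neg, hcomm, n1 _ hy]
      · rw [hp, extendP1_zero]; exact n0
      · rw [hp, extendP1_of_pos hx]; exact n1 x hx
  have hpf : ∀ t : ℝ, 0 < t → p (t : OnePoint ℝ) = φ (t : OnePoint ℝ) := fun t ht =>
    extendP1_of_pos ht
  have hT : p = prs ρ k s matT p + prs ρ k s matT' p := by
    refine three_term_of_pos hc hN hS fun t ht => ?_
    have ht1 : 0 < t + 1 := by linarith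
    have h3 := f3 t ht
    rw [prs_apply, prs_apply, bdAct_matT_coe, bdAct_matT'_coe ht1.ne'] at h3 ⊢
    rw [hpf t ht, hpf _ ht1, hpf _ (div_pos ht ht1)]
    exact h3
  refine ⟨p, ⟨⟨hc, {((0 : ℚ) : OnePoint ℚ), OnePoint.infty}, fun t ht => ?_⟩, hN, ⟨hS, hT⟩,
    ⟨ha, hc⟩, fun t => ?_⟩, ?_⟩
  · cases t with
    | infty => exact absurd rfl (ht OnePoint.infty (by simp))
    | coe x =>
      refine ha x fun hx => ht ((0 : ℚ) : OnePoint ℚ) (by simp) ?_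
      rw [hx, cuspToReal, OnePoint.map_some, Rat.cast_zero]
  · rw [hpf t t.2, hφ, extZero_of_pos f t.2]
  · rintro p' ⟨⟨hc', -⟩, -, ⟨hS', -⟩, -, hf'⟩
    refine ext_of_pos hc' hc hS' hS fun t ht => ?_
    rw [hpf t ht, hφ, extZero_of_pos f ht]
    exact hf' ⟨t, ht⟩

end MaassPeriod

end

/-! ### The proposition. -/

theorem mainTheorem5 {V : Type*} [NormedAddCommGroup V] [InnerProductSpace ℂ V]
    [FiniteDimensional ℂ V] (ρ : SL(2, ℤ) →* (V ≃ₗᵢ[ℂ] V)) (k : ℝ) (s : ℂ) :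
    (∀ u ∈ MaassPeriod.cuspForms ρ k s,
      (∀ (ξ₁ ξ₂ : OnePoint ℚ) (t : OnePoint ℝ), MeasureTheory.IntegrableOn
        (MaassPeriod.etaPullback k s u ξ₁ ξ₂ t) (Set.Ioi (0 : ℝ)) MeasureTheory.volume) ∧
      MaassPeriod.EigenNegOne ρ k s (MaassPeriod.periodIntegral k s u) ∧
      MaassPeriod.PeriodRelations ρ k s (MaassPeriod.periodIntegral k s u) ∧
      MaassPeriod.AnalyticOffZeroInfty (MaassPeriod.periodIntegral k s u) ∧
      MaassPeriod.HasHolomorphicExtension (MaassPeriod.periodIntegral k s u) ∧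
      (∀ ξ₁ ξ₂ : OnePoint ℚ, ∃ (m : ℕ) (γ : Fin m → SL(2, ℤ)),
        MaassPeriod.parCocycle k s u ξ₁ ξ₂ =
          ∑ j, MaassPeriod.prs ρ k s (γ j) (MaassPeriod.periodIntegral k s u))) ∧
    (∃ pf : MaassPeriod.cuspForms ρ k s →ₗ[ℂ] MaassPeriod.periodFunctions ρ k s,
      ∀ (u : MaassPeriod.cuspForms ρ k s) (t : Set.Ioi (0 : ℝ)),
        (pf u : Set.Ioi (0 : ℝ) → V) t =
          MaassPeriod.periodIntegral k s (u : ℍ → V) ((t : ℝ) : OnePoint ℝ)) ∧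
    (∀ f : MaassPeriod.periodFunctions ρ k s, ∃! p : OnePoint ℝ → V,
      MaassPeriod.IsSemiAnalytic p ∧
      MaassPeriod.EigenNegOne ρ k s p ∧
      MaassPeriod.PeriodRelations ρ k s p ∧
      MaassPeriod.AnalyticOffZeroInfty p ∧
      ∀ t : Set.Ioi (0 : ℝ), p ((t : ℝ) : OnePoint ℝ) = (f : Set.Ioi (0 : ℝ) → V) t) := by
  have : CompleteSpace V := FiniteDimensional.complete ℂ V
  refine ⟨fun u hu => ⟨fun ξ₁ ξ₂ t => MaassPeriod.integrableOn_etaPullback hu ξ₁ ξ₂ t,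
    MaassPeriod.periodIntegral_eigen hu, MaassPeriod.periodIntegral_relations hu,
    MaassPeriod.periodIntegral_analytic hu, MaassPeriod.periodIntegral_hasHolomorphicExtension hu,
    MaassPeriod.exists_parCocycle_eq_sum hu⟩,
    ⟨MaassPeriod.periodMap ρ k s, fun _ _ => rfl⟩,
    fun f => MaassPeriod.existsUnique_extension f.2⟩
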